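/- **Theorem.** An instance of the min-cost popular matching problem consists of a finite bipartite graph $G=(\mathcal A\cup\mathcal B,E)$ with $n_1=|\mathcal A|$ people and $m=|E|$ edges, a rank (a natural number) for every edge, a number $\mathsf{copies}(b)\in\mathbb N$ of copies and a real price $\mathsf{cost}(b)\ge 0$ for every item $b\in\mathcal B$. A person $a$ prefers the item $b$ to the item $b'$ if the edge $(a,b)$ has smaller rank than the edge $(a,b')$; equal ranks are ties. A matching $M$ matches every person to at most one adjacent item, and every item $b$ to at most $\mathsf{copies}(b)$ people. A person prefers $M$ to $M'$ if she is matched in $M$ and unmatched in $M'$, or is matched in both and prefers $M(a)$ to $M'(a)$. $M$ is popular if for no matching $M'$ the number of people who prefer $M'$ to $M$ exceeds the number of people who prefer $M$ to $M'$. The cost of $M$ is $\sum_{b} k_M(b)\,\mathsf{cost}(b)$, where $k_M(b)$ is the number of people matched to $b$ in $M$. There is an $O(mn_1)$ time algorithm that decides whether a given instance admits a popular matching and, if so, computes one of minimum cost among all popular matchings. Precisely, there are one program for a unit-cost random access machine and one constant $C$ such that on every instance the program halts after at most $C(mn_1+1)$ steps, with verdict $1$ and a minimum-cost popular matching as output if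 a popular matching exists, and with verdict $0$ otherwise. (The machine stores natural numbers in registers and arrays, which are zero except for the input, and can add, subtract, compare and address its arrays indirectly, each in one step; the prices are real numbers in a read-only array, and the only operation on them is a one-step comparison of two of them. The input is the numbers of people, items and edges, a list of the edges with their ranks in arbitrary order, and the tables of copies and prices.) -/

import Mathlib

open scoped NNReal

namespace PopMatch

/-! ## Instances, matchings, popularity, cost -/

/-- An instance of the min-cost popular matching problem. The people are the elements of `Fin n₁`,
the items those of `Fin n₂`; the `m` edges of the (simple) bipartite graph are listed in an
arbitrary order, edge number `e` joining the person `person e` to the item `item e` with rank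
`rank e`. Equal ranks are ties. -/
structure Inst where
  n₁ : ℕ
  n₂ : ℕ
  m : ℕ
  person : Fin m → Fin n₁
  item : Fin m → Fin n₂
  rank : Fin m → ℕ
  simple : ∀ e e' : Fin m, person e = person e' → item e = item e' → e = e'
  copies : Fin n₂ → ℕ
  cost : Fin n₂ → ℝ≥0

namespace Inst

variable (I : Inst)

/-- The graph contains the edge `(a, b)`, and its rank is `r`. -/
def EdgeOfRank (a : Fin I.n₁) (b : Fin I.n₂) (r : ℕ) : Prop :=
  ∃ e : Fin I.m, I.person e = a ∧ I.item e = b ∧ I.rank e = r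

/-- An assignment of at most one item to every person; `none` means unmatched. -/
abbrev Assignment : Type := Fin I.n₁ → Option (Fin I.n₂)

variable {I}

/-- The number of people that are matched to `b`, that is, the number of copies of `b` in use. -/
def used (M : I.Assignment) (b : Fin I.n₂) : ℕ :=
  (Finset.univ.filter fun a : Fin I.n₁ => M a = some b).card

/-- A matching uses only edges of the graph and at most `copies b` copies of every item `b`. -/
def IsMatching (M : I.Assignment) : Prop :=
  (∀ a b, M a = some b → ∃ r, I.EdgeOfRank a b r) ∧ ∀ b, used M b ≤ I.copies b

/-- The person `a` prefers `M` to `M'`. -/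
def Prefers (a : Fin I.n₁) (M M' : I.Assignment) : Prop :=
  (M a ≠ none ∧ M' a = none) ∨
    ∃ b b' r r', M a = some b ∧ M' a = some b' ∧
      I.EdgeOfRank a b r ∧ I.EdgeOfRank a b' r' ∧ r < r'

open Classical in
/-- The number of people who prefer `M` to `M'`. -/
noncomputable def votes (M M' : I.Assignment) : ℕ :=
  (Finset.univ.filter fun a : Fin I.n₁ => Prefers a M M').card

/-- `M` is more popular than `M'`. -/
def MorePopular (M M' : I.Assignment) : Prop := votes M' M < votes M M'

/-- A popular matching: a matching such that no matching is more popular. -/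
def IsPopular (M : I.Assignment) : Prop :=
  IsMatching M ∧ ∀ M' : I.Assignment, IsMatching M' → ¬ MorePopular M' M

/-- The cost of `M`: every used copy of an item `b` costs `cost b`. -/
noncomputable def totalCost (M : I.Assignment) : ℝ≥0 :=
  ∑ b : Fin I.n₂, used M b • I.cost b

/-- A popular matching of minimum cost among all popular matchings. -/
def IsMinCostPopular (M : I.Assignment) : Prop :=
  IsPopular M ∧ ∀ M' : I.Assignment, IsPopular M' → totalCost M ≤ totalCost M'

end Inst

/-! ## A random access machine with a step count

The machine has registers and arrays (numbered by naturals; a program mentions only finitely many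
of them), whose cells hold natural numbers. It can add, subtract (truncated at `0`), compare, and
read and write the array cell whose index it has computed; there is no multiplication. The costs of
the items are real numbers in a read-only array; the only access to them is to compare two of them.
Every operation takes one unit of time. Programs are structured (sequence, branch, loop). -/

/-- The memory of the machine: registers `reg x` and array cells `mem A i`. -/
structure State where
  reg : ℕ → ℕ
  mem : ℕ → ℕ → ℕ

/-- Arithmetic expressions; `get A i` is the cell of the array `A` with index `i`. -/
inductive Expr : Type
  | const (k : ℕ)
  | var (x : ℕ)
  | get (A : ℕ) (i : Expr)
  | add (e f : Expr)
  | sub (e f : Expr)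

namespace Expr

def eval (s : State) : Expr → ℕ
  | const k => k
  | var x => s.reg x
  | get A i => s.mem A (i.eval s)
  | add e f => e.eval s + f.eval s
  | sub e f => e.eval s - f.eval s

/-- The number of operations of the expression: the time to evaluate it. -/
def time : Expr → ℕ
  | const _ => 1
  | var _ => 1
  | get _ i => i.time + 1
  | add e f => e.time + f.time + 1
  | sub e f => e.time + f.time + 1

end Expr

/-- Tests; `costLe i j` compares the costs of the items with the numbers `i` and `j`. -/
inductive Test : Type
  | eq (e f : Expr)
  | lt (e f : Expr)
  | costLe (i j : Expr)
  | not (c : Test)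
  | and (c d : Test)

namespace Test

/-- The test succeeds, where `p` is the read-only array of costs. -/
def Holds (p : ℕ → ℝ≥0) (s : State) : Test → Prop
  | eq e f => e.eval s = f.eval s
  | lt e f => e.eval s < f.eval s
  | costLe i j => p (i.eval s) ≤ p (j.eval s)
  | not c => ¬ c.Holds p s
  | and c d => c.Holds p s ∧ d.Holds p s

/-- The time to evaluate the test. -/
def time : Test → ℕ
  | eq e f => e.time + f.time + 1
  | lt e f => e.time + f.time + 1
  | costLe i j => i.time + j.time + 1
  | not c => c.time + 1
  | and c d => c.time + d.time + 1

end Test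

/-- Programs. -/
inductive Prog : Type
  | skip
  | assign (x : ℕ) (e : Expr)
  | store (A : ℕ) (i e : Expr)
  | seq (P Q : Prog)
  | branch (c : Test) (P Q : Prog)
  | loop (c : Test) (P : Prog)

/-- `Exec p P s t s'`: with the costs `p`, the program `P` started in the memory `s` halts after
exactly `t` steps with the memory `s'`. -/
inductive Exec (p : ℕ → ℝ≥0) : Prog → State → ℕ → State → Prop
  | skip (s : State) : Exec p .skip s 1 s
  | assign (x : ℕ) (e : Expr) (s : State) :
      Exec p (.assign x e) s (e.time + 1)
        { s with reg := Function.update s.reg x (e.eval s) }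
  | store (A : ℕ) (i e : Expr) (s : State) :
      Exec p (.store A i e) s (i.time + e.time + 1)
        { s with mem :=
          Function.update s.mem A (Function.update (s.mem A) (i.eval s) (e.eval s)) }
  | seq {P Q : Prog} {s s₁ s₂ : State} {t₁ t₂ : ℕ} :
      Exec p P s t₁ s₁ → Exec p Q s₁ t₂ s₂ → Exec p (.seq P Q) s (t₁ + t₂) s₂
  | branch_true {c : Test} {P Q : Prog} {s s₁ : State} {t : ℕ} :
      c.Holds p s → Exec p P s t s₁ → Exec p (.branch c P Q) s (c.time + 1 + t) s₁
  | branch_false {c : Test} {P Q : Prog} {s s₁ : State} {t : ℕ} :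
      ¬ c.Holds p s → Exec p Q s t s₁ → Exec p (.branch c P Q) s (c.time + 1 + t) s₁
  | loop_false {c : Test} {P : Prog} {s : State} :
      ¬ c.Holds p s → Exec p (.loop c P) s (c.time + 1) s
  | loop_true {c : Test} {P : Prog} {s s₁ s₂ : State} {t₁ t₂ : ℕ} :
      c.Holds p s → Exec p P s t₁ s₁ → Exec p (.loop c P) s₁ t₂ s₂ →
        Exec p (.loop c P) s (c.time + 1 + t₁ + t₂) s₂

/-- The machine is deterministic: running time and final memory are unique. -/
theorem Exec.deterministic {p : ℕ → ℝ≥0} {P : Prog} {s s₁ s₂ : State} {t₁ t₂ : ℕ}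
    (h₁ : Exec p P s t₁ s₁) (h₂ : Exec p P s t₂ s₂) : t₁ = t₂ ∧ s₁ = s₂ := by
  induction h₁ generalizing t₂ s₂ with
  | skip | assign | store => cases h₂; exact ⟨rfl, rfl⟩
  | seq _ _ ih₁ ih₂ =>
    cases h₂ with
    | seq k₁ k₂ =>
      obtain ⟨rfl, rfl⟩ := ih₁ k₁
      obtain ⟨rfl, rfl⟩ := ih₂ k₂
      exact ⟨rfl, rfl⟩
  | branch_true hc _ ih =>
    cases h₂ with
    | branch_true _ k => obtain ⟨rfl, rfl⟩ := ih k; exact ⟨rfl, rfl⟩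
    | branch_false hn _ => exact absurd hc hn
  | branch_false hn _ ih =>
    cases h₂ with
    | branch_true hc _ => exact absurd hc hn
    | branch_false _ k => obtain ⟨rfl, rfl⟩ := ih k; exact ⟨rfl, rfl⟩
  | loop_false hn =>
    cases h₂ with
    | loop_false _ => exact ⟨rfl, rfl⟩
    | loop_true hc _ _ => exact absurd hc hn
  | loop_true hc _ _ ih₁ ih₂ =>
    cases h₂ with
    | loop_false hn => exact absurd hc hn
    | loop_true _ k₁ k₂ =>
      obtain ⟨rfl, rfl⟩ := ih₁ k₁
      obtain ⟨rfl, rfl⟩ := ih₂ k₂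
      exact ⟨rfl, rfl⟩

/-! ## Input and output conventions -/

/-- The array with the given entries, followed by zeros. -/
def pad {α : Type} [Zero α] {n : ℕ} (v : Fin n → α) (i : ℕ) : α :=
  if h : i < n then v ⟨i, h⟩ else 0

namespace Inst

/-- The memory at the start: the registers `0`, `1`, `2` hold the numbers of people, items and
edges; the arrays `0`, `1`, `2` hold the person, the item and the rank of every edge; the array `3`
holds the numbers of copies; everything else is zero. -/
def input (I : Inst) : State where
  reg
    | 0 => I.n₁
    | 1 => I.n₂
    | 2 => I.m
    | _ => 0
  mem
    | 0 => pad fun e => (I.person e : ℕ)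
    | 1 => pad fun e => (I.item e : ℕ)
    | 2 => pad I.rank
    | 3 => pad I.copies
    | _ => fun _ => 0

/-- The read-only array of the costs of the items. -/
def costArray (I : Inst) : ℕ → ℝ≥0 := pad I.cost

/-- The array `4` of `s` holds the matching `M`: the cell of the person `a` holds `0` if `a` is
unmatched, and `b + 1` if `a` is matched to the item with the number `b`. -/
def Outputs {I : Inst} (s : State) (M : I.Assignment) : Prop :=
  ∀ a : Fin I.n₁, s.mem 4 a = (M a).elim 0 fun b => (b : ℕ) + 1

end Inst

end PopMatch

namespace PopMatch

open Finset

/-! ## Assignments on the naturals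

The people are the numbers below `n`, the items are positive numbers, and an assignment is a
function `M : ℕ → ℕ`, with `M a = 0` if `a` is unmatched. -/

/-! Give every person a last resort of her own, of capacity one and ranked below everything else.
Matchings then become complete assignments, with the same votes and the same cost
(`Represents.votes_eq`, `Represents.popular_iff`, `Represents.totalCost_eq`).

Take a maximum matching of the graph of top choices, and let `N` be the set of items from which no
item with spare capacity can be reached by moving people along top choices. A complete assignment is
popular exactly if it fills `N` and gives everybody either a best item outside `N`, or a top item in
`N` provided that she has no top item outside `N` (`Market.Good`). Sufficiency
(`Market.Good.popular`) is counting: whoever gains must enter `N`, which is already full, so for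
each of them somebody leaves `N` and loses. Necessity (`Market.Popular.good`) rests on an exchange
argument (`Market.Popular.promote`): if somebody prefers an item from which a free item can be
reached, a short chain of moves beats the matching. By `IsPartial.transfer` all maximum matchings
have the same closed full sets containing the unmatched state, so `N` may be computed from any of
them.

Popular matchings are therefore the complete matchings of the allowed edges that fill `N`. As costs
sit on items, the greedy method works: augment from the unmatched people, each time to the reachable
free item of least weight, where items of `N` come before all others. Its correctness is carried by
the certificate `IsOpt`, a closed set for every lower set of weights, which augmentations preserve
(`Augments.isOpt`). The certificate implies that the final matching meets every lower set at least
as often as any competitor (`IsOpt.card_le`). The lowest such set shows that `N` gets filled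
whenever this is possible, and all of them together give minimum cost (`sum_le_sum_of_card_le`,
`IsOpt.good_and_cheapest`).

One breadth first search takes time linear in `m + n₁`, because only items that occur in edges are
ever touched. People without edges get their last resorts at once, so each of the three search
stages (top choices, computation of `N`, allowed edges) needs at most `min m n₁ + 1` searches. For
`m > 0` the product is of order `m * n₁`; the case `m = 0` is answered in constant time. Programs
are verified with `WP`, which bounds time and result together, and `Frame`, which says what a
program leaves alone. -/

/-- The number of people below `n` that `M` sends to `x`. -/
def load (n : ℕ) (M : ℕ → ℕ) (x : ℕ) : ℕ := #{a ∈ range n | M a = x}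

/-- Both indicators are added, one on each side, so no subtraction of naturals occurs and `y = M a`
needs no separate case. -/
theorem load_update {n : ℕ} (M : ℕ → ℕ) {a : ℕ} (ha : a < n) (y x : ℕ) :
    load n (Function.update M a y) x + (if x = M a then 1 else 0) =
      load n M x + (if x = y then 1 else 0) := by
  unfold load
  have h : range n = insert a ((range n).erase a) := (insert_erase (mem_range.2 ha)).symm
  have e : #{b ∈ (range n).erase a | Function.update M a y b = x} =
      #{b ∈ (range n).erase a | M b = x} := by
    congr 1
    apply filter_congr
    intro b hb
    rw [Function.update_of_ne (ne_of_mem_erase hb)]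
  rw [h, filter_insert, filter_insert, Function.update_self]
  have na : ∀ p : ℕ → Prop, [DecidablePred p] → a ∉ ((range n).erase a).filter p := by
    intro p _; simp
  by_cases h1 : y = x <;> by_cases h2 : M a = x <;>
    (try subst h1) <;> simp_all [eq_comm]

theorem load_pos {n : ℕ} {M : ℕ → ℕ} {x : ℕ} : 0 < load n M x ↔ ∃ a < n, M a = x := by
  simp [load, card_pos, Finset.Nonempty]

theorem load_congr {n : ℕ} {M K : ℕ → ℕ} (h : ∀ a < n, M a = K a) (x : ℕ) :
    load n M x = load n K x := by
  unfold load
  congr 1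
  exact filter_congr fun a ha => by rw [h a (mem_range.1 ha)]

theorem card_mem_eq_sum_load {n : ℕ} (M : ℕ → ℕ) (Z : Set ℕ) [DecidablePred (· ∈ Z)] (F : Finset ℕ)
    (hF : ∀ a < n, M a ∈ Z → M a ∈ F) :
    #{a ∈ range n | M a ∈ Z} = ∑ x ∈ F with x ∈ Z, load n M x := by
  rw [card_eq_sum_card_fiberwise (f := M) (t := F.filter (· ∈ Z))]
  · apply sum_congr rfl
    intro x hx
    unfold load
    rw [filter_filter]
    congr 1
    apply filter_congr
    intro a _
    constructor
    · exact fun h => h.2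
    · rintro rfl; exact ⟨(mem_filter.1 hx).2, rfl⟩
  · intro a ha
    have := mem_filter.1 ha
    simp [this.2, hF a (mem_range.1 this.1) this.2]

theorem card_mem_le {n : ℕ} {M K : ℕ → ℕ} {Z : Set ℕ} [DecidablePred (· ∈ Z)] (h : ∀ x ∈ Z, load n K x ≤ load n M x) :
    #{a ∈ range n | K a ∈ Z} ≤ #{a ∈ range n | M a ∈ Z} := by
  have hF : ∀ L : ℕ → ℕ, L = M ∨ L = K → ∀ a < n, L a ∈ Z →
      L a ∈ (range n).image M ∪ (range n).image K := by
    rintro L (rfl | rfl) a ha _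
    · exact mem_union_left _ (mem_image_of_mem _ (mem_range.2 ha))
    · exact mem_union_right _ (mem_image_of_mem _ (mem_range.2 ha))
  have e1 := card_mem_eq_sum_load K Z _ (hF K (Or.inr rfl))
  have e2 := card_mem_eq_sum_load M Z _ (hF M (Or.inl rfl))
  have e3 := sum_le_sum (s := ((range n).image M ∪ (range n).image K).filter (· ∈ Z))
    fun x hx => h x (mem_filter.1 hx).2
  rwa [← e1, ← e2] at e3

/-- If `K` does not exceed `M` anywhere on `Z`, but sends as many people to `Z`, then the two
assignments have the same loads on `Z`. -/
theorem load_eq_of_card_mem_le {n : ℕ} {M K : ℕ → ℕ} {Z : Set ℕ}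
    (h : ∀ x ∈ Z, load n K x ≤ load n M x)
    [DecidablePred (· ∈ Z)]
    (hc : #{a ∈ range n | M a ∈ Z} ≤ #{a ∈ range n | K a ∈ Z}) :
    ∀ x ∈ Z, load n K x = load n M x := by
  intro x hx
  by_contra hne
  have hlt : load n K x < load n M x := lt_of_le_of_ne (h x hx) hne
  have hF : ∀ L : ℕ → ℕ, L = M ∨ L = K → ∀ a < n, L a ∈ Z →
      L a ∈ (range n).image M ∪ (range n).image K := by
    rintro L (rfl | rfl) a ha _
    · exact mem_union_left _ (mem_image_of_mem _ (mem_range.2 ha))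
    · exact mem_union_right _ (mem_image_of_mem _ (mem_range.2 ha))
  have e1 := card_mem_eq_sum_load K Z _ (hF K (Or.inr rfl))
  have e2 := card_mem_eq_sum_load M Z _ (hF M (Or.inl rfl))
  obtain ⟨a, ha, rfl⟩ := load_pos.1 (lt_of_le_of_lt (Nat.zero_le _) hlt)
  have := sum_lt_sum (s := ((range n).image M ∪ (range n).image K).filter (· ∈ Z))
    (f := load n K) (g := load n M) (fun x hx => h x (mem_filter.1 hx).2)
    ⟨M a, mem_filter.2 ⟨hF M (Or.inl rfl) a ha hx, hx⟩, hlt⟩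
  rw [← e1, ← e2] at this
  exact absurd hc (not_le.2 this)

/-! ### Closed sets, full sets and paths of moves -/

/-- The set `Z` of items is closed under moving a person from her item in `Z` along `R`. -/
def Closed (n : ℕ) (R : ℕ → ℕ → Prop) (M : ℕ → ℕ) (Z : Set ℕ) : Prop :=
  ∀ a < n, M a ∈ Z → ∀ b, R a b → b ∈ Z

/-- All items in `Z` are used to capacity by `M`. -/
def Full (n : ℕ) (cap M : ℕ → ℕ) (Z : Set ℕ) : Prop :=
  ∀ b ∈ Z, b ≠ 0 → cap b ≤ load n M b

/-- `M` is a partial matching of the graph `R` with the capacities `cap`. -/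
def IsPartial (n : ℕ) (R : ℕ → ℕ → Prop) (cap M : ℕ → ℕ) : Prop :=
  (∀ a < n, M a ≠ 0 → R a (M a)) ∧ ∀ b ≠ 0, load n M b ≤ cap b

/-- The items from which `y` can be reached in at most `k` moves of people along `R`. -/
def layer (n : ℕ) (R : ℕ → ℕ → Prop) (M : ℕ → ℕ) (y : ℕ) : ℕ → Set ℕ
  | 0 => {y}
  | k + 1 => layer n R M y k ∪ {x | ∃ a < n, M a = x ∧ ∃ z ∈ layer n R M y k, R a z}

/-- One unit of load can be moved from `x` to `y` along a path of moves. -/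
theorem exists_shift {n : ℕ} {R : ℕ → ℕ → Prop} (hR : ∀ a b, R a b → b ≠ 0) (M : ℕ → ℕ) (y : ℕ)
    (k : ℕ) : ∀ x ∈ layer n R M y k, x ≠ 0 → ∃ K : ℕ → ℕ,
      (∀ a, K a ≠ M a → M a ∈ layer n R M y k ∧ M a ≠ 0 ∧ R a (K a)) ∧
      ∀ v, load n K v + (if v = x then 1 else 0) = load n M v + (if v = y then 1 else 0) := by
  induction k with
  | zero =>
    rintro x rfl _
    exact ⟨M, fun a h => absurd rfl h, fun v => rfl⟩
  | succ k ih =>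
    intro x hx hx0
    by_cases hk : x ∈ layer n R M y k
    · obtain ⟨K, h1, h2⟩ := ih x hk hx0
      exact ⟨K, fun a h => ⟨Or.inl (h1 a h).1, (h1 a h).2⟩, h2⟩
    · obtain ⟨a, ha, hax, z, hz, haz⟩ := hx.resolve_left hk
      obtain ⟨K, h1, h2⟩ := ih z hz (hR _ _ haz)
      -- The shift from `z` moves only people whose items lie in layer `k`. Since `x` first appears
      -- in the next layer, `a` has not moved yet.
      have hKa : K a = x := by
        by_contra h
        exact hk (hax ▸ (h1 a (by rwa [hax])).1)
      refine ⟨Function.update K a z, fun c hc => ?_, fun v => ?_⟩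
      · by_cases hca : c = a
        · subst hca
          rw [Function.update_self]
          exact ⟨Or.inr ⟨c, ha, rfl, z, hz, haz⟩, hax ▸ hx0, haz⟩
        · rw [Function.update_of_ne hca] at hc ⊢
          exact ⟨Or.inl (h1 c hc).1, (h1 c hc).2⟩
      · have e1 := load_update K ha z v
        have e2 := h2 v
        rw [hKa] at e1
        omega

/-! ## Popularity in a market where everybody has a last resort -/

/-- A market with `n` people: acceptable items, their ranks, capacities, and for every person an
item of her own. -/
structure Market where
  n : ℕ
  adj : ℕ → ℕ → Prop
  rk : ℕ → ℕ → ℕ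
  cap : ℕ → ℕ
  last : ℕ → ℕ
  pos : ∀ {a b}, adj a b → b ≠ 0
  cap_pos : ∀ {a b}, adj a b → 0 < cap b
  adj_last : ∀ {a : ℕ}, a < n → adj a (last a)
  last_adj : ∀ {a b}, a < n → b < n → adj a (last b) → a = b

namespace Market

variable (G : Market)

/-- Everybody is matched, within the capacities. -/
def Complete (M : ℕ → ℕ) : Prop :=
  (∀ a < G.n, G.adj a (M a)) ∧ ∀ b, load G.n M b ≤ G.cap b

/-- The number of people who prefer `M` to `K`. -/
def wins (M K : ℕ → ℕ) : ℕ := #{a ∈ range G.n | G.rk a (M a) < G.rk a (K a)}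

/-- Popularity among the complete matchings. -/
def Popular (M : ℕ → ℕ) : Prop :=
  G.Complete M ∧ ∀ K, G.Complete K → G.wins K M ≤ G.wins M K

/-- `b` is a top choice of `a`. -/
def Top (a b : ℕ) : Prop := G.adj a b ∧ ∀ b', G.adj a b' → G.rk a b ≤ G.rk a b'

/-- The items that a popular matching may give to `a`, where `N` is the set of the items that all
maximum matchings of the top choices use to capacity. -/
def Allowed (N : Set ℕ) (a b : ℕ) : Prop :=
  G.adj a b ∧ ((b ∉ N ∧ ∀ b' ∉ N, G.adj a b' → G.rk a b ≤ G.rk a b') ∨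
    (b ∈ N ∧ G.Top a b ∧ ∀ b' ∉ N, ¬ G.Top a b'))

/-- The matchings that turn out to be the popular ones. -/
def Good (N : Set ℕ) (M : ℕ → ℕ) : Prop :=
  (∀ a < G.n, G.Allowed N a (M a)) ∧ (∀ b, load G.n M b ≤ G.cap b) ∧ Full G.n G.cap M N

variable {G}

theorem Good.complete {N : Set ℕ} {M : ℕ → ℕ} (h : G.Good N M) : G.Complete M :=
  ⟨fun a ha => (h.1 a ha).1, h.2.1⟩

theorem Top.pos {a b : ℕ} (h : G.Top a b) : b ≠ 0 := G.pos h.1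

theorem exists_top {a : ℕ} (ha : a < G.n) : ∃ b, G.Top a b := by
  classical
  let P : ℕ → Prop := fun r => ∃ b, G.adj a b ∧ G.rk a b = r
  have hP : ∃ r, P r := ⟨_, _, G.adj_last ha, rfl⟩
  obtain ⟨b, hb, hr⟩ := Nat.find_spec hP
  exact ⟨b, hb, fun b' hb' => hr ▸ Nat.find_min' hP ⟨b', hb', rfl⟩⟩

-- Whoever prefers `K` to `M` must go from outside `N` into `N`: inside `N` she has a top choice,
-- and outside she has the best of the items outside. Whoever goes from `N` to the outside loses,
-- since no top choice of hers is outside. As `M` fills `N`, at least as many people leave `N` as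
-- enter it.
open Classical in
theorem Good.popular {N : Set ℕ} {M : ℕ → ℕ} (h : G.Good N M) : G.Popular M := by
  refine ⟨h.complete, fun K hK => ?_⟩
  set X := {a ∈ range G.n | M a ∈ N}
  set Y := {a ∈ range G.n | K a ∈ N}
  have hYX : #Y ≤ #X := by
    refine card_mem_le (Z := N) fun x hx => ?_
    by_cases h0 : x = 0
    · subst h0
      have : load G.n K 0 = 0 := by
        by_contra hne
        obtain ⟨a, ha, hx⟩ := load_pos.1 (Nat.pos_of_ne_zero hne)
        exact G.pos (hK.1 a ha) hx
      omega
    · exact (hK.2 x).trans (h.2.2 x hx h0)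
  have hsd : #(Y \ X) ≤ #(X \ Y) := by
    have e1 := card_sdiff_add_card_inter Y X
    have e2 := card_sdiff_add_card_inter X Y
    rw [inter_comm] at e2
    omega
  refine le_trans (card_le_card ?_) (hsd.trans (card_le_card ?_))
  · intro a ha
    obtain ⟨han, hlt⟩ := mem_filter.1 ha
    have hAl := h.1 a (mem_range.1 han)
    have hKa := hK.1 a (mem_range.1 han)
    rw [mem_sdiff, mem_filter, mem_filter]
    have hX : M a ∉ N := by
      intro hN
      rcases hAl.2 with h1 | h1
      · exact h1.1 hN
      · exact absurd (h1.2.1.2 _ hKa) (not_le.2 hlt)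
    refine ⟨⟨han, ?_⟩, fun h1 => hX h1.2⟩
    by_contra hKN
    rcases hAl.2 with h1 | h1
    · exact absurd (h1.2 _ hKN hKa) (not_le.2 hlt)
    · exact hX h1.1
  · intro a ha
    obtain ⟨haX, haY⟩ := mem_sdiff.1 ha
    obtain ⟨han, hMN⟩ := mem_filter.1 haX
    have hKN : K a ∉ N := fun h1 => haY (mem_filter.2 ⟨han, h1⟩)
    have hKa := hK.1 a (mem_range.1 han)
    refine mem_filter.2 ⟨han, ?_⟩
    rcases (h.1 a (mem_range.1 han)).2 with h1 | ⟨_, h2, h3⟩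
    · exact absurd hMN h1.1
    · by_contra hle
      exact h3 _ hKN ⟨hKa, fun b' hb' => (not_lt.1 hle).trans (h2.2 b' hb')⟩

/-- A complete matching that makes nobody worse off and somebody better off beats `M`. -/
theorem Popular.not_improved {M K : ℕ → ℕ} (hM : G.Popular M) (hK : G.Complete K)
    (P Q : Finset ℕ) (hP : ∀ c ∈ P, c < G.n ∧ G.rk c (K c) < G.rk c (M c))
    (hQ : ∀ a < G.n, a ∉ Q → G.rk a (K a) ≤ G.rk a (M a)) : #P ≤ #Q := by
  refine le_trans (card_le_card ?_) ((hM.2 K hK).trans (card_le_card ?_))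
  · intro a ha
    exact mem_filter.2 ⟨mem_range.2 (hP a ha).1, (hP a ha).2⟩
  · intro a ha
    obtain ⟨h1, h2⟩ := mem_filter.1 ha
    by_contra hn
    exact absurd (hQ a (mem_range.1 h1) hn) (not_le.2 h2)

/-! ### Exchange arguments on the top part of a popular matching -/

open Classical in
/-- The part of `M` that consists of top choices. -/
noncomputable def topPart (G : Market) (M : ℕ → ℕ) (a : ℕ) : ℕ := if G.Top a (M a) then M a else 0

theorem topPart_of_top {M : ℕ → ℕ} {a : ℕ} (h : G.Top a (M a)) : topPart G M a = M a := if_pos h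

theorem topPart_of_not {M : ℕ → ℕ} {a : ℕ} (h : ¬ G.Top a (M a)) : topPart G M a = 0 := if_neg h

theorem top_of_topPart {M : ℕ → ℕ} {a : ℕ} (h : topPart G M a ≠ 0) : G.Top a (M a) := by
  by_contra hn
  exact h (if_neg hn)

theorem load_topPart_le (M : ℕ → ℕ) {x : ℕ} (hx : x ≠ 0) :
    load G.n (topPart G M) x ≤ load G.n M x := by
  refine card_le_card fun a ha => ?_
  obtain ⟨h1, h2⟩ := mem_filter.1 ha
  have := topPart_of_top (top_of_topPart (h2 ▸ hx))
  exact mem_filter.2 ⟨h1, this ▸ h2⟩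

theorem Complete.isPartial_topPart {M : ℕ → ℕ} (hM : G.Complete M) :
    IsPartial G.n G.Top G.cap (topPart G M) :=
  ⟨fun _ _ h => topPart_of_top (top_of_topPart h) ▸ top_of_topPart h,
    fun b hb => (load_topPart_le M hb).trans (hM.2 b)⟩

/-- In a popular matching `M` nobody strictly prefers an item from which, moving people along top
choices, an item can be reached that the top part of `M` does not use to capacity. -/
theorem Popular.promote {M : ℕ → ℕ} (hM : G.Popular M) {a b y k : ℕ} (ha : a < G.n)
    (hab : G.adj a b) (hb : b ∈ layer G.n G.Top (topPart G M) y k)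
    (hy : y ≠ 0) (hfree : load G.n (topPart G M) y < G.cap y) :
    G.rk a (M a) ≤ G.rk a b := by
  classical
  by_contra hlt
  rw [not_le] at hlt
  have hMc := hM.1
  obtain ⟨K, hK1, hK2⟩ := exists_shift (fun _ _ h => Top.pos h) (topPart G M) y k b hb (G.pos hab)
  have hanot : ¬ G.Top a (M a) := fun h => absurd (h.2 b hab) (not_le.2 hlt)
  -- people at a top choice move with the path, the others stay
  let L : ℕ → ℕ := fun c => if G.Top c (M c) then K c else M c
  have hLtop : ∀ c, G.Top c (M c) → G.Top c (L c) := by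
    intro c hc
    by_cases hKc : K c = topPart G M c
    · simp only [L, if_pos hc, hKc, topPart_of_top hc, hc]
    · simp only [L, if_pos hc]; exact (hK1 c hKc).2.2
  have hLnot : ∀ c, ¬ G.Top c (M c) → L c = M c := fun c hc => if_neg hc
  have hKnot : ∀ c, ¬ G.Top c (M c) → K c = 0 := by
    intro c hc
    by_contra h0
    have := topPart_of_not hc
    exact (hK1 c (by rwa [this])).2.1 this
  -- People who are not at a top choice contribute equally to `L` and `M`, so the loads differ only
  -- by the shifted unit.
  have hLload : ∀ x, x ≠ 0 →
      load G.n L x + (if x = b then 1 else 0) = load G.n M x + (if x = y then 1 else 0) := by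
    intro x hx
    have h2 := hK2 x
    have e : ∀ (A B : ℕ → ℕ), (∀ c, G.Top c (M c) → A c = B c) → (∀ c, ¬ G.Top c (M c) → A c = 0) →
        load G.n (fun c => if G.Top c (M c) then B c else M c) x =
          load G.n A x + #{c ∈ range G.n | ¬ G.Top c (M c) ∧ M c = x} := by
      intro A B hA hA0
      unfold load
      rw [← card_union_of_disjoint]
      · congr 1
        ext c
        simp only [mem_filter, mem_union]
        by_cases hc : G.Top c (M c)
        · simp [hc, hA c hc]
        · simp [hc, hA0 c hc, hx.symm]
      · rw [disjoint_filter]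
        rintro c _ h1 ⟨h3, _⟩
        exact hx (h1 ▸ hA0 c h3)
    have e1 := e K K (fun _ _ => rfl) hKnot
    have e2 := e (topPart G M) M (fun c hc => topPart_of_top hc) (fun c hc => topPart_of_not hc)
    simp only [ite_self] at e2
    change load G.n L x = _ at e1
    change load G.n M x = _ at e2
    omega
  have hL0 : ∀ c < G.n, L c ≠ 0 := by
    intro c hc
    by_cases h : G.Top c (M c)
    · exact (hLtop c h).pos
    · rw [hLnot c h]; exact G.pos (hMc.1 c hc)
  -- `a` takes `b`
  set L1 := Function.update L a b with hL1
  -- The unit that the path removed from `b` is refilled by `a`. In total one unit has gone from `M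
  -- a` to `y`.
  have hL1load : ∀ x, x ≠ 0 →
      load G.n L1 x + (if x = M a then 1 else 0) = load G.n M x + (if x = y then 1 else 0) := by
    intro x hx
    have e1 : load G.n L1 x + _ = _ := load_update L ha b x
    have e2 := hLload x hx
    rw [hLnot a hanot] at e1
    omega
  have hload0 : ∀ K' : ℕ → ℕ, (∀ c < G.n, K' c ≠ 0) → load G.n K' 0 ≤ G.cap 0 := by
    intro K' h
    by_contra hne
    obtain ⟨c, hc, hx⟩ := load_pos.1 (lt_of_le_of_lt (Nat.zero_le _) (not_le.1 hne))
    exact h c hc hx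
  have hcomp : ∀ K' : ℕ → ℕ, (∀ c < G.n, G.adj c (K' c)) →
      (∀ x, x ≠ 0 → load G.n K' x ≤ G.cap x) → G.Complete K' := by
    intro K' h1 h2
    refine ⟨h1, fun x => ?_⟩
    by_cases hx : x = 0
    · subst hx; exact hload0 K' fun c hc => G.pos (h1 c hc)
    · exact h2 x hx
  have hLadj : ∀ c < G.n, G.adj c (L c) := by
    intro c hc
    by_cases h : G.Top c (M c)
    · exact (hLtop c h).1
    · rw [hLnot c h]; exact hMc.1 c hc
  have hLrk : ∀ c < G.n, G.rk c (L c) ≤ G.rk c (M c) := by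
    intro c hc
    by_cases h : G.Top c (M c)
    · exact (hLtop c h).2 _ h.1
    · rw [hLnot c h]
  have hL1adj : ∀ c < G.n, G.adj c (L1 c) := by
    intro c hc
    by_cases h : c = a
    · subst h; rwa [hL1, Function.update_self]
    · rw [hL1, Function.update_of_ne h]; exact hLadj c hc
  have hL1rk : ∀ c < G.n, G.rk c (L1 c) ≤ G.rk c (M c) := by
    intro c hc
    by_cases h : c = a
    · subst h; rw [hL1, Function.update_self]; exact hlt.le
    · rw [hL1, Function.update_of_ne h]; exact hLrk c hc
  have hL1a : L1 a = b := Function.update_self ..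
  have contra : ∀ (K' : ℕ → ℕ) (P Q : Finset ℕ), (∀ c < G.n, G.adj c (K' c)) →
      (∀ x, x ≠ 0 → load G.n K' x ≤ G.cap x) →
      (∀ a ∈ P, a < G.n ∧ G.rk a (K' a) < G.rk a (M a)) →
      (∀ a < G.n, a ∉ Q → G.rk a (K' a) ≤ G.rk a (M a)) → #P ≤ #Q :=
    fun K' P Q h1 h2 h3 h4 => hM.not_improved (hcomp K' h1 h2) P Q h3 h4
  have hcapM := hMc.2
  -- The item `y` is free for the top part of `M`, but perhaps not for `M` itself. If the extra unit
  -- fits, `a` gains and nobody loses.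
  by_cases hroom : load G.n M y < G.cap y ∨ y = M a
  · have := contra L1 {a} ∅ hL1adj (fun x hx => by
      have h1 := hL1load x hx
      have h2 := hcapM x
      by_cases hxy : x = y
      · subst hxy
        rcases hroom with h | h
        · rw [if_pos rfl] at h1; omega
        · rw [if_pos rfl, if_pos h] at h1; omega
      · rw [if_neg hxy] at h1; omega) (by simp [ha, hL1a, hlt]) (fun c hc _ => hL1rk c hc)
    simp at this
  push Not at hroom
  obtain ⟨hysat, hyMa⟩ := hroom
  -- somebody sits at `y` without ranking it top
  obtain ⟨d, hd, hMd, hdnot⟩ : ∃ d < G.n, M d = y ∧ ¬ G.Top d (M d) := by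
    by_contra hno
    push Not at hno
    refine absurd hfree (not_lt.2 (hysat.trans (card_le_card fun c hc => ?_)))
    obtain ⟨h1, h2⟩ := mem_filter.1 hc
    exact mem_filter.2 ⟨h1, (topPart_of_top (hno c (mem_range.1 h1) h2)).trans h2⟩
  have hda : d ≠ a := fun h => hyMa (by rw [← hMd, h])
  have hL1d : L1 d = y := by rw [hL1, Function.update_of_ne hda, hLnot d hdnot, hMd]
  have hLd : L d = y := by rw [hLnot d hdnot, hMd]
  obtain ⟨t, ht⟩ := exists_top hd
  have hdlt : G.rk d t < G.rk d (M d) := by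
    by_contra hle
    exact hdnot ⟨hMc.1 d hd, fun b' hb' => (not_lt.1 hle).trans (ht.2 b' hb')⟩
  have hty : t ≠ y := fun h => by rw [hMd, h] at hdlt; exact lt_irrefl _ hdlt
  set L2 := Function.update L1 d t with hL2
  -- Now `d`, who sat at `y` without ranking it top, hands the surplus on to her top choice `t`.
  have hL2load : ∀ x, x ≠ 0 →
      load G.n L2 x + (if x = M a then 1 else 0) = load G.n M x + (if x = t then 1 else 0) := by
    intro x hx
    have e1 : load G.n L2 x + _ = _ := load_update L1 hd t x
    have e2 := hL1load x hx
    rw [hL1d] at e1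
    omega
  have hL2d : L2 d = t := Function.update_self ..
  have hL2ne : ∀ c, c ≠ d → L2 c = L1 c := fun c hc => Function.update_of_ne hc ..
  have hL2adj : ∀ c < G.n, G.adj c (L2 c) := by
    intro c hc
    by_cases h : c = d
    · subst h; rw [hL2d]; exact ht.1
    · rw [hL2ne c h]; exact hL1adj c hc
  have hL2rk : ∀ c < G.n, G.rk c (L2 c) ≤ G.rk c (M c) := by
    intro c hc
    by_cases h : c = d
    · subst h; rw [hL2d]; exact hdlt.le
    · rw [hL2ne c h]; exact hL1rk c hc
  by_cases hroom : load G.n M t < G.cap t ∨ t = M a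
  · have := contra L2 {a} ∅ hL2adj (fun x hx => by
      have h1 := hL2load x hx
      have h2 := hcapM x
      by_cases hxy : x = t
      · subst hxy
        rcases hroom with h | h
        · rw [if_pos rfl] at h1; omega
        · rw [if_pos rfl, if_pos h] at h1; omega
      · rw [if_neg hxy] at h1; omega) (by simp [ha, hL2ne a hda.symm, hL1a, hlt])
      (fun c hc _ => hL2rk c hc)
    simp at this
  push Not at hroom
  obtain ⟨htsat, htMa⟩ := hroom
  -- The item `t` is full and has positive capacity, so somebody holds it in `L1`.
  obtain ⟨e, he, hL1e⟩ : ∃ e < G.n, L1 e = t := by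
    rw [← load_pos]
    have h1 := hL1load t ht.pos
    rw [if_neg htMa, if_neg hty] at h1
    have := G.cap_pos ht.1
    omega
  have hed : e ≠ d := fun h => hty (by rw [← hL1e, h, hL1d])
  by_cases hea : e = a
  · -- `d` moves to the beginning of the path
    subst hea
    have htb : t = b := by rw [← hL1e, hL1a]
    subst htb
    set L3 := Function.update L d t with hL3
    -- If `t` is the item `b` that the path has vacated, `d` takes the vacancy instead of `a`. All
    -- loads are then those of `M`, and `d` alone is enough for the contradiction.
    have := contra L3 {d} ∅ (fun c hc => by
        by_cases h : c = d
        · subst h; rw [hL3, Function.update_self]; exact ht.1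
        · rw [hL3, Function.update_of_ne h]; exact hLadj c hc) (fun x hx => by
        have h1 : load G.n L3 x + _ = _ := load_update L hd t x
        have h2 := hLload x hx
        have h3 := hcapM x
        rw [hLd] at h1
        omega) (by simp [hL3, hd, hdlt]) (fun c hc _ => by
        by_cases h : c = d
        · subst h; rw [hL3, Function.update_self]; exact hdlt.le
        · rw [hL3, Function.update_of_ne h]; exact hLrk c hc)
    simp at this
  · -- `e` makes room for `d` and takes her last resort
    set L3 := Function.update L2 e (G.last e) with hL3
    have hL2e : L2 e = t := by rw [hL2ne e hed, hL1e]
    have htl : t ≠ G.last e := fun h => hed (G.last_adj hd he (h ▸ ht.1)).symm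
    -- Nobody but `e` may hold her last resort, and `e` holds `t`.
    have hlast : load G.n L2 (G.last e) = 0 := by
      by_contra hne
      obtain ⟨c, hc, hcx⟩ := load_pos.1 (Nat.pos_of_ne_zero hne)
      have : c = e := G.last_adj hc he (hcx ▸ hL2adj c hc)
      exact htl (by rw [← hL2e, ← hcx, this])
    have hL3ne : ∀ c, c ≠ e → L3 c = L2 c := fun c hc => Function.update_of_ne hc ..
    have := contra L3 {a, d} {e} (fun c hc => by
        by_cases h : c = e
        · subst h; rw [hL3, Function.update_self]; exact G.adj_last hc
        · rw [hL3ne c h]; exact hL2adj c hc) (fun x hx => by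
        have h1 : load G.n L3 x + _ = _ := load_update L2 he (G.last e) x
        have h2 := hL2load x hx
        have h3 := hcapM x
        rw [hL2e] at h1
        by_cases hxl : x = G.last e
        · subst hxl
          have := G.cap_pos (G.adj_last he)
          rw [hlast, if_neg (Ne.symm htl)] at h1
          simp at h1
          omega
        · rw [if_neg hxl] at h1; omega)
      (by
        intro c hc
        rcases mem_insert.1 hc with rfl | hc
        · rw [hL3ne c (Ne.symm hea), hL2ne c hda.symm, hL1a]; exact ⟨ha, hlt⟩
        · rw [mem_singleton.1 hc, hL3ne d hed.symm, hL2d]; exact ⟨hd, hdlt⟩)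
      (fun c hc hce => by
        have hce : c ≠ e := fun h => hce (mem_singleton.2 h)
        rw [hL3ne c hce]; exact hL2rk c hc)
    -- Two people gain and at most one loses, which popularity forbids.
    rw [card_pair (Ne.symm hda), card_singleton] at this
    omega

end Market
end PopMatch

namespace PopMatch

open Finset

/-! ## Maximum partial matchings -/

/-- The union of all closed sets of items that `M` uses to capacity. -/
def tight (n : ℕ) (R : ℕ → ℕ → Prop) (cap M : ℕ → ℕ) : Set ℕ :=
  {x | ∃ Z, Closed n R M Z ∧ Full n cap M Z ∧ x ∈ Z}

theorem closed_tight (n : ℕ) (R : ℕ → ℕ → Prop) (cap M : ℕ → ℕ) :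
    Closed n R M (tight n R cap M) :=
  fun a ha ⟨Z, h1, h2, h3⟩ b hb => ⟨Z, h1, h2, h1 a ha h3 b hb⟩

theorem full_tight (n : ℕ) (R : ℕ → ℕ → Prop) (cap M : ℕ → ℕ) :
    Full n cap M (tight n R cap M) :=
  fun b ⟨_, _, h2, h3⟩ h0 => h2 b h3 h0

theorem subset_tight {n : ℕ} {R : ℕ → ℕ → Prop} {cap M : ℕ → ℕ} {Z : Set ℕ} (h1 : Closed n R M Z)
    (h2 : Full n cap M Z) : Z ⊆ tight n R cap M := fun _ hx => ⟨Z, h1, h2, hx⟩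

/-- A closed full set that contains `0` shows that `M` leaves the fewest people unmatched. If `K`
leaves as few unmatched, then the set is closed and full for `K`, too. -/
theorem IsPartial.transfer {n : ℕ} {R : ℕ → ℕ → Prop} {cap M K : ℕ → ℕ}
    (hK : IsPartial n R cap K) {Z : Set ℕ} (h0 : (0 : ℕ) ∈ Z)
    (hc : Closed n R M Z) (hf : Full n cap M Z) :
    load n M 0 ≤ load n K 0 ∧ (load n K 0 ≤ load n M 0 → Closed n R K Z ∧ Full n cap K Z) := by
  classical
  -- the people that `M` keeps in `Z` are kept there by `K`, too
  set X := {a ∈ range n | M a ∈ Z}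
  set Y := {a ∈ range n | K a ∈ Z}
  have hXY : X ⊆ Y := by
    intro a ha
    obtain ⟨h1, h2⟩ := mem_filter.1 ha
    refine mem_filter.2 ⟨h1, ?_⟩
    by_cases hk : K a = 0
    · rwa [hk]
    · exact hc a (mem_range.1 h1) h2 _ (hK.1 a (mem_range.1 h1) hk)
  -- The value `0` has no capacity, so it is split off before loads are compared.
  obtain ⟨D, hD⟩ : ∃ D, D = Z \ {0} := ⟨_, rfl⟩
  have split : ∀ L : ℕ → ℕ, #{a ∈ range n | L a ∈ Z} =
      load n L 0 + #{a ∈ range n | L a ∈ D} := by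
    intro L
    unfold load
    rw [← card_union_of_disjoint]
    · congr 1
      ext a
      simp only [hD, mem_filter, mem_union, Set.mem_sdiff, Set.mem_singleton_iff]
      by_cases h : L a = 0
      · simp [h, h0]
      · simp [h]
    · rw [disjoint_filter]
      rintro a _ h1 h2
      rw [hD] at h2
      exact h2.2 h1
  have hle : ∀ x ∈ D, load n K x ≤ load n M x := fun x hx => by
    rw [hD] at hx
    exact (hK.2 x hx.2).trans (hf x hx.1 hx.2)
  have hc' := card_mem_le hle
  have eM : #X = _ := split M
  have eK : #Y = _ := split K
  have hXYc := card_le_card hXY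
  refine ⟨by omega, fun hKM => ?_⟩
  -- Here all the inequalities of the count are forced to be equalities.
  have hYX : X = Y := eq_of_subset_of_card_le hXY (by omega)
  refine ⟨fun a ha haZ b hb => ?_, fun b hb hb0 => ?_⟩
  · have : a ∈ X := hYX ▸ mem_filter.2 ⟨mem_range.2 ha, haZ⟩
    exact hc a ha (mem_filter.1 this).2 b hb
  · rw [load_eq_of_card_mem_le hle (by omega) b (hD ▸ ⟨hb, hb0⟩)]
    exact hf b hb hb0

namespace Market

variable {G : Market}

/-- Every popular matching is good for the tight set of a maximum matching of the top choices. -/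
theorem Popular.good {M K : ℕ → ℕ} (hM : G.Popular M) (hK : IsPartial G.n G.Top G.cap K)
    (h0 : (0 : ℕ) ∈ tight G.n G.Top G.cap K) : G.Good (tight G.n G.Top G.cap K) M := by
  set N := tight G.n G.Top G.cap K
  have hP := hM.1.isPartial_topPart
  -- the items from which no free item of the top part of `M` can be reached
  set Z : Set ℕ := {x | ∀ y k, y ≠ 0 → load G.n (topPart G M) y < G.cap y →
    x ∉ layer G.n G.Top (topPart G M) y k}
  have hZc : Closed G.n G.Top (topPart G M) Z := by
    intro a ha haZ b hb y k hy hfree hbl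
    exact haZ y (k + 1) hy hfree (Or.inr ⟨a, ha, rfl, b, hbl, hb⟩)
  have hZf : Full G.n G.cap (topPart G M) Z := by
    intro b hb hb0
    by_contra hlt
    exact hb b 0 hb0 (not_le.1 hlt) rfl
  have hpro : ∀ a < G.n, ∀ b ∉ Z, G.adj a b → G.rk a (M a) ≤ G.rk a b := by
    intro a ha b hb hab
    simp only [Z, Set.mem_ofPred_eq, not_forall, not_not] at hb
    obtain ⟨y, k, hy, hfree, hl⟩ := hb
    exact hM.promote ha hab hl hy hfree
  -- Suppose an unmatched person of the top part could start a path to a free item. By promotion her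
  -- item in `M` would be as good as her top choice, so she would be matched in the top part.
  have hZ0 : (0 : ℕ) ∈ Z := by
    intro y k hy hfree hl
    induction k with
    | zero => exact hy hl.symm
    | succ k ih =>
      rcases hl with hl | ⟨a, ha, ha0, z, hz, haz⟩
      · exact ih hl
      · have hzZ : z ∉ Z := fun h => h y k hy hfree hz
        have h1 := hpro a ha z hzZ haz.1
        have : G.Top a (M a) := ⟨hM.1.1 a ha, fun b' hb' => h1.trans (haz.2 b' hb')⟩
        rw [topPart_of_top this] at ha0
        exact this.pos ha0
  -- Applying the transfer in both directions shows that `K` and the top part of `M` leave equally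
  -- many people unmatched. Then `Z` is closed and full for `K`, and `N` is closed and full for the
  -- top part.
  obtain ⟨h1, h2⟩ := IsPartial.transfer hK hZ0 hZc hZf
  obtain ⟨h3, h4⟩ := IsPartial.transfer hP h0 (closed_tight _ _ _ _) fun b hb hb0 => full_tight _ _ _ _ b hb hb0
  obtain ⟨h5, h6⟩ := h2 h3
  obtain ⟨h7, h8⟩ := h4 h1
  have hZN : Z ⊆ N := subset_tight h5 h6
  have hload : ∀ b ∈ N, b ≠ 0 → load G.n (topPart G M) b = load G.n M b := fun b hb hb0 =>
    le_antisymm (load_topPart_le M hb0) ((hM.1.2 b).trans (h8 b hb hb0))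
  refine ⟨fun a ha => ⟨hM.1.1 a ha, ?_⟩, hM.1.2, fun b hb hb0 => (hload b hb hb0) ▸ h8 b hb hb0⟩
  by_cases hN : M a ∈ N
  · have hb0 := G.pos (hM.1.1 a ha)
    -- On `N` the top part already has the full load of `M`, so everybody whom `M` sends there has a
    -- top choice.
    have hta : G.Top a (M a) := by
      have hsub : (range G.n).filter (fun c => topPart G M c = M a) ⊆
          (range G.n).filter (fun c => M c = M a) := by
        intro c hc
        obtain ⟨hc1, hc2⟩ := mem_filter.1 hc
        have := topPart_of_top (top_of_topPart (hc2 ▸ hb0))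
        exact mem_filter.2 ⟨hc1, this ▸ hc2⟩
      have heq := eq_of_subset_of_card_le hsub (hload _ hN hb0).ge
      have : a ∈ (range G.n).filter (fun c => topPart G M c = M a) :=
        heq ▸ mem_filter.2 ⟨mem_range.2 ha, rfl⟩
      exact top_of_topPart ((mem_filter.1 this).2 ▸ hb0)
    refine Or.inr ⟨hN, hta, fun b' hb' ht => hb' ?_⟩
    exact h7 a ha (by rwa [topPart_of_top hta]) b' ht
  · exact Or.inl ⟨hN, fun b' hb' hab => hpro a ha b' (fun h => hb' (hZN h)) hab⟩

end Market

/-! ## Matchings of minimum weight -/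

section Weight

variable {ι : Type*} [LinearOrder ι]

/-- No item of larger weight can be exchanged for a free item of smaller weight: for every lower
set `T` of items, there is a closed set `Z` that contains the items used outside `T` and in which
all items of `T` are used to capacity. -/
def IsOpt (n : ℕ) (R : ℕ → ℕ → Prop) (cap : ℕ → ℕ) (w : ℕ → ι) (M : ℕ → ℕ) : Prop :=
  ∀ T : Set ℕ, (∀ x ∈ T, ∀ y, w y ≤ w x → y ∈ T) → ∃ Z, Closed n R M Z ∧
    (∀ a < n, M a ≠ 0 → M a ∉ T → M a ∈ Z) ∧ Full n cap M (Z ∩ T)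

/-- The assignment `K` arises from `M` by moving people along a path of moves from `0` to the free
item `y`. -/
structure Augments (n : ℕ) (R : ℕ → ℕ → Prop) (M K : ℕ → ℕ) (y : ℕ) : Prop where
  load_eq : ∀ v ≠ 0, load n K v = load n M v + (if v = y then 1 else 0)
  load_zero : load n K 0 + 1 = load n M 0
  edge : ∀ a < n, K a ≠ M a → R a (K a)
  avoid : ∀ Z, Closed n R M Z → y ∉ Z → ∀ a < n, K a ≠ M a → M a ∉ Z ∧ K a ∉ Z
  used : ∀ a < n, K a ≠ M a → K a = y ∨ ∃ c < n, M c = K a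

theorem Augments.isPartial {n : ℕ} {R : ℕ → ℕ → Prop} {cap M K : ℕ → ℕ} {y : ℕ}
    (h : Augments n R M K y) (hM : IsPartial n R cap M) (hy : load n M y < cap y) :
    IsPartial n R cap K := by
  refine ⟨fun a ha h0 => ?_, fun b hb => ?_⟩
  · by_cases he : K a = M a
    · rw [he] at h0 ⊢; exact hM.1 a ha h0
    · exact h.edge a ha he
  · have h1 := h.load_eq b hb
    have h2 := hM.2 b hb
    by_cases hby : b = y
    · subst hby; rw [if_pos rfl] at h1; omega
    · rw [if_neg hby] at h1; omega

/-- Augmenting to a free item of minimum weight in a closed set preserves optimality. -/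
theorem Augments.isOpt {n : ℕ} {R : ℕ → ℕ → Prop} {cap M K : ℕ → ℕ} {y : ℕ} {w : ℕ → ι}
    (h : Augments n R M K y) (hM : IsOpt n R cap w M) (hy : load n M y < cap y) (hy0 : y ≠ 0)
    {V : Set ℕ} (hV : Closed n R M V) (hyV : y ∈ V) (hin : ∀ a < n, K a ≠ M a → M a ∈ V)
    (hbest : ∀ x ∈ V, x ≠ 0 → load n M x < cap x → w y ≤ w x) : IsOpt n R cap w K := by
  intro T hT
  obtain ⟨Z, hZ1, hZ2, hZ3⟩ := hM T hT
  have hmono : ∀ v ≠ 0, load n M v ≤ load n K v := fun v hv => by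
    rw [h.load_eq v hv]; exact Nat.le_add_right ..
  by_cases hyT : y ∈ T
  · have hyZ : y ∉ Z := fun hyZ => absurd (hZ3 y ⟨hyZ, hyT⟩ hy0) (not_le.2 hy)
    have hch := h.avoid Z hZ1 hyZ
    refine ⟨Z, fun a ha haZ b hb => ?_, fun a ha ha0 haT => ?_, fun b hb hb0 =>
      (hZ3 b hb hb0).trans (hmono b hb0)⟩
    · by_cases he : K a = M a
      · exact hZ1 a ha (he ▸ haZ) b hb
      · exact absurd haZ (hch a ha he).2
    · by_cases he : K a = M a
      · rw [he] at ha0 haT ⊢; exact hZ2 a ha ha0 haT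
      · rcases h.used a ha he with h1 | ⟨c, hc, h1⟩
        · exact absurd (h1 ▸ hyT) haT
        · rw [← h1] at ha0 haT ⊢; exact hZ2 c hc ha0 haT
  · have hV2 : Full n cap M (V ∩ T) := by
      intro b hb hb0
      by_contra hlt
      exact hyT (hT b hb.2 y (hbest b hb.1 hb0 (not_le.1 hlt)))
    have hc : Closed n R M (Z ∪ V) := by
      rintro a ha (h1 | h1) b hb
      · exact Or.inl (hZ1 a ha h1 b hb)
      · exact Or.inr (hV a ha h1 b hb)
    refine ⟨Z ∪ V, fun a ha haZ b hb => ?_, fun a ha ha0 haT => ?_, ?_⟩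
    · by_cases he : K a = M a
      · exact hc a ha (he ▸ haZ) b hb
      · exact Or.inr (hV a ha (hin a ha he) b hb)
    · by_cases he : K a = M a
      · rw [he] at ha0 haT ⊢; exact Or.inl (hZ2 a ha ha0 haT)
      · rcases h.used a ha he with h1 | ⟨c, hc', h1⟩
        · rw [h1]; exact Or.inr hyV
        · rw [← h1] at ha0 haT ⊢; exact Or.inl (hZ2 c hc' ha0 haT)
    · rintro b ⟨hb | hb, hbT⟩ hb0
      · exact (hZ3 b ⟨hb, hbT⟩ hb0).trans (hmono b hb0)
      · exact (hV2 b ⟨hb, hbT⟩ hb0).trans (hmono b hb0)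

open Classical in
/-- An optimal complete matching uses every lower set of items as much as any other one. -/
theorem IsOpt.card_le {n : ℕ} {R : ℕ → ℕ → Prop} {cap M K : ℕ → ℕ} {w : ℕ → ι}
    (hR : ∀ a b, R a b → b ≠ 0) (hM : IsOpt n R cap w M) (hMR : ∀ a < n, R a (M a))
    (hKR : ∀ a < n, R a (K a)) (hKc : ∀ b ≠ 0, load n K b ≤ cap b)
    (T : Set ℕ) (hT : ∀ x ∈ T, ∀ y, w y ≤ w x → y ∈ T) :
    #{a ∈ range n | K a ∈ T} ≤ #{a ∈ range n | M a ∈ T} := by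
  obtain ⟨Z, hZ1, hZ2, hZ3⟩ := hM T hT
  have hsub : {a ∈ range n | K a ∈ T} \ {a ∈ range n | K a ∈ Z ∩ T} ⊆
      {a ∈ range n | M a ∈ T} \ {a ∈ range n | M a ∈ Z ∩ T} := by
    intro a ha
    simp only [mem_sdiff, mem_filter, Set.mem_inter_iff, not_and, mem_range] at ha ⊢
    obtain ⟨⟨han, haT⟩, haZ⟩ := ha
    -- Closedness is used backwards: had `M` placed `a` in `Z`, every edge of `a`, also the one that
    -- `K` uses, would end in `Z`.
    have hMZ : M a ∉ Z := fun h => haZ han (hZ1 a han h _ (hKR a han)) haT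
    refine ⟨⟨han, ?_⟩, fun _ h => absurd h hMZ⟩
    by_contra h
    exact hMZ (hZ2 a han (hR _ _ (hMR a han)) h)
  have hle : #{a ∈ range n | K a ∈ Z ∩ T} ≤ #{a ∈ range n | M a ∈ Z ∩ T} := by
    refine card_mem_le (Z := Z ∩ T) fun x hx => ?_
    by_cases h0 : x = 0
    · subst h0
      have : load n K 0 = 0 := by
        by_contra hne
        obtain ⟨a, ha, hx⟩ := load_pos.1 (Nat.pos_of_ne_zero hne)
        exact hR _ _ (hKR a ha) hx
      omega
    · exact (hKc x h0).trans (hZ3 x hx h0)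
  have key : ∀ L : ℕ → ℕ, #({a ∈ range n | L a ∈ T} \ {a ∈ range n | L a ∈ Z ∩ T}) +
      #{a ∈ range n | L a ∈ Z ∩ T} = #{a ∈ range n | L a ∈ T} := fun L =>
    card_sdiff_add_card_eq_card (monotone_filter_right _ fun a _ h => h.2)
  rw [← key K, ← key M]
  exact add_le_add (card_le_card hsub) hle

end Weight

/-- A family that is pointwise dominated in its distribution function has the larger sum. -/
theorem sum_le_sum_of_card_le {α : Type*} [DecidableEq α] (S S' : Finset α) (f g : α → ℝ≥0)
    (hc : #S = #S') (h : ∀ t, #{a ∈ S' | g a ≤ t} ≤ #{a ∈ S | f a ≤ t}) :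
    ∑ a ∈ S, f a ≤ ∑ a ∈ S', g a := by
  induction hk : #S generalizing S S' with
  | zero =>
    rw [card_eq_zero.1 hk]
    simp
  | succ k ih =>
    obtain ⟨a, ha, hamax⟩ := exists_max_image S f (card_pos.1 (by omega))
    obtain ⟨b, hb, hbmax⟩ := exists_max_image S' g (card_pos.1 (by omega))
    -- At the threshold `g b` all of `S'` is counted, hence all of `S`. So the two maxima compare,
    -- and they can be removed as a pair.
    have hfg : ∀ x ∈ S, f x ≤ g b := by
      have h1 := h (g b)
      rw [filter_true_of_mem hbmax, ← hc] at h1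
      have h2 := eq_of_subset_of_card_le (filter_subset _ S) h1
      intro x hx
      rw [← h2] at hx
      exact (mem_filter.1 hx).2
    rw [← add_sum_erase S f ha, ← add_sum_erase S' g hb]
    refine add_le_add (hfg a ha) (ih _ _ ?_ (fun t => ?_) ?_)
    · rw [card_erase_of_mem ha, card_erase_of_mem hb, hc]
    · by_cases ht : f a ≤ t
      · have : {x ∈ S.erase a | f x ≤ t} = S.erase a :=
          filter_true_of_mem fun x hx => (hamax x (mem_of_mem_erase hx)).trans ht
        rw [this, card_erase_of_mem ha, hc, ← card_erase_of_mem hb]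
        exact card_le_card (filter_subset _ _)
      · have hgb : ¬ g b ≤ t := fun h' => ht ((hfg a ha).trans h')
        rw [filter_erase, filter_erase,
          erase_eq_of_notMem (s := S.filter _) (fun h' => ht (mem_filter.1 h').2),
          erase_eq_of_notMem (s := S'.filter _) (fun h' => hgb (mem_filter.1 h').2)]
        exact h t
    · rw [card_erase_of_mem ha, hk]; rfl

/-- The weight of an item: the items that have to be used to capacity come first, then the items
are ordered by their costs. -/
def weight (ev : ℕ → ℕ) (c : ℕ → ℝ≥0) (x : ℕ) : ℕ ×ₗ ℝ≥0 := toLex (ev x, c x)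

/-- An optimal complete matching of the allowed edges is good and cheapest among the good ones. -/
theorem IsOpt.good_and_cheapest {G : Market} {N : Set ℕ} {ev : ℕ → ℕ} {c : ℕ → ℝ≥0}
    (hev : ∀ x, ev x = 0 ↔ x ∈ N) (hev1 : ∀ x, ev x ≤ 1) {M K : ℕ → ℕ}
    (hM : IsOpt G.n (G.Allowed N) G.cap (weight ev c) M) (hMc : ∀ b, load G.n M b ≤ G.cap b)
    (hMR : ∀ a < G.n, G.Allowed N a (M a)) (hK : G.Good N K) :
    G.Good N M ∧ ∑ a ∈ range G.n, c (M a) ≤ ∑ a ∈ range G.n, c (K a) := by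
  classical
  have hR : ∀ a b, G.Allowed N a b → b ≠ 0 := fun a b h => G.pos h.1
  have hdom := hM.card_le hR hMR hK.1 (fun b _ => hK.2.1 b)
  have hloadN : ∀ b ∈ N \ {0}, load G.n M b = load G.n K b := by
    -- `N` is itself a lower set of weights, so `M` sends at least as many people there as `K`,
    -- which fills it.
    have h1 := hdom N fun x hx y hy => by
      rw [weight, weight, Prod.Lex.toLex_le_toLex] at hy
      rw [← hev] at hx ⊢
      rcases hy with h | h
      · omega
      · exact h.1.trans hx
    have h2 : ∀ L : ℕ → ℕ, (∀ a < G.n, G.Allowed N a (L a)) →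
        #{a ∈ range G.n | L a ∈ N} = #{a ∈ range G.n | L a ∈ N \ {0}} := by
      intro L hL
      congr 1
      apply filter_congr
      intro a ha
      simp [hR _ _ (hL a (mem_range.1 ha))]
    rw [h2 M hMR, h2 K hK.1] at h1
    exact load_eq_of_card_mem_le
      (fun x hx => (hMc x).trans (hK.2.2 x hx.1 hx.2)) (by convert h1)
  have hgood : G.Good N M := ⟨hMR, hMc, fun b hb hb0 => by
    rw [hloadN b ⟨hb, hb0⟩]; exact hK.2.2 b hb hb0⟩
  refine ⟨hgood, ?_⟩
  -- The cost on `N` depends only on the loads, which agree for `M` and `K`. Elsewhere the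
  -- distributions are compared, with people in `N` counted at price `0` so that every threshold set
  -- is a lower set of weights.
  have hsplit : ∀ L : ℕ → ℕ, (∀ a < G.n, G.Allowed N a (L a)) → ∑ a ∈ range G.n, c (L a) =
      ∑ a ∈ range G.n with L a ∈ N \ {0}, c (L a) +
        ∑ a ∈ range G.n, (if L a ∈ N then 0 else c (L a)) := by
    intro L hL
    rw [sum_filter, ← sum_add_distrib]
    refine sum_congr rfl fun a ha => ?_
    have := hR _ _ (hL a (mem_range.1 ha))
    by_cases h : L a ∈ N <;> simp [h, this]
  have hNsum : ∀ L : ℕ → ℕ, ∑ a ∈ range G.n with L a ∈ N \ {0}, c (L a) =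
      ∑ x ∈ ((range G.n).image M ∪ (range G.n).image K ∪ (range G.n).image L) with x ∈ N \ {0},
        load G.n L x • c x := by
    intro L
    rw [← sum_fiberwise_of_maps_to (g := L)
      (t := ((range G.n).image M ∪ (range G.n).image K ∪ (range G.n).image L).filter (· ∈ N \ {0}))]
    · refine sum_congr rfl fun x hx => ?_
      rw [load, ← sum_const, filter_filter]
      refine sum_congr ?_ fun a ha => by rw [(mem_filter.1 ha).2]
      apply filter_congr
      intro a _
      constructor
      · exact fun h => h.2
      · rintro rfl; exact ⟨(mem_filter.1 hx).2, rfl⟩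
    · intro a ha
      obtain ⟨h1, h2⟩ := mem_filter.1 ha
      exact mem_filter.2 ⟨mem_union_right _ (mem_image_of_mem _ h1), h2⟩
  rw [hsplit M hMR, hsplit K hK.1]
  refine add_le_add (le_of_eq ?_) (sum_le_sum_of_card_le _ _ _ _ rfl fun t => ?_)
  · rw [hNsum M, hNsum K]
    rw [union_right_comm, union_self, union_assoc, union_self]
    exact sum_congr rfl fun x hx => by rw [hloadN x (mem_filter.1 hx).2]
  · have h1 := hdom {x | x ∈ N ∨ c x ≤ t} fun x hx y hy => by
      rw [weight, weight, Prod.Lex.toLex_le_toLex] at hy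
      rcases hy with h | h
      · exact Or.inl ((hev y).1 (by have := hev1 x; simp only at h; omega))
      · rcases hx with hx | hx
        · exact Or.inl ((hev y).1 (h.1.trans ((hev x).2 hx)))
        · exact Or.inr (h.2.trans hx)
    have h2 : ∀ L : ℕ → ℕ, {a ∈ range G.n | (if L a ∈ N then 0 else c (L a)) ≤ t} =
        {a ∈ range G.n | L a ∈ {x | x ∈ N ∨ c x ≤ t}} := by
      intro L
      apply filter_congr
      intro a _
      by_cases h : L a ∈ N <;> simp [h]
    rw [h2 K, h2 M]
    convert h1

end PopMatch

namespace PopMatch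

/-! ## Reasoning about programs -/

/-- Started in `s`, the program `P` halts within `T` steps in a state that satisfies `Q`. -/
def WP (p : ℕ → ℝ≥0) (P : Prog) (T : ℕ) (Q : State → Prop) (s : State) : Prop :=
  ∃ t s', Exec p P s t s' ∧ t ≤ T ∧ Q s'

namespace Prog

/-- The registers that a program may change. -/
def regs : Prog → List ℕ
  | skip => []
  | assign x _ => [x]
  | store _ _ _ => []
  | seq P Q => P.regs ++ Q.regs
  | branch _ P Q => P.regs ++ Q.regs
  | loop _ P => P.regs

/-- The arrays that a program may change. -/
def arrs : Prog → List ℕ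
  | skip => []
  | assign _ _ => []
  | store A _ _ => [A]
  | seq P Q => P.arrs ++ Q.arrs
  | branch _ P Q => P.arrs ++ Q.arrs
  | loop _ P => P.arrs

/-- Programs without loops. -/
def loopFree : Prog → Bool
  | skip => true
  | assign _ _ => true
  | store _ _ _ => true
  | seq P Q => P.loopFree && Q.loopFree
  | branch _ P Q => P.loopFree && Q.loopFree
  | loop _ _ => false

/-- A bound for the running time of a program without loops. -/
def cost : Prog → ℕ
  | skip => 1
  | assign _ e => e.time + 1
  | store _ i e => i.time + e.time + 1
  | seq P Q => P.cost + Q.cost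
  | branch c P Q => c.time + 1 + (P.cost + Q.cost)
  | loop _ _ => 0

open Classical in
/-- The effect of a program without loops. -/
noncomputable def run (p : ℕ → ℝ≥0) : Prog → State → State
  | skip, s => s
  | assign x e, s => { s with reg := Function.update s.reg x (e.eval s) }
  | store A i e, s =>
    { s with mem := Function.update s.mem A (Function.update (s.mem A) (i.eval s) (e.eval s)) }
  | seq P Q, s => run p Q (run p P s)
  | branch c P Q, s => if c.Holds p s then run p P s else run p Q s
  | loop _ _, s => s

theorem exec_run (p : ℕ → ℝ≥0) {P : Prog} (h : P.loopFree = true) (s : State) :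
    ∃ t ≤ P.cost, Exec p P s t (run p P s) := by
  induction P generalizing s with
  | skip => exact ⟨1, le_rfl, .skip s⟩
  | assign x e => exact ⟨_, le_rfl, .assign x e s⟩
  | store A i e => exact ⟨_, le_rfl, .store A i e s⟩
  | seq P Q ihP ihQ =>
    simp only [loopFree, Bool.and_eq_true] at h
    obtain ⟨t₁, h₁, e₁⟩ := ihP h.1 s
    obtain ⟨t₂, h₂, e₂⟩ := ihQ h.2 (run p P s)
    exact ⟨_, add_le_add h₁ h₂, .seq e₁ e₂⟩
  | branch c P Q ihP ihQ =>
    simp only [loopFree, Bool.and_eq_true] at h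
    by_cases hc : c.Holds p s
    · obtain ⟨t₁, h₁, e₁⟩ := ihP h.1 s
      refine ⟨c.time + 1 + t₁, ?_, ?_⟩
      · simp only [cost]; omega
      · simp only [run, if_pos hc]; exact .branch_true hc e₁
    · obtain ⟨t₁, h₁, e₁⟩ := ihQ h.2 s
      refine ⟨c.time + 1 + t₁, ?_, ?_⟩
      · simp only [cost]; omega
      · simp only [run, if_neg hc]; exact .branch_false hc e₁
  | loop c P _ => simp [loopFree] at h

end Prog

/-- The states `s` and `s'` agree outside the registers and arrays that `P` may change. -/
structure Frame (P : Prog) (s s' : State) : Prop where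
  reg : ∀ x, x ∉ P.regs → s'.reg x = s.reg x
  mem : ∀ A, A ∉ P.arrs → s'.mem A = s.mem A

theorem Frame.rfl' {P : Prog} {s : State} : Frame P s s := ⟨fun _ _ => rfl, fun _ _ => rfl⟩

theorem Frame.trans {P : Prog} {s₁ s₂ s₃ : State} (h : Frame P s₁ s₂) (h' : Frame P s₂ s₃) :
    Frame P s₁ s₃ :=
  ⟨fun x hx => (h'.reg x hx).trans (h.reg x hx), fun A hA => (h'.mem A hA).trans (h.mem A hA)⟩

/-- What a program may change is read off its syntax, so for concrete programs every preservation
fact reduces to a decidable membership in a list of numbers. -/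
theorem Exec.frame {p : ℕ → ℝ≥0} {P : Prog} {s s' : State} {t : ℕ} (h : Exec p P s t s') :
    Frame P s s' := by
  induction h with
  | skip => exact Frame.rfl'
  | assign x e s =>
    refine ⟨fun y hy => ?_, fun _ _ => rfl⟩
    simp only [Prog.regs, List.mem_singleton] at hy
    exact Function.update_of_ne hy _ _
  | store A i e s =>
    refine ⟨fun _ _ => rfl, fun B hB => ?_⟩
    simp only [Prog.arrs, List.mem_singleton] at hB
    exact Function.update_of_ne hB _ _
  | seq _ _ ih₁ ih₂ =>
    constructor
    · intro x hx
      simp only [Prog.regs, List.mem_append, not_or] at hx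
      exact (ih₂.reg x hx.2).trans (ih₁.reg x hx.1)
    · intro x hx
      simp only [Prog.arrs, List.mem_append, not_or] at hx
      exact (ih₂.mem x hx.2).trans (ih₁.mem x hx.1)
  | branch_true _ _ ih =>
    constructor
    · intro x hx
      simp only [Prog.regs, List.mem_append, not_or] at hx
      exact ih.reg x hx.1
    · intro x hx
      simp only [Prog.arrs, List.mem_append, not_or] at hx
      exact ih.mem x hx.1
  | branch_false _ _ ih =>
    constructor
    · intro x hx
      simp only [Prog.regs, List.mem_append, not_or] at hx
      exact ih.reg x hx.2
    · intro x hx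
      simp only [Prog.arrs, List.mem_append, not_or] at hx
      exact ih.mem x hx.2
  | loop_false => exact Frame.rfl'
  | loop_true _ _ _ ih₁ ih₂ =>
    exact ⟨fun x hx => (ih₂.reg x hx).trans (ih₁.reg x hx),
      fun x hx => (ih₂.mem x hx).trans (ih₁.mem x hx)⟩

namespace WP

variable {p : ℕ → ℝ≥0} {P P' : Prog} {T T' : ℕ} {Q Q' : State → Prop} {s : State} {c : Test}

theorem mono (h : WP p P T Q s) (hT : T ≤ T') (hQ : ∀ s', Frame P s s' → Q s' → Q' s') :
    WP p P T' Q' s := by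
  obtain ⟨t, s', h1, h2, h3⟩ := h
  exact ⟨t, s', h1, h2.trans hT, hQ s' h1.frame h3⟩

/-- Loop-free code is verified by computing its effect as a function, so derivations of `Exec` are
needed only for loops. -/
theorem of_run (h : P.loopFree = true) (hT : P.cost ≤ T) (hQ : Q (P.run p s)) : WP p P T Q s := by
  obtain ⟨t, h1, h2⟩ := Prog.exec_run p h s
  exact ⟨t, _, h2, h1.trans hT, hQ⟩

theorem seq (h : WP p P T Q s) (h' : ∀ s', Frame P s s' → Q s' → WP p P' T' Q' s') :
    WP p (.seq P P') (T + T') Q' s := by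
  obtain ⟨t, s', h1, h2, h3⟩ := h
  obtain ⟨t', s'', h4, h5, h6⟩ := h' s' h1.frame h3
  exact ⟨_, s'', .seq h1 h4, add_le_add h2 h5, h6⟩

theorem branch (h : c.Holds p s → WP p P T Q s) (h' : ¬ c.Holds p s → WP p P' T Q s) :
    WP p (.branch c P P') (c.time + 1 + T) Q s := by
  by_cases hc : c.Holds p s
  · obtain ⟨t, s', h1, h2, h3⟩ := h hc
    exact ⟨_, s', .branch_true hc h1, by omega, h3⟩
  · obtain ⟨t, s', h1, h2, h3⟩ := h' hc
    exact ⟨_, s', .branch_false hc h1, by omega, h3⟩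

/-- A loop with the invariant `Inv` and the time potential `Φ`. -/
theorem loop (Inv : State → Prop) (Φ : State → ℕ)
    (hbody : ∀ s', Frame P s s' → Inv s' → c.Holds p s' →
      ∃ T', WP p P T' (fun s'' => Inv s'' ∧ Φ s'' + T' + (c.time + 1) ≤ Φ s') s')
    (h0 : Inv s) (hQ : ∀ s', Frame P s s' → Inv s' → ¬ c.Holds p s' → Q s')
    (hT : Φ s + c.time + 1 ≤ T) : WP p (.loop c P) T Q s := by
  -- Every test takes at least one step, so the potential drops strictly in each round. Induction on
  -- a bound for it proves termination together with the time bound.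
  have key : ∀ N s', Φ s' ≤ N → Frame P s s' → Inv s' →
      WP p (.loop c P) (Φ s' + c.time + 1) (fun s'' => Frame P s s'' ∧ Inv s'' ∧ ¬ c.Holds p s'') s' := by
    intro N
    induction N with
    | zero =>
      intro s' hN hF hI
      by_cases hc : c.Holds p s'
      · obtain ⟨T', t, s'', _, _, _, h⟩ := hbody s' hF hI hc
        omega
      · exact ⟨_, s', .loop_false hc, by omega, hF, hI, hc⟩
    | succ N ih =>
      intro s' hN hF hI
      by_cases hc : c.Holds p s'
      · obtain ⟨T', t, s'', h1, h2, h3, h4⟩ := hbody s' hF hI hc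
        obtain ⟨t', s₃, k1, k2, k3⟩ := ih s'' (by omega) (hF.trans h1.frame) h3
        exact ⟨_, s₃, .loop_true hc h1 k1, by omega, k3⟩
      · exact ⟨_, s', .loop_false hc, by omega, hF, hI, hc⟩
  exact (key _ s le_rfl Frame.rfl' h0).mono hT fun s' _ h => hQ s' h.1 h.2.1 h.2.2

/-- A loop whose iterations take constant time. -/
theorem loop_const (Inv : State → Prop) (φ : State → ℕ) (K : ℕ)
    (hbody : ∀ s', Frame P s s' → Inv s' → c.Holds p s' →
      WP p P K (fun s'' => Inv s'' ∧ φ s'' < φ s') s')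
    (h0 : Inv s) (hQ : ∀ s', Frame P s s' → Inv s' → ¬ c.Holds p s' → Q s')
    (hT : φ s * (K + c.time + 1) + c.time + 1 ≤ T) : WP p (.loop c P) T Q s := by
  refine loop Inv (fun s => φ s * (K + c.time + 1)) (fun s' hF hI hc => ⟨K, ?_⟩) h0 hQ hT
  refine (hbody s' hF hI hc).mono le_rfl fun s'' _ h => ⟨h.1, ?_⟩
  have := Nat.mul_le_mul_right (K + c.time + 1) h.2
  rw [Nat.succ_mul] at this
  omega

end WP

/-- Overwrite a register. -/
def State.setReg (s : State) (x v : ℕ) : State := { s with reg := Function.update s.reg x v }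

/-- `for i := 0, …, n - 1`, where `i` and `n` are registers and the body changes neither. -/
def Prog.forTo (i n : ℕ) (P : Prog) : Prog :=
  .seq (.assign i (.const 0)) (.loop (.lt (.var i) (.var n))
    (.seq P (.assign i (.add (.var i) (.const 1)))))

/-- A counting loop with amortized time: `f k` is the time allowed for the iteration `k`. -/
theorem WP.forTo_sum {p : ℕ → ℝ≥0} {P : Prog} {i n N T : ℕ} {Q : State → Prop} {s : State}
    (f : ℕ → ℕ) (Inv : ℕ → State → Prop)
    (hn : s.reg n = N) (hin : i ≠ n) (hi : i ∉ P.regs) (hnr : n ∉ P.regs)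
    (hst : ∀ k s v, Inv k s → Inv k (s.setReg i v))
    (h0 : Inv 0 s)
    (hbody : ∀ k s', Frame (.forTo i n P) s s' → Inv k s' → s'.reg i = k → k < N →
      WP p P (f k) (Inv (k + 1)) s')
    (hQ : ∀ s', Frame (.forTo i n P) s s' → Inv N s' → s'.reg i = N → Q s')
    (hT : 6 + ∑ k ∈ Finset.range N, (f k + 8) ≤ T) : WP p (.forTo i n P) T Q s := by
  have hF0 : ∀ v, Frame (.forTo i n P) s (s.setReg i v) := fun v =>
    ⟨fun x hx => Function.update_of_ne (fun h => hx (by simp [h, Prog.forTo, Prog.regs])) _ _,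
      fun _ _ => rfl⟩
  have hsub : ∀ s₁ s₂, Frame (.seq P (.assign i (.add (.var i) (.const 1)))) s₁ s₂ →
      Frame (.forTo i n P) s₁ s₂ := fun s₁ s₂ h =>
    ⟨fun x hx => h.reg x fun h' => hx (List.mem_append_right _ h'),
      fun x hx => h.mem x fun h' => hx (List.mem_append_right _ h')⟩
  -- Each round pays 4 steps for the increment and 4 for the test on top of its body, whence the 8.
  -- The initial assignment takes 2 steps and the failing test 4, whence the 6.
  have hloop : WP p (.loop (.lt (.var i) (.var n)) (.seq P (.assign i (.add (.var i) (.const 1)))))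
      (∑ k ∈ Finset.range N, (f k + 8) + 4) Q (s.setReg i 0) := by
    refine WP.loop (fun s' => s'.reg n = N ∧ s'.reg i ≤ N ∧ Inv (s'.reg i) s')
      (fun s' => ∑ k ∈ Finset.Ico (s'.reg i) N, (f k + 8)) ?_ ?_ ?_ ?_
    · rintro s' hF ⟨h1, h2, h3⟩ hc
      simp only [Test.Holds, Expr.eval, h1] at hc
      refine ⟨f (s'.reg i) + 4, ?_⟩
      refine WP.seq (hbody (s'.reg i) s' ((hF0 0).trans (hsub _ _ hF)) h3 rfl hc)
        fun s'' hF' h4 => ?_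
      refine WP.of_run rfl (by simp [Prog.cost, Expr.time]) ?_
      have e1 : s''.reg i = s'.reg i := hF'.reg i hi
      have e2 : s''.reg n = N := (hF'.reg n hnr).trans h1
      have : (Prog.assign i (.add (.var i) (.const 1))).run p s'' = s''.setReg i (s'.reg i + 1) := by
        simp [Prog.run, Expr.eval, State.setReg, e1]
      rw [this]
      have e3 : (s''.setReg i (s'.reg i + 1)).reg i = s'.reg i + 1 := Function.update_self ..
      have e4 : (s''.setReg i (s'.reg i + 1)).reg n = N := by
        rw [← e2]; exact Function.update_of_ne hin.symm _ _
      refine ⟨⟨e4, by rw [e3]; exact hc, by rw [e3]; exact hst _ _ _ h4⟩, ?_⟩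
      rw [e3, Finset.sum_eq_sum_Ico_succ_bot hc]
      simp only [Test.time, Expr.time]
      omega
    · refine ⟨?_, ?_, ?_⟩
      · rw [← hn]; exact Function.update_of_ne hin.symm _ _
      · simp [State.setReg]
      · have : (s.setReg i 0).reg i = 0 := Function.update_self ..
        rw [this]; exact hst _ _ _ h0
    · rintro s' hF ⟨h1, h2, h3⟩ hc
      simp only [Test.Holds, Expr.eval, h1, not_lt] at hc
      have e : s'.reg i = N := le_antisymm h2 hc
      exact hQ s' ((hF0 0).trans (hsub _ _ hF)) (e ▸ h3) e
    · have : (s.setReg i 0).reg i = 0 := Function.update_self ..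
      rw [this, Nat.Ico_zero_eq_range]
      simp only [Test.time, Expr.time]
      omega
  obtain ⟨t, s', h1, h2, h3⟩ := hloop
  refine ⟨_, s', .seq (.assign i (.const 0) s) h1, ?_, h3⟩
  simp only [Expr.time]
  omega

/-- A counting loop whose iterations take constant time. -/
theorem WP.forTo {p : ℕ → ℝ≥0} {P : Prog} {i n N T : ℕ} {Q : State → Prop} {s : State}
    (K : ℕ) (Inv : ℕ → State → Prop)
    (hn : s.reg n = N) (hin : i ≠ n) (hi : i ∉ P.regs) (hnr : n ∉ P.regs)
    (hst : ∀ k s v, Inv k s → Inv k (s.setReg i v))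
    (h0 : Inv 0 s)
    (hbody : ∀ k s', Frame (.forTo i n P) s s' → Inv k s' → s'.reg i = k → k < N →
      WP p P K (Inv (k + 1)) s')
    (hQ : ∀ s', Frame (.forTo i n P) s s' → Inv N s' → s'.reg i = N → Q s')
    (hT : 6 + N * (K + 8) ≤ T) : WP p (.forTo i n P) T Q s :=
  WP.forTo_sum (fun _ => K) Inv hn hin hi hnr hst h0 hbody hQ (by simpa using hT)

end PopMatch

namespace PopMatch

open Finset

/-! ## Breadth first search -/

/-- `v` is `0` if no `j < k` has the key `x`, and `j + 1` for the largest such `j` otherwise. -/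
def Prev (key : ℕ → ℕ) (k x v : ℕ) : Prop :=
  (∀ j < v, j + 1 = v → j < k ∧ key j = x) ∧ ∀ j < k, key j = x → j < v

theorem Prev.succ {key : ℕ → ℕ} {k x v j : ℕ} (h : Prev key k x v) (hv : v = j + 1) :
    j < k ∧ key j = x := h.1 j (by omega) hv.symm

theorem Prev.zero (key : ℕ → ℕ) (x : ℕ) : Prev key 0 x 0 :=
  ⟨fun _ h => absurd h (Nat.not_lt_zero _), fun _ h => absurd h (Nat.not_lt_zero _)⟩

theorem Prev.step_eq {key : ℕ → ℕ} {k x : ℕ} (h : key k = x) : Prev key (k + 1) x (k + 1) :=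
  ⟨fun j _ hj => by obtain rfl : j = k := by omega
                    exact ⟨by omega, h⟩, fun j hj _ => hj⟩

theorem Prev.step_ne {key : ℕ → ℕ} {k x v : ℕ} (hp : Prev key k x v) (h : key k ≠ x) :
    Prev key (k + 1) x v := by
  refine ⟨fun j hj hjv => ⟨by have := (hp.1 j hj hjv).1; omega, (hp.1 j hj hjv).2⟩, fun j hj hx => ?_⟩
  rcases Nat.lt_succ_iff_lt_or_eq.1 hj with h1 | rfl
  · exact hp.2 j h1 hx
  · exact absurd hx h

/-- The data that a search uses: the people `0, …, n - 1`, the edges `0, …, m - 1` with their ends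
and marks, an assignment, capacities, loads and weights of the items, and the linked lists of the
edges of every person and of the people at every item. -/
structure Net where
  n : ℕ
  m : ℕ
  per : ℕ → ℕ
  it : ℕ → ℕ
  ok : ℕ → ℕ
  M : ℕ → ℕ
  cap : ℕ → ℕ
  used : ℕ → ℕ
  head : ℕ → ℕ
  nxt : ℕ → ℕ
  mh : ℕ → ℕ
  mn : ℕ → ℕ
  w : ℕ → ℕ ×ₗ ℝ≥0

namespace Net

variable (N : Net)

/-- The number `0` (for unmatched people) and the items that occur in edges. -/
def IsItem (x : ℕ) : Prop := x = 0 ∨ ∃ e < N.m, N.it e = x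

/-- The graph of the marked edges. -/
def R (a b : ℕ) : Prop := ∃ e < N.m, N.per e = a ∧ N.it e = b ∧ N.ok e = 1

/-- The graph is well-formed, and its linked lists are correct. -/
structure GraphOk : Prop where
  per_lt : ∀ e < N.m, N.per e < N.n
  it_ne : ∀ e < N.m, N.it e ≠ 0
  head : ∀ a < N.n, Prev N.per N.m a (N.head a)
  nxt : ∀ e < N.m, Prev N.per e (N.per e) (N.nxt e)

/-- The linked lists and the loads of the assignment are correct. -/
structure ListsOk : Prop where
  item : ∀ a < N.n, N.IsItem (N.M a)
  mh : ∀ x, N.IsItem x → Prev N.M N.n x (N.mh x)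
  mn : ∀ a < N.n, Prev N.M a (N.M a) (N.mn a)
  used : ∀ x, N.IsItem x → N.used x = load N.n N.M x

/-- The search from `start` has put the items `Q 0, …, Q (qt - 1)` into its queue; the person
`par b - 1` has led to the item `b`. -/
structure Visited (start : ℕ) (par Q : ℕ → ℕ) (qt : ℕ) : Prop where
  pos : 0 < qt
  zero : Q 0 = start
  parent : ∀ j < qt, 0 < j →
    ∃ a i, par (Q j) = a + 1 ∧ a < N.n ∧ i < j ∧ N.M a = Q i ∧ N.R a (Q j)
  inj : ∀ i j, i < j → j < qt → Q i ≠ Q j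

/-- The best free item in the queue is `best`, which is `0` if there is none. -/
def Best (Q : ℕ → ℕ) (qt best : ℕ) : Prop :=
  (best = 0 → ∀ j < qt, 0 < j → N.cap (Q j) ≤ N.used (Q j)) ∧
  (best ≠ 0 → (∃ j < qt, 0 < j ∧ Q j = best) ∧ N.used best < N.cap best ∧
    ∀ j < qt, 0 < j → N.used (Q j) < N.cap (Q j) → N.w best ≤ N.w (Q j))

/-- The edges of the person `a` have been or are being scanned. -/
def Done (Q : ℕ → ℕ) (y qh a : ℕ) : Prop := ∃ j < qh, N.M a = Q j ∧ (j + 1 = qh → y ≤ a)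

/-- The edge `e` has been scanned. -/
def Scanned (Q : ℕ → ℕ) (x y c qh e : ℕ) : Prop :=
  N.Done Q y qh (N.per e) ∧ (N.per e = c → x ≤ e)

/-- The invariant of the search: `x` is the next edge of the person `c`, and `y` the next person at
the item `Q (qh - 1)`. -/
structure Bfs (start : ℕ) (par Q : ℕ → ℕ) (x y c qh qt best : ℕ) : Prop where
  vis : N.Visited start par Q qt
  best : N.Best Q qt best
  item : ∀ j < qt, N.IsItem (Q j)
  par : ∀ b, N.IsItem b → (par b ≠ 0 ↔ ∃ j < qt, Q j = b)
  le : qh ≤ qt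
  edge : ∀ e, x = e + 1 → e < N.m ∧ N.per e = c ∧ N.Done Q y qh c
  person : ∀ a, y = a + 1 → a < N.n ∧ ∃ j, j + 1 = qh ∧ N.M a = Q j
  closed : ∀ e < N.m, N.Scanned Q x y c qh e → N.ok e = 1 → ∃ j < qt, Q j = N.it e

open Classical in
/-- The number of steps left. -/
noncomputable def pot (Q : ℕ → ℕ) (x y c qh qt : ℕ) : ℕ :=
  2 * #{e ∈ range N.m | ¬ N.Scanned Q x y c qh e} + #{a ∈ range N.n | ¬ N.Done Q y qh a} + (qt - qh)

variable {N} {start : ℕ} {par Q : ℕ → ℕ} {x y c qh qt best : ℕ}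

theorem pot_le (h : qt ≤ 1) : N.pot Q x y c qh qt ≤ 2 * N.m + N.n + 1 := by
  classical
  unfold pot
  have h1 := card_filter_le (range N.m) fun e => ¬ N.Scanned Q x y c qh e
  have h2 := card_filter_le (range N.n) fun a => ¬ N.Done Q y qh a
  rw [card_range] at h1 h2
  omega

theorem Bfs.init (hs : N.IsItem start) (h0 : ∀ b, N.IsItem b → (par b ≠ 0 ↔ b = start))
    (hQ : Q 0 = start) (c : ℕ) : N.Bfs start par Q 0 0 c 0 1 0 where
  vis := ⟨one_pos, hQ, fun j hj hj0 => by omega, fun i j hij hj => by omega⟩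
  best := ⟨fun _ j hj hj0 => by omega, fun h => absurd rfl h⟩
  item := fun j hj => by
    obtain rfl : j = 0 := by omega
    rwa [hQ]
  par := fun b hb => by
    rw [h0 b hb]
    constructor
    · rintro rfl; exact ⟨0, one_pos, hQ⟩
    · rintro ⟨j, hj, rfl⟩
      obtain rfl : j = 0 := by omega
      exact hQ
  le := Nat.zero_le _
  edge := fun e h => by omega
  person := fun e h => by omega
  closed := fun e _ h => by
    obtain ⟨⟨j, hj, _⟩, _⟩ := h
    omega

/-- The lists run through the edges of a person in decreasing order without gaps, so moving the
pointer past `e` adds no other edge to the scanned ones. -/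
theorem scanned_of_scanned_nxt (hG : N.GraphOk) {e : ℕ} (he : e < N.m) (hc : N.per e = c)
    {e' : ℕ} (h : N.Scanned Q (N.nxt e) y c qh e') (hne : e' ≠ e) : N.Scanned Q (e + 1) y c qh e' := by
  refine ⟨h.1, fun h' => ?_⟩
  by_contra hlt
  have := (hG.nxt e he).2 e' (by omega) (h'.trans hc.symm)
  have := h.2 h'
  omega

theorem scanned_nxt (hG : N.GraphOk) {e : ℕ} (he : e < N.m)
    {e' : ℕ} (h : N.Scanned Q (e + 1) y c qh e') : N.Scanned Q (N.nxt e) y c qh e' := by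
  refine ⟨h.1, fun h' => ?_⟩
  have h1 := h.2 h'
  by_contra hlt
  obtain ⟨v, hv⟩ : ∃ v, N.nxt e = v + 1 := ⟨N.nxt e - 1, by omega⟩
  have := ((hG.nxt e he).succ hv).1
  omega

theorem card_scanned_lt (hG : N.GraphOk) {e : ℕ} (he : e < N.m) (hc : N.per e = c)
    (hd : N.Done Q y qh c) [DecidablePred fun e' => ¬ N.Scanned Q (N.nxt e) y c qh e']
    [DecidablePred fun e' => ¬ N.Scanned Q (e + 1) y c qh e'] :
    #{e' ∈ range N.m | ¬ N.Scanned Q (N.nxt e) y c qh e'} <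
      #{e' ∈ range N.m | ¬ N.Scanned Q (e + 1) y c qh e'} := by
  refine card_lt_card ⟨fun e' h' => ?_, fun hsub => ?_⟩
  · obtain ⟨h1, h2⟩ := mem_filter.1 h'
    exact mem_filter.2 ⟨h1, fun h => h2 (scanned_nxt hG he h)⟩
  · have h1 : e ∈ {e' ∈ range N.m | ¬ N.Scanned Q (e + 1) y c qh e'} :=
      mem_filter.2 ⟨mem_range.2 he, fun h => by have := h.2 hc; omega⟩
    refine (mem_filter.1 (hsub h1)).2 ⟨hc ▸ hd, fun _ => ?_⟩
    by_contra hlt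
    obtain ⟨v, hv⟩ : ∃ v, N.nxt e = v + 1 := ⟨N.nxt e - 1, by omega⟩
    have := ((hG.nxt e he).succ hv).1
    omega

/-- Scanning an edge that leads to nothing new. -/
theorem Bfs.scan_old (hG : N.GraphOk) {e : ℕ} (h : N.Bfs start par Q (e + 1) y c qh qt best)
    (hold : N.ok e = 1 → par (N.it e) ≠ 0) :
    N.Bfs start par Q (N.nxt e) y c qh qt best ∧
      N.pot Q (N.nxt e) y c qh qt < N.pot Q (e + 1) y c qh qt := by
  classical
  obtain ⟨he, hc, hd⟩ := h.edge e rfl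
  refine ⟨{ h with edge := fun v hv => ?_, closed := fun e' he' hs hok => ?_ }, ?_⟩
  · obtain ⟨h1, h2⟩ := (hG.nxt e he).succ hv
    exact ⟨h1.trans he, h2.trans hc, hd⟩
  · by_cases hee : e' = e
    · subst hee
      exact (h.par _ (Or.inr ⟨e', he, rfl⟩)).1 (hold hok)
    · exact h.closed e' he' (scanned_of_scanned_nxt hG he hc hs hee) hok
  · have := card_scanned_lt hG he hc hd
    unfold pot
    omega

/-- Which people are done depends only on the queue below `qh`; appending at position `qt` does not
affect it. -/
theorem done_update {b : ℕ} (h : qh ≤ qt) (a : ℕ) :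
    N.Done (Function.update Q qt b) y qh a ↔ N.Done Q y qh a := by
  unfold Done
  refine exists_congr fun j => and_congr_right fun hj => ?_
  rw [Function.update_of_ne (by omega)]

theorem scanned_update {b : ℕ} (h : qh ≤ qt) (e : ℕ) :
    N.Scanned (Function.update Q qt b) x y c qh e ↔ N.Scanned Q x y c qh e := by
  unfold Scanned
  rw [done_update h]

theorem exists_lt_succ_update {b z : ℕ} :
    (∃ j < qt + 1, Function.update Q qt b j = z) ↔ (∃ j < qt, Q j = z) ∨ b = z := by
  constructor
  · rintro ⟨j, hj, h⟩
    by_cases hjq : j = qt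
    · subst hjq; rw [Function.update_self] at h; exact Or.inr h
    · rw [Function.update_of_ne hjq] at h; exact Or.inl ⟨j, by omega, h⟩
  · rintro (⟨j, hj, h⟩ | h)
    · exact ⟨j, by omega, by rwa [Function.update_of_ne (by omega)]⟩
    · exact ⟨qt, by omega, by rwa [Function.update_self]⟩

/-- Scanning an edge that leads to a new item. -/
theorem Bfs.scan_new (hG : N.GraphOk) {e best' : ℕ}
    (h : N.Bfs start par Q (e + 1) y c qh qt best)
    (hok : N.ok e = 1) (hnew : par (N.it e) = 0)
    (hbest : (N.used (N.it e) < N.cap (N.it e) ∧ (best = 0 ∨ N.w (N.it e) < N.w best) ∧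
        best' = N.it e) ∨
      (¬ (N.used (N.it e) < N.cap (N.it e) ∧ (best = 0 ∨ N.w (N.it e) < N.w best)) ∧
        best' = best)) :
    N.Bfs start (Function.update par (N.it e) (c + 1)) (Function.update Q qt (N.it e)) (N.nxt e) y c
        qh (qt + 1) best' ∧
      N.pot (Function.update Q qt (N.it e)) (N.nxt e) y c qh (qt + 1) <
        N.pot Q (e + 1) y c qh qt := by
  classical
  obtain ⟨he, hc, hd⟩ := h.edge e rfl
  have hitem : N.IsItem (N.it e) := Or.inr ⟨e, he, rfl⟩
  have hnotin : ∀ j < qt, Q j ≠ N.it e := fun j hj hj' =>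
    (h.par _ hitem).2 ⟨j, hj, hj'⟩ hnew
  have hle := h.le
  have hpos := h.vis.pos
  have hdone := fun a => done_update (N := N) (Q := Q) (y := y) (b := N.it e) h.le a
  have hne := hG.it_ne e he
  constructor
  · refine ⟨⟨by omega, ?_, ?_, ?_⟩, ?_, ?_, ?_, by omega, ?_, ?_, ?_⟩
    · rw [Function.update_of_ne (by omega)]; exact h.vis.zero
    · intro j hj hj0
      by_cases hjq : j = qt
      · subst hjq
        obtain ⟨i, hi, hMi, _⟩ := hd
        refine ⟨c, i, ?_, ?_, by omega, ?_, e, he, hc, ?_, hok⟩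
        · rw [Function.update_self, Function.update_self]
        · rw [← hc]; exact hG.per_lt e he
        · rw [Function.update_of_ne (by omega)]; exact hMi
        · rw [Function.update_self]
      · obtain ⟨a, i, h1, h2, h3, h4, h5⟩ := h.vis.parent j (by omega) hj0
        refine ⟨a, i, ?_, h2, h3, ?_, ?_⟩
        · rw [Function.update_of_ne hjq, Function.update_of_ne (hnotin j (by omega))]; exact h1
        · rw [Function.update_of_ne (by omega)]; exact h4
        · rw [Function.update_of_ne hjq]; exact h5
    · intro i j hij hj
      rw [Function.update_of_ne (show i ≠ qt by omega)]
      by_cases hjq : j = qt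
      · subst hjq; rw [Function.update_self]; exact hnotin i hij
      · rw [Function.update_of_ne hjq]; exact h.vis.inj i j hij (by omega)
    · -- the best free item
      have hold : ∀ j < qt, Function.update Q qt (N.it e) j = Q j := fun j hj =>
        Function.update_of_ne (by omega) _ _
      have hlast : Function.update Q qt (N.it e) qt = N.it e := Function.update_self ..
      rcases hbest with ⟨hf, hb, rfl⟩ | ⟨hnf, rfl⟩
      · refine ⟨fun h0 => absurd h0 hne, fun _ => ⟨⟨qt, by omega, hpos, hlast⟩, hf, ?_⟩⟩
        intro j hj hj0 hfj
        by_cases hjq : j = qt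
        · subst hjq; rw [hlast]
        · rw [hold j (by omega)] at hfj ⊢
          by_cases hb0 : best = 0
          · exact absurd hfj (not_lt.2 (h.best.1 hb0 j (by omega) hj0))
          · exact (hb.resolve_left hb0).le.trans ((h.best.2 hb0).2.2 j (by omega) hj0 hfj)
      · refine ⟨fun h0 j hj hj0 => ?_, fun h0 => ⟨?_, (h.best.2 h0).2.1, fun j hj hj0 hfj => ?_⟩⟩
        · by_cases hjq : j = qt
          · subst hjq
            rw [hlast]
            by_contra hlt
            exact hnf ⟨not_le.1 hlt, Or.inl h0⟩
          · rw [hold j (by omega)]; exact h.best.1 h0 j (by omega) hj0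
        · obtain ⟨j, hj, hj0, hjb⟩ := (h.best.2 h0).1
          exact ⟨j, by omega, hj0, (hold j hj).trans hjb⟩
        · by_cases hjq : j = qt
          · subst hjq
            rw [hlast] at hfj ⊢
            by_contra hlt
            exact hnf ⟨hfj, Or.inr (not_le.1 hlt)⟩
          · rw [hold j (by omega)] at hfj ⊢
            exact (h.best.2 h0).2.2 j (by omega) hj0 hfj
    · intro j hj
      by_cases hjq : j = qt
      · subst hjq; rw [Function.update_self]; exact hitem
      · rw [Function.update_of_ne hjq]; exact h.item j (by omega)
    · intro b hb
      rw [exists_lt_succ_update]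
      by_cases hbe : b = N.it e
      · subst hbe; simp
      · rw [Function.update_of_ne hbe, h.par b hb]
        simp [Ne.symm hbe]
    · intro v hv
      obtain ⟨h1, h2⟩ := (hG.nxt e he).succ hv
      exact ⟨h1.trans he, h2.trans hc, (hdone c).2 hd⟩
    · intro a ha
      obtain ⟨h1, j, h2, h3⟩ := h.person a ha
      exact ⟨h1, j, h2, by rw [Function.update_of_ne (by omega)]; exact h3⟩
    · intro e' he' hs hok'
      rw [scanned_update h.le] at hs
      rw [exists_lt_succ_update]
      by_cases hee : e' = e
      · subst hee; exact Or.inr rfl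
      · exact Or.inl (h.closed e' he' (scanned_of_scanned_nxt hG he hc hs hee) hok')
  -- The queue grows by one here. This is why an unscanned edge counts twice in the potential.
  · have := card_scanned_lt hG he hc hd
    unfold pot
    simp only [scanned_update h.le, hdone]
    omega

/-- Turning to the next person at the current item. -/
theorem Bfs.expand (hG : N.GraphOk) (hL : N.ListsOk) {a : ℕ}
    (h : N.Bfs start par Q 0 (a + 1) c qh qt best) :
    N.Bfs start par Q (N.head a) (N.mn a) a qh qt best ∧
      N.pot Q (N.head a) (N.mn a) a qh qt < N.pot Q 0 (a + 1) c qh qt := by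
  classical
  obtain ⟨ha, j, hj, hMa⟩ := h.person a rfl
  have hle := h.le
  have hmn := hL.mn a ha
  have hmnle : N.mn a ≤ a := by
    by_contra hlt
    obtain ⟨v, hv⟩ : ∃ v, N.mn a = v + 1 := ⟨N.mn a - 1, by omega⟩
    have := (hmn.succ hv).1
    omega
  have hmono : ∀ a', N.Done Q (a + 1) qh a' → N.Done Q (N.mn a) qh a' := by
    rintro a' ⟨i, hi, h1, h2⟩
    exact ⟨i, hi, h1, fun h3 => by have := h2 h3; omega⟩
  have hself : N.Done Q (N.mn a) qh a := ⟨j, by omega, hMa, fun _ => hmnle⟩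
  have hinv : ∀ a', N.Done Q (N.mn a) qh a' → a' ≠ a → N.Done Q (a + 1) qh a' := by
    rintro a' ⟨i, hi, h1, h2⟩ hne
    refine ⟨i, hi, h1, fun h3 => ?_⟩
    have h4 := h2 h3
    by_contra hlt
    obtain rfl : i = j := by omega
    have := hmn.2 a' (by omega) (h1.trans hMa.symm)
    omega
  refine ⟨{ h with edge := fun v hv => ?_, person := fun v hv => ?_, closed := fun e he hs hok => ?_ },
    ?_⟩
  · obtain ⟨h1, h2⟩ := (hG.head a ha).succ hv
    exact ⟨h1, h2, hself⟩
  · obtain ⟨h1, h2⟩ := hmn.succ hv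
    exact ⟨h1.trans ha, j, hj, h2.trans hMa⟩
  -- No edge of `a` counts as scanned yet, since all of them lie below the head of her list. Any
  -- other scanned edge belongs to a person who was done before.
  · by_cases hp : N.per e = a
    · have := (hG.head a ha).2 e he hp
      have := hs.2 hp
      omega
    · exact h.closed e he ⟨hinv _ hs.1 hp, fun _ => Nat.zero_le _⟩ hok
  -- The queue has no repetitions, so `a` cannot have been handled at an earlier occurrence of her
  -- item.
  · have hnot : ¬ N.Done Q (a + 1) qh a := by
      rintro ⟨i, hi, h1, h2⟩
      by_cases h3 : i + 1 = qh
      · have := h2 h3; omega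
      · exact h.vis.inj i j (by omega) (by omega) (h1.symm.trans hMa)
    have c1 : #{e ∈ range N.m | ¬ N.Scanned Q (N.head a) (N.mn a) a qh e} ≤
        #{e ∈ range N.m | ¬ N.Scanned Q 0 (a + 1) c qh e} := by
      refine card_le_card fun e he => ?_
      obtain ⟨h1, h2⟩ := mem_filter.1 he
      refine mem_filter.2 ⟨h1, fun hs => h2 ⟨hmono _ hs.1, fun hp => ?_⟩⟩
      exact absurd (hp ▸ hs.1) hnot
    have c2 : #{a' ∈ range N.n | ¬ N.Done Q (N.mn a) qh a'} <
        #{a' ∈ range N.n | ¬ N.Done Q (a + 1) qh a'} := by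
      refine card_lt_card ⟨fun a' h' => ?_, fun hsub => ?_⟩
      · obtain ⟨h1, h2⟩ := mem_filter.1 h'
        exact mem_filter.2 ⟨h1, fun h => h2 (hmono _ h)⟩
      · exact (mem_filter.1 (hsub (mem_filter.2 ⟨mem_range.2 ha, hnot⟩))).2 hself
    unfold pot
    omega

/-- Turning to the next item of the queue. -/
theorem Bfs.pop (hG : N.GraphOk) (hL : N.ListsOk) (h : N.Bfs start par Q 0 0 c qh qt best) (hlt : qh < qt) :
    N.Bfs start par Q 0 (N.mh (Q qh)) c (qh + 1) qt best ∧
      N.pot Q 0 (N.mh (Q qh)) c (qh + 1) qt < N.pot Q 0 0 c qh qt := by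
  classical
  have hmh := hL.mh _ (h.item qh hlt)
  -- With the pointer at the head of the list of the new item, nobody there is done. With the
  -- pointer at `0`, everybody at the old item was.
  have hdone : ∀ a < N.n, N.Done Q (N.mh (Q qh)) (qh + 1) a ↔ N.Done Q 0 qh a := by
    intro a ha
    constructor
    · rintro ⟨i, hi, h1, h2⟩
      by_cases hiq : i = qh
      · subst hiq
        have := hmh.2 a ha h1
        have := h2 rfl
        omega
      · exact ⟨i, by omega, h1, fun _ => Nat.zero_le _⟩
    · rintro ⟨i, hi, h1, _⟩
      exact ⟨i, by omega, h1, fun _ => by omega⟩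
  refine ⟨{ h with edge := fun v hv => ?_, person := fun v hv => ?_, le := hlt,
                   closed := fun e he hs hok => ?_ }, ?_⟩
  · omega
  · obtain ⟨h1, h2⟩ := hmh.succ hv
    exact ⟨h1, qh, rfl, h2⟩
  · exact h.closed e he ⟨(hdone _ (hG.per_lt e he)).1 hs.1, hs.2⟩ hok
  · have c1 : #{e ∈ range N.m | ¬ N.Scanned Q 0 (N.mh (Q qh)) c (qh + 1) e} ≤
        #{e ∈ range N.m | ¬ N.Scanned Q 0 0 c qh e} := by
      refine card_le_card fun e he => ?_
      obtain ⟨h1, h2⟩ := mem_filter.1 he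
      refine mem_filter.2 ⟨h1, fun hs => h2 ⟨?_, hs.2⟩⟩
      obtain ⟨i, hi, h3, _⟩ := hs.1
      exact ⟨i, by omega, h3, fun _ => by omega⟩
    have c2 : #{a ∈ range N.n | ¬ N.Done Q (N.mh (Q qh)) (qh + 1) a} ≤
        #{a ∈ range N.n | ¬ N.Done Q 0 qh a} := by
      refine card_le_card fun a ha => ?_
      obtain ⟨h1, h2⟩ := mem_filter.1 ha
      exact mem_filter.2 ⟨h1, fun hs => h2 ((hdone a (mem_range.1 h1)).2 hs)⟩
    unfold pot
    omega

/-- At the end of the search, the visited items are closed. -/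
theorem Bfs.isClosed (h : N.Bfs start par Q 0 0 c qh qt best) (hle : qt ≤ qh) :
    Closed N.n N.R N.M {x | ∃ j < qt, Q j = x} := by
  rintro a ha ⟨j, hj, hja⟩ b ⟨e, he, hea, rfl, hok⟩
  exact h.closed e he ⟨⟨j, by omega, by rw [hea, hja], fun _ => Nat.zero_le _⟩,
    fun _ => Nat.zero_le _⟩ hok

end Net

end PopMatch

namespace PopMatch

open Finset

/-! ## The search program

Registers: `0` number of people, `3` number of edges, `5` loop counter, `7` start, `8` best free
item, `9` and `10` ends of the queue, `11` edge pointer, `12` person pointer, `13` current person.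
Arrays: `0`, `1` ends of the edges, `4` assignment, `5` capacities, `6` loads, `7`, `8` lists of
edges, `9` marks of edges, `10`, `11` lists of people, `12` parents, `13` queue, `16` classes of
items. Items are numbered from `1` on. -/

/-- Empty the lists of people and the parents of the items. -/
def resetItem : Prog :=
  .seq (.store 6 (.get 1 (.var 5)) (.const 0))
    (.seq (.store 10 (.get 1 (.var 5)) (.const 0)) (.store 12 (.get 1 (.var 5)) (.const 0)))

/-- Insert a person into the list of her item. -/
def insertPerson : Prog :=
  .seq (.store 11 (.var 5) (.get 10 (.get 4 (.var 5))))
    (.seq (.store 10 (.get 4 (.var 5)) (.add (.var 5) (.const 1)))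
      (.store 6 (.get 4 (.var 5)) (.add (.get 6 (.get 4 (.var 5))) (.const 1))))

/-- The test whether the item `15` is strictly better than the item `8`. -/
def better : Test :=
  .not (.and (.not (.lt (.get 16 (.var 15)) (.get 16 (.var 8))))
    (.not (.and (.eq (.get 16 (.var 8)) (.get 16 (.var 15)))
      (.not (.costLe (.sub (.var 8) (.const 1)) (.sub (.var 15) (.const 1)))))))

/-- Mark an item as visited and put it into the queue. -/
def visitItem : Prog :=
  .seq (.assign 15 (.get 1 (.var 14)))
    (.seq (.store 12 (.var 15) (.add (.var 13) (.const 1)))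
      (.seq (.store 13 (.var 10) (.var 15)) (.assign 10 (.add (.var 10) (.const 1)))))

/-- Make the item `15` the best one if it is free and better. -/
def compareBest : Prog :=
  .branch (.and (.lt (.get 6 (.var 15)) (.get 5 (.var 15)))
      (.not (.and (.not (.eq (.var 8) (.const 0))) (.not better))))
    (.assign 8 (.var 15)) .skip

/-- One step of the search. -/
def searchStep : Prog :=
  .branch (.lt (.const 0) (.var 11))
    (.seq (.assign 14 (.sub (.var 11) (.const 1)))
      (.seq (.assign 11 (.get 8 (.var 14)))
        (.branch (.and (.eq (.get 9 (.var 14)) (.const 1))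
            (.eq (.get 12 (.get 1 (.var 14))) (.const 0)))
          (.seq visitItem compareBest) .skip)))
    (.branch (.lt (.const 0) (.var 12))
      (.seq (.assign 13 (.sub (.var 12) (.const 1)))
        (.seq (.assign 12 (.get 11 (.var 13))) (.assign 11 (.get 7 (.var 13)))))
      (.seq (.assign 12 (.get 10 (.get 13 (.var 9)))) (.assign 9 (.add (.var 9) (.const 1)))))

/-- The initialization of the search. -/
def searchInit : Prog :=
  .seq (.store 12 (.var 7) (.const 1))
    (.seq (.store 13 (.const 0) (.var 7))
      (.seq (.assign 8 (.const 0)) (.seq (.assign 9 (.const 0)) (.seq (.assign 10 (.const 1))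
        (.seq (.assign 11 (.const 0)) (.assign 12 (.const 0)))))))

/-- The first cells of the arrays of the items, which belong to no item. -/
def resetZero : Prog :=
  .seq (.store 6 (.const 0) (.const 0))
    (.seq (.store 10 (.const 0) (.const 0)) (.store 12 (.const 0) (.const 0)))

/-- The main loop of the search. -/
def searchLoop : Prog :=
  .loop (.lt (.const 0) (.add (.var 11) (.add (.var 12) (.sub (.var 10) (.var 9))))) searchStep

/-- Search from the item `7` for the best free item. -/
def search : Prog :=
  .seq resetZero (.seq (.forTo 5 3 resetItem) (.seq (.forTo 5 0 insertPerson)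
    (.seq searchInit searchLoop)))

/-- The data of the search in the memory. -/
noncomputable def netOf (p : ℕ → ℝ≥0) (s : State) : Net where
  n := s.reg 0
  m := s.reg 3
  per := s.mem 0
  it := s.mem 1
  ok := s.mem 9
  M := s.mem 4
  cap := s.mem 5
  used := s.mem 6
  head := s.mem 7
  nxt := s.mem 8
  mh := s.mem 10
  mn := s.mem 11
  w := weight (s.mem 16) fun x => p (x - 1)

variable {p : ℕ → ℝ≥0}

theorem better_holds {s : State} : better.Holds p s ↔
    (netOf p s).w (s.reg 15) < (netOf p s).w (s.reg 8) := by
  simp only [better, Test.Holds, Expr.eval, netOf, weight, Prod.Lex.toLex_lt_toLex, not_and_or,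
    not_not, not_le, eq_comm (a := s.mem 16 (s.reg 8))]
  tauto

open Classical in
theorem compareBest_run (s : State) : compareBest.run p s =
    if (netOf p s).used (s.reg 15) < (netOf p s).cap (s.reg 15) ∧ (s.reg 8 = 0 ∨
      (netOf p s).w (s.reg 15) < (netOf p s).w (s.reg 8)) then s.setReg 8 (s.reg 15) else s := by
  unfold compareBest
  simp only [Prog.run, Test.Holds, Expr.eval, better_holds, not_and_or, not_not]
  rfl

/-- The cases are an edge pointer that is set (new or old target), otherwise a person pointer that
is set, otherwise the next item of the queue. They match `Bfs.scan_new`, `Bfs.scan_old`,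
`Bfs.expand` and `Bfs.pop`. -/
theorem searchStep_spec {s : State} {start : ℕ} (hG : (netOf p s).GraphOk)
    (hL : (netOf p s).ListsOk)
    (h : (netOf p s).Bfs start (s.mem 12) (s.mem 13) (s.reg 11) (s.reg 12) (s.reg 13) (s.reg 9)
      (s.reg 10) (s.reg 8))
    (hc : 0 < s.reg 11 + (s.reg 12 + (s.reg 10 - s.reg 9))) :
    let s' := searchStep.run p s
    netOf p s' = netOf p s ∧
    (netOf p s).Bfs start (s'.mem 12) (s'.mem 13) (s'.reg 11) (s'.reg 12) (s'.reg 13) (s'.reg 9)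
      (s'.reg 10) (s'.reg 8) ∧
    (netOf p s).pot (s'.mem 13) (s'.reg 11) (s'.reg 12) (s'.reg 13) (s'.reg 9) (s'.reg 10) <
      (netOf p s).pot (s.mem 13) (s.reg 11) (s.reg 12) (s.reg 13) (s.reg 9) (s.reg 10) := by
  intro s'
  have hnet : netOf p s' = netOf p s := by
    obtain ⟨t, _, he⟩ := Prog.exec_run p (P := searchStep) rfl s
    have hF := he.frame
    unfold netOf
    rw [hF.reg 0 (by decide), hF.reg 3 (by decide), hF.mem 0 (by decide), hF.mem 1 (by decide),
      hF.mem 9 (by decide), hF.mem 4 (by decide), hF.mem 5 (by decide), hF.mem 6 (by decide),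
      hF.mem 7 (by decide), hF.mem 8 (by decide), hF.mem 10 (by decide), hF.mem 11 (by decide),
      hF.mem 16 (by decide)]
  refine ⟨hnet, ?_⟩
  by_cases hx : 0 < s.reg 11
  · obtain ⟨e, he⟩ : ∃ e, s.reg 11 = e + 1 := ⟨s.reg 11 - 1, by omega⟩
    rw [he] at h ⊢
    by_cases hnew : s.mem 9 e = 1 ∧ s.mem 12 (s.mem 1 e) = 0
    · obtain ⟨s₁, hs₁⟩ : ∃ s₁ : State, s₁ = visitItem.run p
          { s with reg := Function.update (Function.update s.reg 14 e) 11 (s.mem 8 e) } := ⟨_, rfl⟩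
      have e' : s' = compareBest.run p s₁ := by
        rw [hs₁]
        simp [s', searchStep, Prog.run, Test.Holds, Expr.eval, he, hnew]
      have hs : s₁.mem 12 = Function.update (s.mem 12) (s.mem 1 e) (s.reg 13 + 1) ∧
          s₁.mem 13 = Function.update (s.mem 13) (s.reg 10) (s.mem 1 e) ∧
          s₁.reg 11 = s.mem 8 e ∧ s₁.reg 12 = s.reg 12 ∧ s₁.reg 13 = s.reg 13 ∧
          s₁.reg 9 = s.reg 9 ∧ s₁.reg 10 = s.reg 10 + 1 ∧ s₁.reg 8 = s.reg 8 ∧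
          s₁.reg 15 = s.mem 1 e ∧ netOf p s₁ = netOf p s := by
        rw [hs₁]
        simp [visitItem, Prog.run, Expr.eval, netOf]
      obtain ⟨h1, h2, h3, h4, h5, h6, h7, h8, h9, h10⟩ := hs
      rw [e', compareBest_run, h10, h9, h8]
      split_ifs with hb
      · change (netOf p s).Bfs start (s₁.mem 12) (s₁.mem 13) (s₁.reg 11) (s₁.reg 12) (s₁.reg 13)
          (s₁.reg 9) (s₁.reg 10) (s.mem 1 e) ∧ (netOf p s).pot (s₁.mem 13) (s₁.reg 11) (s₁.reg 12)
          (s₁.reg 13) (s₁.reg 9) (s₁.reg 10) < _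
        rw [h1, h2, h3, h4, h5, h6, h7]
        exact h.scan_new hG hnew.1 hnew.2 (Or.inl ⟨hb.1, hb.2, rfl⟩)
      · rw [h1, h2, h3, h4, h5, h6, h7, h8]
        exact h.scan_new hG hnew.1 hnew.2 (Or.inr ⟨hb, rfl⟩)
    · have hs' : s'.mem 12 = s.mem 12 ∧ s'.mem 13 = s.mem 13 ∧
          s'.reg 11 = s.mem 8 e ∧ s'.reg 12 = s.reg 12 ∧ s'.reg 13 = s.reg 13 ∧
          s'.reg 9 = s.reg 9 ∧ s'.reg 10 = s.reg 10 ∧ s'.reg 8 = s.reg 8 := by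
        simp [s', searchStep, Prog.run, Test.Holds, Expr.eval, he, hnew]
      obtain ⟨h1, h2, h3, h4, h5, h6, h7, h8⟩ := hs'
      rw [h1, h2, h3, h4, h5, h6, h7, h8]
      exact h.scan_old hG fun h1 h2 => hnew ⟨h1, h2⟩
  · have hx0 : s.reg 11 = 0 := by omega
    rw [hx0] at h ⊢
    by_cases hy : 0 < s.reg 12
    · obtain ⟨a, ha⟩ : ∃ a, s.reg 12 = a + 1 := ⟨s.reg 12 - 1, by omega⟩
      rw [ha] at h ⊢
      have hs' : s'.mem 12 = s.mem 12 ∧ s'.mem 13 = s.mem 13 ∧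
          s'.reg 11 = s.mem 7 a ∧ s'.reg 12 = s.mem 11 a ∧ s'.reg 13 = a ∧
          s'.reg 9 = s.reg 9 ∧ s'.reg 10 = s.reg 10 ∧ s'.reg 8 = s.reg 8 := by
        simp [s', searchStep, Prog.run, Test.Holds, Expr.eval, hx0, ha]
      obtain ⟨h1, h2, h3, h4, h5, h6, h7, h8⟩ := hs'
      rw [h1, h2, h3, h4, h5, h6, h7, h8]
      exact h.expand hG hL
    · have hy0 : s.reg 12 = 0 := by omega
      rw [hy0] at h ⊢
      have hs' : s'.mem 12 = s.mem 12 ∧ s'.mem 13 = s.mem 13 ∧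
          s'.reg 11 = 0 ∧ s'.reg 12 = s.mem 10 (s.mem 13 (s.reg 9)) ∧ s'.reg 13 = s.reg 13 ∧
          s'.reg 9 = s.reg 9 + 1 ∧ s'.reg 10 = s.reg 10 ∧ s'.reg 8 = s.reg 8 := by
        simp [s', searchStep, Prog.run, Test.Holds, Expr.eval, hx0, hy0]
      obtain ⟨h1, h2, h3, h4, h5, h6, h7, h8⟩ := hs'
      rw [h1, h2, h3, h4, h5, h6, h7, h8]
      exact h.pop hG hL (by omega)

end PopMatch

/-! ### Correctness and running time of the search -/

namespace PopMatch

open Finset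

variable {p : ℕ → ℝ≥0}

/-- The program changes neither the edges nor their lists. -/
def Prog.KeepsGraph (P : Prog) : Prop :=
  (∀ x ∈ [0, 3], x ∉ P.regs) ∧ ∀ A ∈ [0, 1, 7, 8], A ∉ P.arrs

instance (P : Prog) : Decidable P.KeepsGraph := inferInstanceAs (Decidable (_ ∧ _))

theorem Net.GraphOk.congr {N N' : Net} (h : N.GraphOk) (hn : N'.n = N.n) (hm : N'.m = N.m)
    (hp : N'.per = N.per) (hi : N'.it = N.it) (hh : N'.head = N.head) (hx : N'.nxt = N.nxt) :
    N'.GraphOk := by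
  refine ⟨?_, ?_, ?_, ?_⟩
  · rw [hm, hn, hp]; exact h.per_lt
  · rw [hm, hi]; exact h.it_ne
  · rw [hm, hn, hp, hh]; exact h.head
  · rw [hm, hp, hx]; exact h.nxt

theorem Frame.graphOk {P : Prog} {s s' : State} (hF : Frame P s s') (hP : P.KeepsGraph)
    (h : (netOf p s).GraphOk) : (netOf p s').GraphOk :=
  h.congr (hF.reg 0 (hP.1 0 (by simp))) (hF.reg 3 (hP.1 3 (by simp))) (hF.mem 0 (hP.2 0 (by simp)))
    (hF.mem 1 (hP.2 1 (by simp))) (hF.mem 7 (hP.2 7 (by simp))) (hF.mem 8 (hP.2 8 (by simp)))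

/-- The result of a search from `start`. -/
structure Searched (p : ℕ → ℝ≥0) (start : ℕ) (s : State) : Prop where
  graph : (netOf p s).GraphOk
  lists : (netOf p s).ListsOk
  vis : (netOf p s).Visited start (s.mem 12) (s.mem 13) (s.reg 10)
  best : (netOf p s).Best (s.mem 13) (s.reg 10) (s.reg 8)
  item : ∀ j < s.reg 10, (netOf p s).IsItem (s.mem 13 j)
  closed : Closed (netOf p s).n (netOf p s).R (netOf p s).M {x | ∃ j < s.reg 10, s.mem 13 j = x}

/-- The queue has no repetitions and holds only `0` and ends of edges. This bounds the length of
augmenting paths. -/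
theorem Searched.le {start : ℕ} {s : State} (h : Searched p start s) : s.reg 10 ≤ s.reg 3 + 1 := by
  have h1 : #(insert 0 ((range (s.reg 3)).image (s.mem 1))) ≤ s.reg 3 + 1 := by
    refine (card_insert_le _ _).trans (Nat.succ_le_succ (card_image_le.trans ?_))
    rw [card_range]
  refine le_trans ?_ h1
  rw [← card_range (s.reg 10)]
  refine card_le_card_of_injOn (s.mem 13) (fun j hj => ?_) fun i hi j hj hij => ?_
  · rcases h.item j (mem_range.1 hj) with h0 | ⟨e, he, h0⟩
    · rw [h0]; exact mem_coe.2 (mem_insert_self _ _)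
    · rw [← h0]; exact mem_coe.2 (mem_insert_of_mem (mem_image_of_mem _ (mem_range.2 he)))
  · rcases lt_trichotomy i j with h1 | h1 | h1
    · exact absurd hij (h.vis.inj i j h1 (mem_range.1 hj))
    · exact h1
    · exact absurd hij.symm (h.vis.inj j i h1 (mem_range.1 hi))

theorem searchLoop_spec {s : State} {start : ℕ} (hG : (netOf p s).GraphOk)
    (hL : (netOf p s).ListsOk)
    (h : (netOf p s).Bfs start (s.mem 12) (s.mem 13) (s.reg 11) (s.reg 12) (s.reg 13) (s.reg 9)
      (s.reg 10) (s.reg 8)) (hqt : s.reg 10 ≤ 1) :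
    WP p searchLoop (150 * (2 * s.reg 3 + s.reg 0 + 1) + 20) (Searched p start) s := by
  refine WP.loop_const (fun s' => netOf p s' = netOf p s ∧
      (netOf p s).Bfs start (s'.mem 12) (s'.mem 13) (s'.reg 11) (s'.reg 12) (s'.reg 13) (s'.reg 9)
        (s'.reg 10) (s'.reg 8))
    (fun s' => (netOf p s).pot (s'.mem 13) (s'.reg 11) (s'.reg 12) (s'.reg 13) (s'.reg 9) (s'.reg 10))
    searchStep.cost ?_ ⟨rfl, h⟩ ?_ ?_
  · rintro s' hF ⟨h1, h2⟩ hc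
    refine WP.of_run rfl le_rfl ?_
    rw [← h1] at hG hL h2
    have h3 := searchStep_spec hG hL h2 (by simpa only [Test.Holds, Expr.eval] using hc)
    rw [h1] at h3
    exact ⟨⟨h3.1, h3.2.1⟩, h3.2.2⟩
  · rintro s' hF ⟨h1, h2⟩ hc
    simp only [Test.Holds, Expr.eval, not_lt, Nat.le_zero, Nat.add_eq_zero_iff] at hc
    obtain ⟨hx, hy, hq⟩ := hc
    rw [hx, hy] at h2
    refine ⟨h1 ▸ hG, h1 ▸ hL, h1 ▸ h2.vis, h1 ▸ h2.best, h1 ▸ h2.item, ?_⟩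
    rw [h1]
    exact h2.isClosed (by omega)
  -- The initial potential is at most `2 * m + n + 1`, where `m` counts the edges including the last
  -- resorts; 150 bounds one step together with the test of the loop.
  · have h1 := Net.pot_le (N := netOf p s) (Q := s.mem 13) (x := s.reg 11) (y := s.reg 12)
      (c := s.reg 13) (qh := s.reg 9) hqt
    have h2 : searchStep.cost + Test.time
      (.lt (.const 0) (.add (.var 11) (.add (.var 12) (.sub (.var 10) (.var 9))))) + 1 ≤ 150 := by
      decide
    have h3 := Nat.mul_le_mul h1 h2
    have h4 : Test.time
      (.lt (.const 0) (.add (.var 11) (.add (.var 12) (.sub (.var 10) (.var 9))))) + 1 ≤ 20 := by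
      decide
    change _ ≤ 150 * (2 * (netOf p s).m + (netOf p s).n + 1) + 20
    rw [mul_comm 150]
    omega

theorem resetItem_run (s : State) : resetItem.run p s =
    ⟨s.reg, Function.update (Function.update (Function.update s.mem
        6 (Function.update (s.mem 6) (s.mem 1 (s.reg 5)) 0))
        10 (Function.update (s.mem 10) (s.mem 1 (s.reg 5)) 0))
        12 (Function.update (s.mem 12) (s.mem 1 (s.reg 5)) 0)⟩ := by
  simp [resetItem, Prog.run, Expr.eval]

theorem insertPerson_run (s : State) : insertPerson.run p s =
    ⟨s.reg, Function.update (Function.update (Function.update s.mem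
        11 (Function.update (s.mem 11) (s.reg 5) (s.mem 10 (s.mem 4 (s.reg 5)))))
        10 (Function.update (s.mem 10) (s.mem 4 (s.reg 5)) (s.reg 5 + 1)))
        6 (Function.update (s.mem 6) (s.mem 4 (s.reg 5)) (s.mem 6 (s.mem 4 (s.reg 5)) + 1))⟩ := by
  simp [insertPerson, Prog.run, Expr.eval]

theorem load_succ (k : ℕ) (M : ℕ → ℕ) (x : ℕ) :
    load (k + 1) M x = load k M x + if M k = x then 1 else 0 := by
  unfold load
  rw [range_add_one, filter_insert]
  split_ifs with h
  · rw [card_insert_of_notMem (by simp)]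
  · rfl

/-- The lists of people are rebuilt in every search. Only cell `0` and the cells of items that occur
in edges are reset, so the time does not depend on the number of items. -/
theorem search_spec {s : State} (hG : (netOf p s).GraphOk)
    (hM : ∀ a < s.reg 0, (netOf p s).IsItem (s.mem 4 a)) (hs : (netOf p s).IsItem (s.reg 7)) :
    WP p search (400 * (s.reg 3 + s.reg 0 + 1)) (Searched p (s.reg 7)) s := by
  have hT : 30 + ((6 + s.reg 3 * (30 + 8)) + ((6 + s.reg 0 * (50 + 8)) + (50 +
      (150 * (2 * s.reg 3 + s.reg 0 + 1) + 20)))) ≤ 400 * (s.reg 3 + s.reg 0 + 1) := by omega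
  refine WP.mono ?_ hT fun _ _ h => h
  unfold search
  have hitem : ∀ {s'}, s'.reg 3 = s.reg 3 → s'.mem 1 = s.mem 1 → ∀ x, (netOf p s').IsItem x ↔
      (netOf p s).IsItem x := by
    intro s' h1 h2 x
    simp only [Net.IsItem, netOf, h1, h2]
  refine WP.seq (Q := fun s' => s'.mem 6 0 = 0 ∧ s'.mem 10 0 = 0 ∧ s'.mem 12 0 = 0)
    (WP.of_run rfl (by decide) (by simp [resetZero, Prog.run, Expr.eval])) fun s1 hF1 h1 => ?_
  have r10 : s1.reg 0 = s.reg 0 := hF1.reg 0 (by decide)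
  have r13 : s1.reg 3 = s.reg 3 := hF1.reg 3 (by decide)
  have m11 : s1.mem 1 = s.mem 1 := hF1.mem 1 (by decide)
  refine WP.seq (Q := fun s' => ∀ x, (netOf p s).IsItem x →
    s'.mem 6 x = 0 ∧ s'.mem 10 x = 0 ∧ s'.mem 12 x = 0) ?_ fun s2 hF2 h2 => ?_
  · refine WP.forTo 30 (fun k s' => ∀ x, (x = 0 ∨ ∃ e < k, s.mem 1 e = x) →
      s'.mem 6 x = 0 ∧ s'.mem 10 x = 0 ∧ s'.mem 12 x = 0) r13 (by decide) (by decide) (by decide)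
      (fun _ _ _ h => h) ?_ ?_ ?_ le_rfl
    · rintro x (rfl | ⟨e, he, _⟩)
      · exact h1
      · exact absurd he (Nat.not_lt_zero _)
    · intro k s' hF hI hk hkm
      have e1 : s'.mem 1 = s.mem 1 := (hF.mem 1 (by decide)).trans m11
      refine WP.of_run rfl (by decide) ?_
      rw [resetItem_run, hk, e1]
      intro x hx
      by_cases hxe : x = s.mem 1 k
      · subst hxe; simp
      · have := hI x (by
          rcases hx with h | ⟨e, he, h⟩
          · exact Or.inl h
          · refine Or.inr ⟨e, ?_, h⟩
            rcases Nat.lt_succ_iff_lt_or_eq.1 he with h' | rfl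
            · exact h'
            · exact absurd h.symm hxe)
        simpa [Function.update_of_ne hxe] using this
    · intro s' hF hI _ x hx
      exact hI x hx
  have r20 : s2.reg 0 = s.reg 0 := (hF2.reg 0 (by decide)).trans r10
  have r23 : s2.reg 3 = s.reg 3 := (hF2.reg 3 (by decide)).trans r13
  have m21 : s2.mem 1 = s.mem 1 := (hF2.mem 1 (by decide)).trans m11
  have m24 : s2.mem 4 = s.mem 4 := (hF2.mem 4 (by decide)).trans (hF1.mem 4 (by decide))
  refine WP.seq (Q := fun s' => (netOf p s').ListsOk ∧ ∀ x, (netOf p s).IsItem x → s'.mem 12 x = 0)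
    ?_ fun s3 hF3 h3 => ?_
  · refine WP.forTo 50 (fun k s' => (∀ x, (netOf p s).IsItem x →
        s'.mem 6 x = load k (s.mem 4) x ∧ Prev (s.mem 4) k x (s'.mem 10 x)) ∧
        ∀ a < k, Prev (s.mem 4) a (s.mem 4 a) (s'.mem 11 a)) r20 (by decide) (by decide) (by decide)
      (fun _ _ _ h => h) ?_ ?_ ?_ le_rfl
    · refine ⟨fun x hx => ?_, fun a ha => absurd ha (Nat.not_lt_zero _)⟩
      rw [(h2 x hx).1, (h2 x hx).2.1]
      exact ⟨by simp [load], Prev.zero _ _⟩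
    · rintro k s' hF ⟨hI1, hI2⟩ hk hkn
      have e4 : s'.mem 4 = s.mem 4 := (hF.mem 4 (by decide)).trans m24
      refine WP.of_run rfl (by decide) ?_
      rw [insertPerson_run, hk, e4]
      have hMk := hI1 _ (hM k hkn)
      refine ⟨fun x hx => ?_, fun a ha => ?_⟩
      · rw [load_succ]
        by_cases hxe : x = s.mem 4 k
        · subst hxe
          simp only [Function.update_self, if_true, hMk.1]
          refine ⟨trivial, ?_⟩
          simpa using Prev.step_eq rfl
        · rw [if_neg (Ne.symm hxe)]
          have := hI1 x hx
          simp only [Function.update_self, Function.update_of_ne hxe, this.1]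
          refine ⟨rfl, ?_⟩
          simpa [Function.update_of_ne hxe] using this.2.step_ne (Ne.symm hxe)
      · by_cases hak : a = k
        · subst hak; simpa using hMk.2
        · simpa [Function.update_of_ne hak] using hI2 a (by omega)
    · rintro s' hF ⟨hI1, hI2⟩ _
      have e0 : s'.reg 0 = s.reg 0 := (hF.reg 0 (by decide)).trans r20
      have e3 : s'.reg 3 = s.reg 3 := (hF.reg 3 (by decide)).trans r23
      have e1 : s'.mem 1 = s.mem 1 := (hF.mem 1 (by decide)).trans m21
      have e4 : s'.mem 4 = s.mem 4 := (hF.mem 4 (by decide)).trans m24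
      have e12 : s'.mem 12 = s2.mem 12 := hF.mem 12 (by decide)
      refine ⟨⟨fun a ha => ?_, fun x hx => ?_, fun a ha => ?_, fun x hx => ?_⟩, fun x hx => ?_⟩
      · rw [hitem e3 e1]; simp only [netOf, e0, e4] at ha ⊢; exact hM a ha
      · rw [hitem e3 e1] at hx; simp only [netOf, e0, e4]; exact (hI1 x hx).2
      · simp only [netOf, e0, e4] at ha ⊢; exact hI2 a ha
      · rw [hitem e3 e1] at hx; simp only [netOf, e0, e4]; exact (hI1 x hx).1
      · rw [e12]; exact (h2 x hx).2.2
  have r30 : s3.reg 0 = s.reg 0 := (hF3.reg 0 (by decide)).trans r20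
  have r33 : s3.reg 3 = s.reg 3 := (hF3.reg 3 (by decide)).trans r23
  have r37 : s3.reg 7 = s.reg 7 := (hF3.reg 7 (by decide)).trans <| (hF2.reg 7 (by decide)).trans
    (hF1.reg 7 (by decide))
  have m31 : s3.mem 1 = s.mem 1 := (hF3.mem 1 (by decide)).trans m21
  have hG3 : (netOf p s3).GraphOk := hF3.graphOk (by decide) <| hF2.graphOk (by decide) <|
    hF1.graphOk (by decide) hG
  refine WP.seq (Q := fun s' => netOf p s' = netOf p s3 ∧ s'.reg 10 = 1 ∧
      (netOf p s').Bfs (s.reg 7) (s'.mem 12) (s'.mem 13) (s'.reg 11) (s'.reg 12) (s'.reg 13)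
        (s'.reg 9) (s'.reg 10) (s'.reg 8)) ?_ fun s4 hF4 h4 => ?_
  · refine WP.of_run rfl (by decide) ?_
    set s' := searchInit.run p s3 with hs'
    have h5 : netOf p s' = netOf p s3 := by simp [hs', searchInit, Prog.run, Expr.eval, netOf]
    have h6 : s'.mem 12 = Function.update (s3.mem 12) (s.reg 7) 1 ∧ s'.mem 13 0 = s.reg 7 ∧
        s'.reg 11 = 0 ∧ s'.reg 12 = 0 ∧ s'.reg 9 = 0 ∧ s'.reg 10 = 1 ∧ s'.reg 8 = 0 := by
      simp [hs', searchInit, Prog.run, Expr.eval, r37]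
    obtain ⟨k1, k2, k3, k4, k5, k6, k7⟩ := h6
    refine ⟨h5, k6, ?_⟩
    rw [h5, k3, k4, k5, k6, k7]
    refine Net.Bfs.init ((hitem r33 m31 _).2 hs) (fun b hb => ?_) k2 _
    rw [hitem r33 m31] at hb
    rw [k1]
    by_cases hbs : b = s.reg 7
    · subst hbs; simp
    · simp [hbs, h3.2 b hb]
  · obtain ⟨h5, h6, h7⟩ := h4
    have e0 : s4.reg 0 = s.reg 0 := (hF4.reg 0 (by decide)).trans r30
    have e3 : s4.reg 3 = s.reg 3 := (hF4.reg 3 (by decide)).trans r33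
    rw [← e0, ← e3]
    exact searchLoop_spec (h5 ▸ hG3) (h5 ▸ h3.1) h7 h6.le

end PopMatch

namespace PopMatch

open Finset

variable {p : ℕ → ℝ≥0}

/-! ## The augmentation program -/

/-- A loop with an invariant that carries a decreasing counter. -/
theorem WP.loop_nat {P : Prog} {T : ℕ} {Q : State → Prop} {s : State} {c : Test}
    (Inv : ℕ → State → Prop) (K N : ℕ)
    (hbody : ∀ k s', Frame P s s' → Inv k s' → c.Holds p s' →
      WP p P K (fun s'' => ∃ k' < k, Inv k' s'') s')
    (h0 : Inv N s) (hQ : ∀ k s', Frame P s s' → Inv k s' → ¬ c.Holds p s' → Q s')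
    (hT : N * (K + c.time + 1) + c.time + 1 ≤ T) : WP p (.loop c P) T Q s := by
  -- The least index for which the invariant holds turns the counter, which no register stores, into
  -- a function of the state.
  refine WP.loop_const (fun s' => ∃ k, Inv k s') (fun s' => sInf {k | Inv k s'}) K
    (fun s' hF hI hc => ?_) ⟨N, h0⟩ (fun s' hF ⟨k, hk⟩ hc => hQ k s' hF hk hc) ?_
  · refine (hbody _ s' hF (Nat.sInf_mem hI) hc).mono le_rfl fun s'' _ h => ?_
    obtain ⟨k', h1, h2⟩ := h
    exact ⟨⟨k', h2⟩, (Nat.sInf_le (s := {k | Inv k s''}) h2).trans_lt h1⟩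
  · have : sInf {k | Inv k s} ≤ N := Nat.sInf_le (s := {k | Inv k s}) h0
    have := Nat.mul_le_mul_right (K + c.time + 1) this
    omega

/-- One step of the augmentation: the parent of the item `16` moves there. -/
def augmentStep : Prog :=
  .seq (.assign 17 (.sub (.get 12 (.var 16)) (.const 1)))
    (.seq (.assign 20 (.get 4 (.var 17)))
      (.seq (.store 4 (.var 17) (.var 16)) (.assign 16 (.var 20))))

/-- Move people along the path of parents from the item `8` back to the item `0`. -/
def augment : Prog :=
  .seq (.assign 16 (.var 8)) (.loop (.not (.eq (.var 16) (.const 0))) augmentStep)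

/-- The state of the augmentation when the item `Q k = x` has received one person too many. -/
structure Augmenting (N : Net) (Q : ℕ → ℕ) (qt y : ℕ) (k x : ℕ) (K : ℕ → ℕ) : Prop where
  lt : k < qt
  cur : Q k = x
  load_eq : ∀ v, load N.n K v + (if v = x then 1 else 0) = load N.n N.M v + if v = y then 1 else 0
  index : ∀ a < N.n, K a ≠ N.M a → ∃ i < qt, k ≤ i ∧ N.M a = Q i
  edge : ∀ a < N.n, K a ≠ N.M a → N.R a (K a)
  leads : ∀ Z, Closed N.n N.R N.M Z → x ∈ Z → y ∈ Z
  avoid : ∀ Z, Closed N.n N.R N.M Z → y ∉ Z → ∀ a < N.n, K a ≠ N.M a → N.M a ∉ Z ∧ K a ∉ Z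
  used : ∀ a < N.n, K a ≠ N.M a → K a = y ∨ ∃ c < N.n, N.M c = K a
  usedx : x = y ∨ ∃ c < N.n, N.M c = x

/-- Moving the parent of `x` to `x` carries the vacancy one step back towards `0`. The index in the
queue decreases, so the walk terminates and meets no person twice. -/
theorem Augmenting.step {N : Net} {par Q : ℕ → ℕ} {qt y k x : ℕ} {K : ℕ → ℕ}
    (hV : N.Visited 0 par Q qt) (h : Augmenting N Q qt y k x K) (hx : x ≠ 0) :
    ∃ a i, par x = a + 1 ∧ i < k ∧ Augmenting N Q qt y i (K a) (Function.update K a x) := by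
  have hk0 : 0 < k := by
    rcases Nat.eq_zero_or_pos k with rfl | hk
    · exact absurd (h.cur.symm.trans hV.zero) hx
    · exact hk
  obtain ⟨a, i, h1, ha, hik, hMa, hR⟩ := hV.parent k h.lt hk0
  rw [h.cur] at h1 hR
  -- Everybody moved so far came from a position at least `k` of the queue, whereas the parent sits
  -- at position `i < k`.
  have hKa : K a = N.M a := by
    by_contra hne
    obtain ⟨j, hj, hkj, hMj⟩ := h.index a ha hne
    exact hV.inj i j (by omega) hj (hMa.symm.trans hMj)
  have hne : ∀ b, b ≠ a → Function.update K a x b = K b := fun b hb =>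
    Function.update_of_ne hb _ _
  have hself : Function.update K a x a = x := Function.update_self ..
  refine ⟨a, i, h1, hik, hik.trans h.lt, hMa.symm.trans hKa.symm, fun v => ?_, fun b hb hbne => ?_,
    fun b hb hbne => ?_, fun Z hZ hKZ => ?_, fun Z hZ hyZ b hb hbne => ?_, fun b hb hbne => ?_,
    Or.inr ⟨a, ha, hKa.symm⟩⟩
  · have e1 := load_update K ha x v
    have e2 := h.load_eq v
    omega
  · by_cases hba : b = a
    · subst hba; exact ⟨i, hik.trans h.lt, le_rfl, hMa⟩
    · rw [hne b hba] at hbne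
      obtain ⟨j, hj, hkj, hMj⟩ := h.index b hb hbne
      exact ⟨j, hj, by omega, hMj⟩
  · by_cases hba : b = a
    · subst hba; rwa [hself]
    · rw [hne b hba] at hbne ⊢; exact h.edge b hb hbne
  · exact h.leads Z hZ (hZ a ha (hKa ▸ hKZ) x hR)
  · by_cases hba : b = a
    · subst hba
      have hxZ : x ∉ Z := fun h' => hyZ (h.leads Z hZ h')
      rw [hself]
      exact ⟨fun h' => hxZ (hZ b ha h' x hR), hxZ⟩
    · rw [hne b hba] at hbne ⊢; exact h.avoid Z hZ hyZ b hb hbne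
  · by_cases hba : b = a
    · subst hba; rw [hself]; exact h.usedx
    · rw [hne b hba] at hbne ⊢; exact h.used b hb hbne

theorem augment_spec {s : State} (h : Searched p 0 s) (hb : s.reg 8 ≠ 0) :
    WP p augment (30 * (s.reg 3 + 2)) (fun s' =>
      Augments (s.reg 0) (netOf p s).R (s.mem 4) (s'.mem 4) (s.reg 8) ∧
      ∀ a < s.reg 0, s'.mem 4 a ≠ s.mem 4 a → ∃ i < s.reg 10, s.mem 13 i = s.mem 4 a) s := by
  have hle := h.le
  obtain ⟨⟨j, hj, _, hjb⟩, _, _⟩ := h.best.2 hb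
  refine WP.mono (T := 3 + (j * (20 + 4 + 1) + 4 + 1)) ?_ (by omega) fun _ _ h => h
  refine WP.seq (Q := fun s' => s'.reg 16 = s.reg 8)
    (WP.of_run rfl (by decide) (by simp [Prog.run, Expr.eval])) fun s1 hF1 h1 => ?_
  refine WP.loop_nat (fun k s' => Augmenting (netOf p s) (s.mem 13) (s.reg 10) (s.reg 8) k
    (s'.reg 16) (s'.mem 4)) 20 j (fun k s' hF hI hc => ?_) ?_ (fun k s' hF hI hc => ?_) le_rfl
  · have hx : s'.reg 16 ≠ 0 := by simpa only [Test.Holds, Expr.eval] using hc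
    obtain ⟨a, i, h2, h3, h4⟩ := hI.step h.vis hx
    refine WP.of_run rfl (by decide) ⟨i, h3, ?_⟩
    have e12 : s'.mem 12 = s.mem 12 := (hF.mem 12 (by decide)).trans (hF1.mem 12 (by decide))
    simpa [augmentStep, Prog.run, Expr.eval, e12, h2] using h4
  · have e4 : s1.mem 4 = s.mem 4 := hF1.mem 4 (by decide)
    rw [h1, e4]
    exact ⟨hj, hjb, fun v => rfl, fun a _ h => absurd rfl h, fun a _ h => absurd rfl h,
      fun _ _ h => h, fun _ _ _ a _ h => absurd rfl h, fun a _ h => absurd rfl h, Or.inl rfl⟩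
  · have hx : s'.reg 16 = 0 := by simpa only [Test.Holds, Expr.eval, not_not] using hc
    have hl := hI.load_eq
    rw [hx] at hl
    refine ⟨⟨fun v hv => ?_, ?_, hI.edge, hI.avoid, hI.used⟩, fun a ha hne => ?_⟩
    · have := hl v
      rw [if_neg hv] at this
      exact this
    · have := hl 0
      rw [if_pos rfl, if_neg (Ne.symm hb)] at this
      exact this
    · obtain ⟨i, hi, _, hMi⟩ := hI.index a ha hne
      exact ⟨i, hi, hMi.symm⟩

/-! ## Optimal maximum matchings -/

/-- Augment as long as possible. -/
def maximize : Prog :=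
  .seq (.assign 18 (.const 1)) (.loop (.eq (.var 18) (.const 1))
    (.seq (.assign 7 (.const 0)) (.seq search
      (.branch (.eq (.var 8) (.const 0)) (.assign 18 (.const 0)) augment))))

/-- The graph of the marked edges with marks, ends and number in the memory. -/
def graphOf (s : State) (a b : ℕ) : Prop :=
  ∃ e < s.reg 3, s.mem 0 e = a ∧ s.mem 1 e = b ∧ s.mem 9 e = 1

/-- The weights of the items given by the classes in the memory and the prices. -/
noncomputable def weightOf (p : ℕ → ℝ≥0) (s : State) : ℕ → ℕ ×ₗ ℝ≥0 :=
  weight (s.mem 16) fun x => p (x - 1)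

/-- The memory holds a partial matching of the marked edges, optimal for its size. -/
structure Optimal (p : ℕ → ℝ≥0) (s : State) : Prop where
  graph : (netOf p s).GraphOk
  isPartial : IsPartial (s.reg 0) (graphOf s) (s.mem 5) (s.mem 4)
  isOpt : IsOpt (s.reg 0) (graphOf s) (s.mem 5) (weightOf p s) (s.mem 4)

theorem IsPartial.isItem {s : State}
    (h : IsPartial (s.reg 0) (graphOf s) (s.mem 5) (s.mem 4)) (a : ℕ) (ha : a < s.reg 0) :
    (netOf p s).IsItem (s.mem 4 a) := by
  by_cases h0 : s.mem 4 a = 0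
  · exact Or.inl h0
  · obtain ⟨e, he, _, hb, _⟩ := h.1 a ha h0
    exact Or.inr ⟨e, he, hb⟩

/-- The data of the optimization that a frame preserves. -/
theorem Frame.optData {P : Prog} {s s' : State} (hF : Frame P s s') (hP : P.KeepsGraph)
    (h5 : 5 ∉ P.arrs) (h9 : 9 ∉ P.arrs) (h16 : 16 ∉ P.arrs) :
    s'.reg 0 = s.reg 0 ∧ graphOf s' = graphOf s ∧ s'.mem 5 = s.mem 5 ∧
      weightOf p s' = weightOf p s := by
  refine ⟨hF.reg 0 (hP.1 0 (by simp)), ?_, hF.mem 5 h5, ?_⟩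
  · unfold graphOf
    rw [hF.reg 3 (hP.1 3 (by simp)), hF.mem 0 (hP.2 0 (by simp)), hF.mem 1 (hP.2 1 (by simp)),
      hF.mem 9 h9]
  · unfold weightOf
    rw [hF.mem 16 h16]

theorem Frame.optimal {P : Prog} {s s' : State} (hF : Frame P s s') (hP : P.KeepsGraph)
    (h4 : 4 ∉ P.arrs) (h5 : 5 ∉ P.arrs) (h9 : 9 ∉ P.arrs) (h16 : 16 ∉ P.arrs)
    (h : Optimal p s) : Optimal p s' := by
  obtain ⟨e0, eg, e5, ew⟩ := hF.optData (p := p) hP h5 h9 h16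
  refine ⟨hF.graphOk hP h.graph, ?_, ?_⟩
  · rw [e0, eg, e5, hF.mem 4 h4]; exact h.isPartial
  · rw [e0, eg, e5, ew, hF.mem 4 h4]; exact h.isOpt

/-- The loads in the memory are correct, and no free item can be reached from `0`. -/
def Maximal (s : State) : Prop :=
  (∀ e < s.reg 3, s.mem 6 (s.mem 1 e) = load (s.reg 0) (s.mem 4) (s.mem 1 e)) ∧
  ∃ Z, Closed (s.reg 0) (graphOf s) (s.mem 4) Z ∧ Full (s.reg 0) (s.mem 5) (s.mem 4) Z ∧ 0 ∈ Z

/-- A round either matches one more person or finds no free item and clears the flag. So the number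
of unmatched people plus the flag is a measure. -/
theorem maximize_spec {s : State} {T : ℕ} (h : Optimal p s)
    (hT : 1000 * (s.reg 3 + s.reg 0 + 1) * (load (s.reg 0) (s.mem 4) 0 + 1) + 20 ≤ T) :
    WP p maximize T (fun s' => Optimal p s' ∧ Maximal s') s := by
  obtain ⟨L, hL⟩ : ∃ L, L = s.reg 3 + s.reg 0 + 1 := ⟨_, rfl⟩
  rw [← hL] at hT
  refine WP.mono (T := 2 + ((load (s.reg 0) (s.mem 4) 0 + 1) *
    (2 + (400 * L + (4 + (60 * L))) + 3 + 1) + 3 + 1)) ?_ ?_ fun _ _ h => h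
  rotate_left
  · refine le_trans ?_ hT
    have : 2 + (400 * L + (4 + (60 * L))) + 3 + 1 ≤ 1000 * L := by omega
    have := Nat.mul_le_mul_left (load (s.reg 0) (s.mem 4) 0 + 1) this
    rw [mul_comm (1000 * L)]
    omega
  refine WP.seq (Q := fun s' => s'.reg 18 = 1)
    (WP.of_run rfl (by decide) (by simp [Prog.run, Expr.eval])) fun s1 hF1 h1 => ?_
  have hO1 : Optimal p s1 := hF1.optimal (by decide) (by decide) (by decide) (by decide)
    (by decide) h
  have r10 : s1.reg 0 = s.reg 0 := hF1.reg 0 (by decide)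
  have r13 : s1.reg 3 = s.reg 3 := hF1.reg 3 (by decide)
  have m14 : s1.mem 4 = s.mem 4 := hF1.mem 4 (by decide)
  rw [← r10, ← m14]
  refine WP.loop_const (fun s' => Optimal p s' ∧ s'.reg 18 ≤ 1 ∧ (s'.reg 18 = 0 → Maximal s'))
    (fun s' => load (s'.reg 0) (s'.mem 4) 0 + s'.reg 18) (2 + (400 * L + (4 + (60 * L))))
    (fun s' hF hI hc => ?_) ⟨hO1, h1.le, fun h => by omega⟩
    (fun s' hF ⟨h2, h3, h4⟩ hc => ⟨h2, h4 ?_⟩) ?_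
  rotate_left
  · simp only [Test.Holds, Expr.eval] at hc; omega
  · rw [h1]; exact le_rfl
  obtain ⟨hO, _, _⟩ := hI
  have h18 : s'.reg 18 = 1 := by simpa only [Test.Holds, Expr.eval] using hc
  have r0 : s'.reg 0 = s.reg 0 := (hF.reg 0 (by decide)).trans r10
  have r3 : s'.reg 3 = s.reg 3 := (hF.reg 3 (by decide)).trans r13
  rw [← r0, ← r3] at hL
  refine WP.seq (Q := fun s' => s'.reg 7 = 0)
    (WP.of_run rfl (by decide) (by simp [Prog.run, Expr.eval])) fun s2 hF2 h2 => ?_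
  have hO2 : Optimal p s2 := hF2.optimal (by decide) (by decide) (by decide) (by decide)
    (by decide) hO
  have r20 : s2.reg 0 = s'.reg 0 := hF2.reg 0 (by decide)
  have r23 : s2.reg 3 = s'.reg 3 := hF2.reg 3 (by decide)
  refine WP.seq (Q := Searched p 0)
    ((search_spec hO2.graph hO2.isPartial.isItem (Or.inl h2)).mono
      (Nat.mul_le_mul_left _ (by rw [r20, r23]; exact hL.ge)) (fun _ _ h => h2 ▸ h)) fun s3 hF3 h3 => ?_
  have hO3 : Optimal p s3 := hF3.optimal (by decide) (by decide) (by decide) (by decide)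
    (by decide) hO2
  have r30 : s3.reg 0 = s'.reg 0 := (hF3.reg 0 (by decide)).trans r20
  have r33 : s3.reg 3 = s'.reg 3 := (hF3.reg 3 (by decide)).trans r23
  have r318 : s3.reg 18 = 1 :=
    (hF3.reg 18 (by decide)).trans ((hF2.reg 18 (by decide)).trans h18)
  have m34 : s3.mem 4 = s'.mem 4 := (hF3.mem 4 (by decide)).trans (hF2.mem 4 (by decide))
  have hused : ∀ x, (netOf p s3).IsItem x → s3.mem 6 x = load (s3.reg 0) (s3.mem 4) x :=
    h3.lists.used
  refine WP.branch (fun hb => ?_) (fun hb => ?_)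
  · have hb : s3.reg 8 = 0 := by simpa only [Test.Holds, Expr.eval] using hb
    -- The visited set itself is the certificate: it is closed, contains `0`, and has no free item
    -- since the search found none.
    have hmax : Maximal s3 := by
      refine ⟨fun e he => hused _ (Or.inr ⟨e, he, rfl⟩), _, h3.closed, ?_, 0, h3.vis.pos, h3.vis.zero⟩
      rintro b ⟨j, hj, rfl⟩ hb0
      have hj0 : 0 < j := by
        rcases Nat.eq_zero_or_pos j with rfl | h
        · exact absurd h3.vis.zero hb0
        · exact h
      rw [← hused _ (h3.item j hj)]
      exact h3.best.1 hb j hj hj0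
    refine WP.of_run rfl (by simp only [Prog.cost, Expr.time]; omega) ?_
    refine ⟨⟨Frame.optimal (P := .assign 18 (.const 0)) ?_ (by decide) (by decide) (by decide)
      (by decide) (by decide) hO3, by simp [Prog.run, Expr.eval], fun _ => hmax⟩, ?_⟩
    · obtain ⟨t, _, he⟩ := Prog.exec_run p (P := .assign 18 (.const 0)) rfl s3
      exact he.frame
    · rw [h18, ← r30, ← m34]
      simp [Prog.run, Expr.eval]
  · have hb : s3.reg 8 ≠ 0 := by simpa only [Test.Holds, Expr.eval] using hb
    refine (augment_spec h3 hb).mono (by rw [r33]; omega) fun s4 hF4 h4 => ?_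
    obtain ⟨hA, hin⟩ := h4
    obtain ⟨e0, eg, e5, ew⟩ := hF4.optData (p := p) (by decide) (by decide) (by decide) (by decide)
    obtain ⟨⟨j, hj, hj0, hjb⟩, hfree, hmin⟩ := h3.best.2 hb
    have hfree : load (s3.reg 0) (s3.mem 4) (s3.reg 8) < s3.mem 5 (s3.reg 8) := by
      rw [← hused _ (hjb ▸ h3.item j hj)]; exact hfree
    have e18 : s4.reg 18 = 1 := (hF4.reg 18 (by decide)).trans r318
    refine ⟨⟨⟨hF4.graphOk (by decide) hO3.graph, ?_, ?_⟩, e18.le, fun h => by omega⟩, ?_⟩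
    · rw [e0, eg, e5]
      exact hA.isPartial hO3.isPartial hfree
    · rw [e0, eg, e5, ew]
      -- The set `V` of the certificate step is the set of visited items, among which the search has
      -- chosen the lightest free one.
      refine hA.isOpt hO3.isOpt hfree hb h3.closed ⟨j, hj, hjb⟩ hin ?_
      rintro x ⟨i, hi, rfl⟩ hx0 hx
      have hi0 : 0 < i := by
        rcases Nat.eq_zero_or_pos i with rfl | h
        · exact absurd h3.vis.zero hx0
        · exact h
      exact hmin i hi hi0 ((hused _ (h3.item i hi)).trans_lt hx)
    · have := hA.load_zero
      rw [e18, h18, e0, ← r30, ← m34]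
      omega

end PopMatch

namespace PopMatch

open Finset

/-! ## The market of an instance -/

/-- The arrays list the edges of the instance, with the items numbered from `1` on, and then an edge
from every person `a` to a last resort of her own, with the number `n₂ + a + 1`, whose rank exceeds
all other ranks. -/
structure Represents (I : Inst) (per it rk cap : ℕ → ℕ) : Prop where
  per_inst : ∀ e : Fin I.m, per e = I.person e
  it_inst : ∀ e : Fin I.m, it e = I.item e + 1
  rk_inst : ∀ e : Fin I.m, rk e = I.rank e
  per_last : ∀ a < I.n₁, per (I.m + a) = a
  it_last : ∀ a < I.n₁, it (I.m + a) = I.n₂ + a + 1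
  rk_last : ∀ a < I.n₁, ∀ e : Fin I.m, I.rank e < rk (I.m + a)
  cap_inst : ∀ e : Fin I.m, cap (I.item e + 1) = I.copies (I.item e)
  cap_last : ∀ a < I.n₁, cap (I.n₂ + a + 1) = 1
  cap_zero : ∀ x, (∀ e < I.m + I.n₁, it e ≠ x) → cap x = 0

namespace Represents

variable {I : Inst} {per it rk cap : ℕ → ℕ} (h : Represents I per it rk cap)
include h

omit h in
theorem edge_cases {e : ℕ} (he : e < I.m + I.n₁) :
    (∃ e' : Fin I.m, e = e') ∨ ∃ a < I.n₁, e = I.m + a := by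
  by_cases hm : e < I.m
  · exact Or.inl ⟨⟨e, hm⟩, rfl⟩
  · exact Or.inr ⟨e - I.m, by omega, by omega⟩

theorem per_lt {e : ℕ} (he : e < I.m + I.n₁) : per e < I.n₁ := by
  rcases edge_cases he with ⟨e, rfl⟩ | ⟨a, ha, rfl⟩
  · rw [h.per_inst]; exact (I.person e).2
  · rwa [h.per_last a ha]

theorem it_ne {e : ℕ} (he : e < I.m + I.n₁) : it e ≠ 0 := by
  rcases edge_cases he with ⟨e, rfl⟩ | ⟨a, ha, rfl⟩
  · rw [h.it_inst]; omega
  · rw [h.it_last a ha]; omega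

theorem edge_unique {e e' : ℕ} (he : e < I.m + I.n₁) (he' : e' < I.m + I.n₁) (hp : per e = per e')
    (hi : it e = it e') : e = e' := by
  rcases edge_cases he with ⟨e, rfl⟩ | ⟨a, ha, rfl⟩ <;>
    rcases edge_cases he' with ⟨e', rfl⟩ | ⟨a', ha', rfl⟩
  · rw [h.per_inst, h.per_inst] at hp
    rw [h.it_inst, h.it_inst] at hi
    exact congrArg _ (I.simple e e' (Fin.ext hp) (Fin.ext (by omega)))
  · rw [h.it_inst, h.it_last _ ha'] at hi
    have := (I.item e).2
    omega
  · rw [h.it_inst, h.it_last _ ha] at hi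
    have := (I.item e').2
    omega
  · rw [h.per_last _ ha, h.per_last _ ha'] at hp
    rw [hp]

/-- The market of the instance. -/
def market : Market where
  n := I.n₁
  -- Items without copies are not acceptable; otherwise they could count as top choices although
  -- nobody can get them.
  adj a b := ∃ e < I.m + I.n₁, per e = a ∧ it e = b ∧ 0 < cap b
  -- The graph is simple, so the sum has at most one term; it merely reads the rank off the edge.
  rk a b := ∑ e ∈ range (I.m + I.n₁) with per e = a ∧ it e = b, rk e
  cap := cap
  last a := I.n₂ + a + 1
  pos := by rintro a b ⟨e, he, _, rfl, _⟩; exact h.it_ne he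
  cap_pos := by rintro a b ⟨_, _, _, _, hc⟩; exact hc
  adj_last := by
    intro a ha
    exact ⟨I.m + a, by omega, h.per_last a ha, h.it_last a ha, by rw [h.cap_last a ha]; exact one_pos⟩
  last_adj := by
    rintro a b ha hb ⟨e, he, rfl, hi, _⟩
    rcases edge_cases he with ⟨e, rfl⟩ | ⟨a', ha', rfl⟩
    · rw [h.it_inst] at hi
      have := (I.item e).2
      omega
    · rw [h.it_last _ ha'] at hi
      rw [h.per_last _ ha']
      omega

theorem rk_eq {e : ℕ} (he : e < I.m + I.n₁) : h.market.rk (per e) (it e) = rk e := by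
  have : {e' ∈ range (I.m + I.n₁) | per e' = per e ∧ it e' = it e} = {e} := by
    ext e'
    simp only [mem_filter, mem_range, mem_singleton]
    constructor
    · rintro ⟨h1, h2, h3⟩; exact h.edge_unique h1 he h2 h3
    · rintro rfl; exact ⟨he, rfl, rfl⟩
  simp only [market, this, sum_singleton]

theorem rk_edge {e : Fin I.m} {a b : ℕ} (ha : (I.person e : ℕ) = a) (hb : (I.item e : ℕ) = b) :
    h.market.rk a (b + 1) = I.rank e := by
  have he : (e : ℕ) < I.m + I.n₁ := by have := e.2; omega
  have := h.rk_eq he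
  rwa [h.per_inst, h.it_inst, h.rk_inst, ha, hb] at this

theorem rk_last_lt {a : ℕ} (ha : a < I.n₁) (e : Fin I.m) :
    I.rank e < h.market.rk a (I.n₂ + a + 1) := by
  have := h.rk_eq (e := I.m + a) (by omega)
  rw [h.per_last a ha, h.it_last a ha] at this
  rw [this]
  exact h.rk_last a ha e

end Represents

/-! ### Translation between matchings of the instance and complete assignments -/

/-- The complete assignment of an assignment: unmatched people get their last resorts. -/
def complete {I : Inst} (M : I.Assignment) (a : ℕ) : ℕ :=
  if h : a < I.n₁ then (M ⟨a, h⟩).elim (I.n₂ + a + 1) fun b => (b : ℕ) + 1 else 0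

/-- The assignment without the last resorts. -/
def truncate (I : Inst) (K : ℕ → ℕ) : I.Assignment := fun a =>
  if h : K a ≠ 0 ∧ K a - 1 < I.n₂ then some ⟨K a - 1, h.2⟩ else none

theorem complete_some {I : Inst} {M : I.Assignment} {a : Fin I.n₁} {b : Fin I.n₂} (h : M a = some b) :
    complete M a = b + 1 := by
  simp [complete, h]

theorem complete_none {I : Inst} {M : I.Assignment} {a : Fin I.n₁} (h : M a = none) :
    complete M a = I.n₂ + a + 1 := by
  simp [complete, h]

theorem load_complete {I : Inst} (M : I.Assignment) (b : Fin I.n₂) :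
    load I.n₁ (complete M) (b + 1) = Inst.used M b := by
  unfold load Inst.used
  refine (card_bij (fun (a : Fin I.n₁) _ => (a : ℕ)) (fun a ha => ?_) (fun _ _ _ _ => Fin.ext)
    fun a ha => ?_).symm
  · exact mem_filter.2 ⟨mem_range.2 a.2, complete_some (mem_filter.1 ha).2⟩
  · obtain ⟨h1, h2⟩ := mem_filter.1 ha
    refine ⟨⟨a, mem_range.1 h1⟩, mem_filter.2 ⟨mem_univ _, ?_⟩, rfl⟩
    rcases hM : M ⟨a, mem_range.1 h1⟩ with _ | b'
    · have := complete_none hM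
      have hb := b.2
      simp only at this
      omega
    · have := complete_some hM
      simp only at this
      exact congrArg some (Fin.ext (by omega))

namespace Represents

variable {I : Inst} {per it rk cap : ℕ → ℕ} (h : Represents I per it rk cap)
include h

theorem complete_truncate {K : ℕ → ℕ} (hK : ∀ a < I.n₁, h.market.adj a (K a)) {a : ℕ}
    (ha : a < I.n₁) : complete (truncate I K) a = K a := by
  obtain ⟨e, he, hp, hi, _⟩ := hK a ha
  rcases edge_cases he with ⟨e, rfl⟩ | ⟨a', ha', rfl⟩
  · rw [h.it_inst] at hi
    have hb := (I.item e).2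
    have hM : truncate I K ⟨a, ha⟩ = some ⟨K a - 1, by omega⟩ := dif_pos (⟨by omega, by omega⟩ : K a ≠ 0 ∧ K a - 1 < I.n₂)
    rw [complete_some (a := ⟨a, ha⟩) hM]
    simp only
    omega
  · rw [h.it_last _ ha'] at hi
    rw [h.per_last _ ha'] at hp
    have hM : truncate I K ⟨a, ha⟩ = none := dif_neg (by simp only; omega)
    rw [complete_none (a := ⟨a, ha⟩) hM]
    simp only
    omega

theorem complete_iff {M : I.Assignment} :
    h.market.Complete (complete M) ↔ Inst.IsMatching M := by
  constructor
  · rintro ⟨h1, h2⟩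
    constructor
    · intro a b hab
      obtain ⟨e, he, hp, hi, _⟩ := h1 a a.2
      rw [complete_some hab] at hi
      rcases edge_cases he with ⟨e, rfl⟩ | ⟨a', ha', rfl⟩
      · rw [h.it_inst] at hi
        rw [h.per_inst] at hp
        exact ⟨_, e, Fin.ext hp, Fin.ext (by omega), rfl⟩
      · rw [h.it_last _ ha'] at hi
        have := b.2
        omega
    · intro b
      rw [← load_complete]
      refine (Nat.eq_zero_or_pos _).elim (fun h0 => h0.trans_le (Nat.zero_le _)) fun hpos => ?_
      obtain ⟨a, ha, hab⟩ := load_pos.1 hpos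
      obtain ⟨e, he, hp, hi, _⟩ := h1 a ha
      rw [hab] at hi
      rcases edge_cases he with ⟨e, rfl⟩ | ⟨a', ha', rfl⟩
      · rw [h.it_inst] at hi
        have hb : I.item e = b := Fin.ext (by omega)
        rw [← hb, ← h.cap_inst]
        exact h2 _
      · rw [h.it_last _ ha'] at hi
        have := b.2
        omega
  · rintro ⟨h1, h2⟩
    have hcap : ∀ (a : Fin I.n₁) b, M a = some b → 0 < I.copies b := fun a b hab =>
      lt_of_lt_of_le (card_pos.2 ⟨a, mem_filter.2 ⟨mem_univ _, hab⟩⟩) (h2 b)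
    constructor
    · intro a ha
      rcases hM : M ⟨a, ha⟩ with _ | b
      · have := complete_none hM
        simp only at this
        rw [this]
        exact h.market.adj_last ha
      · obtain ⟨r, e, h3, h4, _⟩ := h1 _ _ hM
        have := complete_some hM
        simp only at this
        rw [this]
        refine ⟨e, by have := e.2; omega, by rw [h.per_inst, h3], by rw [h.it_inst, h4], ?_⟩
        have := h.cap_inst e
        rw [h4] at this
        rw [this]
        exact hcap _ _ hM
    · intro x
      refine (Nat.eq_zero_or_pos _).elim (fun h0 => h0.trans_le (Nat.zero_le _)) fun hpos => ?_
      obtain ⟨a, ha, hax⟩ := load_pos.1 hpos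
      rcases hM : M ⟨a, ha⟩ with _ | b
      · have h3 := complete_none hM
        simp only at h3
        have h4 : load I.n₁ (complete M) x ≤ 1 := by
          refine card_le_one.2 fun c hc d hd => ?_
          have key : ∀ c ∈ (range I.n₁).filter (fun c => complete M c = x), c = a := by
            intro c hc
            obtain ⟨h5, h6⟩ := mem_filter.1 hc
            rcases hMc : M ⟨c, mem_range.1 h5⟩ with _ | b
            · have := complete_none hMc
              simp only at this
              omega
            · have := complete_some hMc
              have hb := b.2
              simp only at this
              omega
          rw [key c hc, key d hd]
        have h5 : h.market.cap x = 1 := by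
          rw [← hax, h3]
          exact h.cap_last a ha
        rw [h5]
        exact h4
      · have h3 := complete_some hM
        simp only at h3
        obtain ⟨r, e, _, h4, _⟩ := h1 _ _ hM
        have h5 := h.cap_inst e
        rw [h4] at h5
        have h6 := h2 b
        rw [← load_complete] at h6
        rw [← hax, h3]
        exact h6.trans h5.ge

/-- Being unmatched becomes holding the last resort, whose rank exceeds that of every given edge.
Both clauses of preference thereby turn into one comparison of ranks. -/
theorem prefers_iff {M M' : I.Assignment} (hM : Inst.IsMatching M) (hM' : Inst.IsMatching M')
    (a : Fin I.n₁) : Inst.Prefers a M M' ↔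
      h.market.rk a (complete M a) < h.market.rk a (complete M' a) := by
  have hrk : ∀ {b r}, I.EdgeOfRank a b r → h.market.rk a (b + 1) = r := by
    rintro b r ⟨e, h1, h2, rfl⟩
    exact h.rk_edge (by rw [h1]) (by rw [h2])
  have hlast : ∀ {b r}, I.EdgeOfRank a b r → r < h.market.rk a (I.n₂ + a + 1) := by
    rintro b r ⟨e, h1, h2, rfl⟩
    exact h.rk_last_lt a.2 e
  unfold Inst.Prefers
  rcases h1 : M a with _ | b <;> rcases h2 : M' a with _ | b'
  · simp [complete_none h1, complete_none h2]
  · obtain ⟨r', hr'⟩ := hM'.1 a b' h2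
    have := hlast hr'
    simp [complete_none h1, complete_some h2, hrk hr']
    omega
  · obtain ⟨r, hr⟩ := hM.1 a b h1
    have := hlast hr
    simp [complete_some h1, complete_none h2, hrk hr, this]
  · obtain ⟨r, hr⟩ := hM.1 a b h1
    obtain ⟨r', hr'⟩ := hM'.1 a b' h2
    rw [complete_some h1, complete_some h2, hrk hr, hrk hr']
    constructor
    · rintro (⟨_, h3⟩ | ⟨c, c', q, q', h3, h4, h5, h6, h7⟩)
      · exact absurd h3 (by simp)
      · obtain rfl := Option.some.inj h3
        obtain rfl := Option.some.inj h4
        rw [← hrk hr, ← hrk hr', hrk h5, hrk h6]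
        exact h7
    · intro h3
      exact Or.inr ⟨b, b', r, r', rfl, rfl, hr, hr', h3⟩

theorem votes_eq {M M' : I.Assignment} (hM : Inst.IsMatching M) (hM' : Inst.IsMatching M') :
    Inst.votes M M' = h.market.wins (complete M) (complete M') := by
  classical
  unfold Inst.votes Market.wins
  refine card_bij (fun a _ => (a : ℕ)) (fun a ha => ?_) (fun _ _ _ _ => Fin.ext)
    fun a ha => ?_
  · exact mem_filter.2 ⟨mem_range.2 a.2, (h.prefers_iff hM hM' a).1 (mem_filter.1 ha).2⟩
  · obtain ⟨h1, h2⟩ := mem_filter.1 ha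
    exact ⟨⟨a, mem_range.1 h1⟩, mem_filter.2 ⟨mem_univ _,
      (h.prefers_iff hM hM' ⟨a, mem_range.1 h1⟩).2 h2⟩, rfl⟩

theorem isMatching_truncate {K : ℕ → ℕ} (hK : h.market.Complete K) :
    Inst.IsMatching (truncate I K) := by
  rw [← h.complete_iff]
  have hc : ∀ a < I.n₁, complete (truncate I K) a = K a := fun a ha => h.complete_truncate hK.1 ha
  exact ⟨fun a ha => by rw [hc a ha]; exact hK.1 a ha, fun b => by
    have := load_congr hc b
    exact this.trans_le (hK.2 b)⟩

/-- On the people, every complete assignment is the completion of its truncation, so the two notions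
quantify over the same competitors. -/
theorem popular_iff {M : I.Assignment} :
    h.market.Popular (complete M) ↔ Inst.IsPopular M := by
  constructor
  · rintro ⟨h1, h2⟩
    have hM := h.complete_iff.1 h1
    refine ⟨hM, fun M' hM' hmore => ?_⟩
    have := h2 _ (h.complete_iff.2 hM')
    rw [Inst.MorePopular, h.votes_eq hM' hM, h.votes_eq hM hM'] at hmore
    omega
  · rintro ⟨hM, h2⟩
    refine ⟨h.complete_iff.2 hM, fun K hK => ?_⟩
    have hM' := h.isMatching_truncate hK
    have h3 := h2 _ hM'
    rw [Inst.MorePopular, h.votes_eq hM' hM, h.votes_eq hM hM', not_lt] at h3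
    have hw : ∀ L : ℕ → ℕ, (h.market.wins K L = h.market.wins (complete (truncate I K)) L) ∧
        h.market.wins L K = h.market.wins L (complete (truncate I K)) := by
      intro L
      constructor <;>
      · unfold Market.wins
        congr 1
        apply filter_congr
        intro a ha
        rw [h.complete_truncate hK.1 (mem_range.1 ha)]
    rwa [(hw _).1, (hw _).2]

omit h in
theorem totalCost_eq (M : I.Assignment) :
    Inst.totalCost M = ∑ a ∈ range I.n₁, I.costArray (complete M a - 1) := by
  unfold Inst.totalCost Inst.used
  rw [sum_range]
  have h1 : ∀ a : Fin I.n₁, I.costArray (complete M a - 1) =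
      ∑ b : Fin I.n₂, if M a = some b then I.cost b else 0 := by
    intro a
    rcases hM : M a with _ | b
    -- The index of a last resort lies beyond the table of prices, where the padded array is `0`. So
    -- staying unmatched is free.
    · rw [complete_none hM]
      simp [Inst.costArray, pad]
    · rw [complete_some hM]
      simp [Inst.costArray, pad]
  simp only [h1]
  rw [sum_comm]
  refine sum_congr rfl fun b _ => ?_
  rw [← sum_filter, sum_const]

/-- A good complete assignment that is cheapest among the good ones yields a cheapest popular
matching. -/
theorem isMinCostPopular {N : Set ℕ} {K : ℕ → ℕ} (hK : h.market.Good N K)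
    (hN : ∀ L, h.market.Popular L → h.market.Good N L)
    (hmin : ∀ L, h.market.Good N L → ∑ a ∈ range I.n₁, I.costArray (K a - 1) ≤
      ∑ a ∈ range I.n₁, I.costArray (L a - 1)) :
    Inst.IsMinCostPopular (truncate I K) := by
  have hc : ∀ a < I.n₁, complete (truncate I K) a = K a := fun a ha =>
    h.complete_truncate hK.complete.1 ha
  have hg : h.market.Good N (complete (truncate I K)) :=
    ⟨fun a ha => by rw [hc a ha]; exact hK.1 a ha,
      fun b => (load_congr hc b).trans_le (hK.2.1 b),
      fun b hb hb0 => (hK.2.2 b hb hb0).trans_eq (load_congr hc b).symm⟩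
  refine ⟨h.popular_iff.1 hg.popular, fun M' hM' => ?_⟩
  rw [totalCost_eq, totalCost_eq]
  have := hmin _ (hN _ (h.popular_iff.2 hM'))
  refine le_trans (le_of_eq ?_) this
  exact sum_congr rfl fun a ha => by rw [hc a (mem_range.1 ha)]

end Represents

end PopMatch

namespace PopMatch

open Finset

variable {p : ℕ → ℝ≥0}

/-! ## Preparation of the arrays

Further registers: `1` number of items, `2` number of given edges, `4` the rank of the last resorts.
Further arrays: `2` ranks, `3` copies, `14` people with edges, `15` ranks of the top choices. -/

/-- Read one given edge. -/
def readEdge : Prog :=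
  -- Copies are fetched edge by edge, since a pass over all items could exceed the time bound.
  .seq (.store 5 (.add (.get 1 (.var 5)) (.const 1)) (.get 3 (.get 1 (.var 5))))
    (.seq (.store 14 (.get 0 (.var 5)) (.const 1))
      -- With truncated subtraction this sets register `4` to the maximum of itself and the rank
      -- plus one, so it ends above all ranks.
      (.seq (.assign 4 (.add (.var 4) (.sub (.add (.get 2 (.var 5)) (.const 1)) (.var 4))))
        (.store 1 (.var 5) (.add (.get 1 (.var 5)) (.const 1)))))

/-- Add the last resort of one person. -/
def addLast : Prog :=
  .seq (.store 0 (.add (.var 2) (.var 5)) (.var 5))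
    (.seq (.store 1 (.add (.var 2) (.var 5)) (.add (.add (.var 1) (.var 5)) (.const 1)))
      (.seq (.store 2 (.add (.var 2) (.var 5)) (.var 4))
        (.seq (.store 5 (.add (.add (.var 1) (.var 5)) (.const 1)) (.const 1))
          (.store 15 (.var 5) (.var 4)))))

/-- Insert one edge into the list of its person, and update the rank of her top choices. -/
def insertEdge : Prog :=
  .seq (.store 8 (.var 5) (.get 7 (.get 0 (.var 5))))
    (.seq (.store 7 (.get 0 (.var 5)) (.add (.var 5) (.const 1)))
      (.branch (.and (.lt (.const 0) (.get 5 (.get 1 (.var 5))))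
          (.lt (.get 2 (.var 5)) (.get 15 (.get 0 (.var 5)))))
        (.store 15 (.get 0 (.var 5)) (.get 2 (.var 5))) .skip))

/-- The preparation of the arrays. -/
def prepare : Prog :=
  .seq (.forTo 5 2 readEdge) (.seq (.assign 3 (.add (.var 2) (.var 0)))
    (.seq (.forTo 5 0 addLast) (.forTo 5 3 insertEdge)))

/-- The arrays are prepared. -/
structure Prepared (I : Inst) (s : State) : Prop where
  r0 : s.reg 0 = I.n₁
  r1 : s.reg 1 = I.n₂
  r3 : s.reg 3 = I.m + I.n₁
  rep : Represents I (s.mem 0) (s.mem 1) (s.mem 2) (s.mem 5)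
  head : ∀ a < I.n₁, Prev (s.mem 0) (I.m + I.n₁) a (s.mem 7 a)
  nxt : ∀ e < I.m + I.n₁, Prev (s.mem 0) e (s.mem 0 e) (s.mem 8 e)
  act : ∀ a, s.mem 14 a = 1 ↔ ∃ e : Fin I.m, (I.person e : ℕ) = a
  top_le : ∀ e < I.m + I.n₁, 0 < s.mem 5 (s.mem 1 e) → s.mem 15 (s.mem 0 e) ≤ s.mem 2 e
  top_eq : ∀ a < I.n₁, ∃ e < I.m + I.n₁, s.mem 0 e = a ∧ 0 < s.mem 5 (s.mem 1 e) ∧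
    s.mem 2 e = s.mem 15 a

theorem readEdge_run (s : State) : readEdge.run p s =
    ⟨Function.update s.reg 4 (s.reg 4 + (s.mem 2 (s.reg 5) + 1 - s.reg 4)),
      Function.update (Function.update (Function.update s.mem
        5 (Function.update (s.mem 5) (s.mem 1 (s.reg 5) + 1) (s.mem 3 (s.mem 1 (s.reg 5)))))
        14 (Function.update (s.mem 14) (s.mem 0 (s.reg 5)) 1))
        1 (Function.update (s.mem 1) (s.reg 5) (s.mem 1 (s.reg 5) + 1))⟩ := by
  simp [readEdge, Prog.run, Expr.eval]

theorem addLast_run (s : State) : addLast.run p s =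
    ⟨s.reg, Function.update (Function.update (Function.update (Function.update (Function.update s.mem
        0 (Function.update (s.mem 0) (s.reg 2 + s.reg 5) (s.reg 5)))
        1 (Function.update (s.mem 1) (s.reg 2 + s.reg 5) (s.reg 1 + s.reg 5 + 1)))
        2 (Function.update (s.mem 2) (s.reg 2 + s.reg 5) (s.reg 4)))
        5 (Function.update (s.mem 5) (s.reg 1 + s.reg 5 + 1) 1))
        15 (Function.update (s.mem 15) (s.reg 5) (s.reg 4))⟩ := by
  simp [addLast, Prog.run, Expr.eval]

theorem pad_fin {α : Type} [Zero α] {n : ℕ} (v : Fin n → α) (i : Fin n) : pad v i = v i := by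
  simp [pad]

/-- The memory after reading the given edges. -/
structure ReadUpTo (I : Inst) (k : ℕ) (s : State) : Prop where
  it : ∀ e : Fin I.m, s.mem 1 e = I.item e + if (e : ℕ) < k then 1 else 0
  cap : ∀ e : Fin I.m, (e : ℕ) < k → s.mem 5 (I.item e + 1) = I.copies (I.item e)
  cap_zero : ∀ x, (∀ e : Fin I.m, (e : ℕ) < k → (I.item e + 1 : ℕ) ≠ x) → s.mem 5 x = 0
  act : ∀ a, s.mem 14 a = 1 ↔ ∃ e : Fin I.m, (e : ℕ) < k ∧ (I.person e : ℕ) = a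
  rank : ∀ e : Fin I.m, (e : ℕ) < k → I.rank e < s.reg 4

theorem readEdges_spec (I : Inst) :
    WP p (.forTo 5 2 readEdge) (6 + I.m * (40 + 8)) (ReadUpTo I I.m) I.input := by
  refine WP.forTo 40 (ReadUpTo I) rfl (by decide) (by decide) (by decide)
    (fun k s v h => ⟨h.it, h.cap, h.cap_zero, h.act, h.rank⟩) ?_ ?_ (fun _ _ h _ => h) le_rfl
  · exact ⟨fun e => by
    rw [if_neg (Nat.not_lt_zero _)]; exact pad_fin (fun e => (I.item e : ℕ)) e, fun e h => absurd h (Nat.not_lt_zero _),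
      fun x _ => rfl, fun a => by simp [Inst.input], fun e h => absurd h (Nat.not_lt_zero _)⟩
  · intro k s hF hI hk hkm
    have m0 : s.mem 0 = pad fun e => (I.person e : ℕ) := hF.mem 0 (by decide)
    have m2 : s.mem 2 = pad I.rank := hF.mem 2 (by decide)
    have m3 : s.mem 3 = pad I.copies := hF.mem 3 (by decide)
    refine WP.of_run rfl (by decide) ?_
    rw [readEdge_run, hk]
    obtain ⟨e, rfl⟩ : ∃ e : Fin I.m, (e : ℕ) = k := ⟨⟨k, hkm⟩, rfl⟩
    have e1 : s.mem 1 e = I.item e := by simpa using hI.it e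
    have e0 : s.mem 0 e = I.person e := by rw [m0]; exact pad_fin _ e
    have e2 : s.mem 2 e = I.rank e := by rw [m2]; exact pad_fin _ e
    have e3 : s.mem 3 (I.item e) = I.copies (I.item e) := by rw [m3]; exact pad_fin _ _
    rw [e1, e0, e2, e3]
    refine ⟨fun e' => ?_, fun e' he' => ?_, fun x hx => ?_, fun a => ?_, fun e' he' => ?_⟩
    · by_cases h : e' = e
      · subst h; simp
      · have h' : (e' : ℕ) ≠ e := fun h' => h (Fin.ext h')
        have : ((e' : ℕ) < e + 1) ↔ (e' : ℕ) < e := by omega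
        simpa [Function.update_of_ne h', this] using hI.it e'
    · by_cases h : (I.item e' : ℕ) + 1 = I.item e + 1
      · have : I.item e' = I.item e := Fin.ext (by omega)
        simp [this]
      · have h' : (e' : ℕ) < e := by
          rcases Nat.lt_succ_iff_lt_or_eq.1 he' with h' | h'
          · exact h'
          · exact absurd (by rw [Fin.ext h']) h
        have h2 := hI.cap e' h'
        simp only [ne_eq, OfNat.ofNat_ne_one, not_false_eq_true, Function.update_of_ne,
          Function.update_self, Nat.reduceEqDiff]
        rw [Function.update_of_ne h, h2]
    · have h1 := hx e (by omega)
      have h2 := hI.cap_zero x fun e' he' => hx e' (by omega)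
      simp only [ne_eq, OfNat.ofNat_ne_one, not_false_eq_true, Function.update_of_ne,
          Function.update_self, Nat.reduceEqDiff]
      rw [Function.update_of_ne h1.symm, h2]
    · have h1 := hI.act a
      by_cases h : a = I.person e
      · subst h
        simp only [ne_eq, OfNat.ofNat_ne_one, not_false_eq_true, Function.update_of_ne,
          Function.update_self, true_iff]
        exact ⟨e, by omega, rfl⟩
      · simp only [ne_eq, OfNat.ofNat_ne_one, not_false_eq_true, Function.update_of_ne,
          Function.update_self]
        rw [Function.update_of_ne h, h1]
        constructor
        · rintro ⟨e', h2, h3⟩; exact ⟨e', by omega, h3⟩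
        · rintro ⟨e', h2, h3⟩
          refine ⟨e', ?_, h3⟩
          rcases Nat.lt_succ_iff_lt_or_eq.1 h2 with h' | h'
          · exact h'
          · exact absurd (by rw [← h3, Fin.ext h']) h
    · simp only [Function.update_self]
      rcases Nat.lt_succ_iff_lt_or_eq.1 he' with h' | h'
      · have := hI.rank e' h'; omega
      · rw [Fin.ext h']; omega

/-- The memory after adding the last resorts of the people below `k`. -/
structure AddedUpTo (I : Inst) (k : ℕ) (s : State) : Prop where
  per : ∀ e : Fin I.m, s.mem 0 e = I.person e
  it : ∀ e : Fin I.m, s.mem 1 e = I.item e + 1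
  rk : ∀ e : Fin I.m, s.mem 2 e = I.rank e
  cap : ∀ e : Fin I.m, s.mem 5 (I.item e + 1) = I.copies (I.item e)
  per_last : ∀ a < k, s.mem 0 (I.m + a) = a
  it_last : ∀ a < k, s.mem 1 (I.m + a) = I.n₂ + a + 1
  rk_last : ∀ a < k, s.mem 2 (I.m + a) = s.reg 4
  cap_last : ∀ a < k, s.mem 5 (I.n₂ + a + 1) = 1
  cap_zero : ∀ x, (∀ e : Fin I.m, (I.item e + 1 : ℕ) ≠ x) → (∀ a < k, I.n₂ + a + 1 ≠ x) →
    s.mem 5 x = 0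
  top : ∀ a < k, s.mem 15 a = s.reg 4

theorem addLasts_spec (I : Inst) {s : State} (h0 : AddedUpTo I 0 s) (r0 : s.reg 0 = I.n₁)
    (r1 : s.reg 1 = I.n₂) (r2 : s.reg 2 = I.m) :
    WP p (.forTo 5 0 addLast) (6 + I.n₁ * (40 + 8)) (AddedUpTo I I.n₁) s := by
  refine WP.forTo 40 (AddedUpTo I) r0 (by decide) (by decide) (by decide)
    (fun k s v h => ⟨h.per, h.it, h.rk, h.cap, h.per_last, h.it_last, h.rk_last, h.cap_last,
      h.cap_zero, h.top⟩) h0 ?_ (fun _ _ h _ => h) le_rfl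
  intro k s' hF hI hk hkn
  have e1 : s'.reg 1 = I.n₂ := (hF.reg 1 (by decide)).trans r1
  have e2 : s'.reg 2 = I.m := (hF.reg 2 (by decide)).trans r2
  refine WP.of_run rfl (by decide) ?_
  rw [addLast_run, hk, e1, e2]
  have hm : ∀ e : Fin I.m, (e : ℕ) ≠ I.m + k := fun e => by have := e.2; omega
  have hi : ∀ e : Fin I.m, (I.item e : ℕ) + 1 ≠ I.n₂ + k + 1 := fun e => by
    have := (I.item e).2; omega
  refine ⟨fun e => ?_, fun e => ?_, fun e => ?_, fun e => ?_, fun a ha => ?_, fun a ha => ?_,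
    fun a ha => ?_, fun a ha => ?_, fun x hx hx' => ?_, fun a ha => ?_⟩
  · simpa [Function.update_of_ne (hm e)] using hI.per e
  · simpa [Function.update_of_ne (hm e)] using hI.it e
  · simpa [Function.update_of_ne (hm e)] using hI.rk e
  · have := hI.cap e
    simp only [ne_eq, Function.update_of_ne, Function.update_self, Nat.reduceEqDiff,
      not_false_eq_true]
    rw [Function.update_of_ne (hi e), this]
  · by_cases hak : a = k
    · subst hak; simp
    · have : I.m + a ≠ I.m + k := by omega
      simpa [Function.update_of_ne this] using hI.per_last a (by omega)
  · by_cases hak : a = k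
    · subst hak; simp
    · have : I.m + a ≠ I.m + k := by omega
      simpa [Function.update_of_ne this] using hI.it_last a (by omega)
  · by_cases hak : a = k
    · subst hak; simp
    · have : I.m + a ≠ I.m + k := by omega
      simpa [Function.update_of_ne this] using hI.rk_last a (by omega)
  · by_cases hak : a = k
    · subst hak; simp
    · have : I.n₂ + a + 1 ≠ I.n₂ + k + 1 := by omega
      have h2 := hI.cap_last a (by omega)
      simp only [ne_eq, Function.update_of_ne, Function.update_self, Nat.reduceEqDiff,
        not_false_eq_true]
      rw [Function.update_of_ne this, h2]
  · have h1 := hI.cap_zero x hx fun a ha => hx' a (by omega)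
    simp only [ne_eq, Function.update_of_ne, Function.update_self, Nat.reduceEqDiff,
        not_false_eq_true]
    rw [Function.update_of_ne (hx' k (by omega)).symm, h1]
  · by_cases hak : a = k
    · subst hak; simp
    · simpa [Function.update_of_ne hak] using hI.top a (by omega)

/-- The lists of edges and the ranks of the top choices after inserting the edges below `k`. -/
structure InsertedUpTo (I : Inst) (R : ℕ) (per it rk cap : ℕ → ℕ) (k : ℕ) (s : State) : Prop where
  head : ∀ a < I.n₁, Prev per k a (s.mem 7 a)
  nxt : ∀ e < k, Prev per e (per e) (s.mem 8 e)
  top_le : ∀ e < k, 0 < cap (it e) → s.mem 15 (per e) ≤ rk e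
  top_eq : ∀ a < I.n₁, s.mem 15 a = R ∨ ∃ e < k, per e = a ∧ 0 < cap (it e) ∧ rk e = s.mem 15 a

open Classical in
theorem insertEdge_run (s : State) : insertEdge.run p s =
    ⟨s.reg, Function.update (Function.update (Function.update s.mem
        8 (Function.update (s.mem 8) (s.reg 5) (s.mem 7 (s.mem 0 (s.reg 5)))))
        7 (Function.update (s.mem 7) (s.mem 0 (s.reg 5)) (s.reg 5 + 1)))
        15 (if 0 < s.mem 5 (s.mem 1 (s.reg 5)) ∧ s.mem 2 (s.reg 5) < s.mem 15 (s.mem 0 (s.reg 5))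
          then Function.update (s.mem 15) (s.mem 0 (s.reg 5)) (s.mem 2 (s.reg 5))
          else s.mem 15)⟩ := by
  by_cases h : 0 < s.mem 5 (s.mem 1 (s.reg 5)) ∧ s.mem 2 (s.reg 5) < s.mem 15 (s.mem 0 (s.reg 5))
  · simp [insertEdge, Prog.run, Expr.eval, Test.Holds, h]
  · have : Function.update (Function.update (Function.update s.mem
        8 (Function.update (s.mem 8) (s.reg 5) (s.mem 7 (s.mem 0 (s.reg 5)))))
        7 (Function.update (s.mem 7) (s.mem 0 (s.reg 5)) (s.reg 5 + 1))) 15 (s.mem 15) =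
        Function.update (Function.update s.mem
        8 (Function.update (s.mem 8) (s.reg 5) (s.mem 7 (s.mem 0 (s.reg 5)))))
        7 (Function.update (s.mem 7) (s.mem 0 (s.reg 5)) (s.reg 5 + 1)) := by
      rw [Function.update_eq_self_iff]
      simp
    simp [insertEdge, Prog.run, Expr.eval, Test.Holds, h, this]

theorem insertEdges_spec (I : Inst) {s : State} (r3 : s.reg 3 = I.m + I.n₁)
    (hper : ∀ e < I.m + I.n₁, s.mem 0 e < I.n₁)
    (h0 : InsertedUpTo I (s.reg 4) (s.mem 0) (s.mem 1) (s.mem 2) (s.mem 5) 0 s) :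
    WP p (.forTo 5 3 insertEdge) (6 + (I.m + I.n₁) * (50 + 8))
      (InsertedUpTo I (s.reg 4) (s.mem 0) (s.mem 1) (s.mem 2) (s.mem 5) (I.m + I.n₁)) s := by
  refine WP.forTo 50 (InsertedUpTo I (s.reg 4) (s.mem 0) (s.mem 1) (s.mem 2) (s.mem 5)) r3
    (by decide) (by decide) (by decide)
    (fun k s v h => ⟨h.head, h.nxt, h.top_le, h.top_eq⟩) h0 ?_ (fun _ _ h _ => h) le_rfl
  intro k s' hF hI hk hkm
  refine WP.of_run rfl (by decide) ?_
  rw [insertEdge_run, hk, hF.mem 0 (by decide), hF.mem 1 (by decide), hF.mem 2 (by decide),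
    hF.mem 5 (by decide)]
  refine ⟨fun a ha => ?_, fun e he => ?_, fun e he hc => ?_, fun a ha => ?_⟩
  · by_cases h : a = s.mem 0 k
    · subst h; simpa using Prev.step_eq rfl
    · simpa [Function.update_of_ne h] using (hI.head a ha).step_ne (Ne.symm h)
  · by_cases h : e = k
    · subst h; simpa using hI.head _ (hper e hkm)
    · simpa [Function.update_of_ne h] using hI.nxt e (by omega)
  · simp only [Function.update_self]
    split_ifs with h
    · by_cases h1 : s.mem 0 e = s.mem 0 k
      · rw [h1, Function.update_self]
        by_cases h2 : e = k
        · rw [h2]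
        · have := hI.top_le e (by omega) hc
          rw [h1] at this
          omega
      · rw [Function.update_of_ne h1]
        refine hI.top_le e ?_ hc
        rcases Nat.lt_succ_iff_lt_or_eq.1 he with h' | rfl
        · exact h'
        · exact absurd rfl h1
    · by_cases h2 : e = k
      · subst h2
        exact not_lt.1 fun h' => h ⟨hc, h'⟩
      · exact hI.top_le e (by omega) hc
  · simp only [Function.update_self]
    have hold := hI.top_eq a ha
    split_ifs with h
    · by_cases h1 : a = s.mem 0 k
      · subst h1
        rw [Function.update_self]
        exact Or.inr ⟨k, by omega, rfl, h.1, rfl⟩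
      · rw [Function.update_of_ne h1]
        exact hold.imp id fun ⟨e, h2, h3⟩ => ⟨e, by omega, h3⟩
    · exact hold.imp id fun ⟨e, h2, h3⟩ => ⟨e, by omega, h3⟩

theorem prepare_spec (I : Inst) : WP p prepare (200 * (I.m + I.n₁ + 1))
    (fun s => Prepared I s ∧ ∀ A, A ∉ prepare.arrs → s.mem A = I.input.mem A) I.input := by
  refine WP.mono (T := (6 + I.m * (40 + 8)) + (10 + ((6 + I.n₁ * (40 + 8)) +
    (6 + (I.m + I.n₁) * (50 + 8))))) ?_ (by omega) fun s hF h => ⟨h, fun A hA => hF.mem A hA⟩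
  refine WP.seq (readEdges_spec I) fun s1 hF1 h1 => ?_
  refine WP.seq (Q := fun s => s.reg 3 = I.m + I.n₁) (WP.of_run rfl (by decide) ?_)
    fun s2 hF2 h2 => ?_
  · have e0 : s1.reg 0 = I.n₁ := hF1.reg 0 (by decide)
    have e2 : s1.reg 2 = I.m := hF1.reg 2 (by decide)
    simp [Prog.run, Expr.eval, e0, e2]
  have r20 : s2.reg 0 = I.n₁ := (hF2.reg 0 (by decide)).trans (hF1.reg 0 (by decide))
  have r21 : s2.reg 1 = I.n₂ := (hF2.reg 1 (by decide)).trans (hF1.reg 1 (by decide))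
  have r22 : s2.reg 2 = I.m := (hF2.reg 2 (by decide)).trans (hF1.reg 2 (by decide))
  have r24 : s2.reg 4 = s1.reg 4 := hF2.reg 4 (by decide)
  have m20 : s2.mem 0 = pad fun e => (I.person e : ℕ) :=
    (hF2.mem 0 (by decide)).trans (hF1.mem 0 (by decide))
  have m21 : s2.mem 1 = s1.mem 1 := hF2.mem 1 (by decide)
  have m22 : s2.mem 2 = pad I.rank := (hF2.mem 2 (by decide)).trans (hF1.mem 2 (by decide))
  have m25 : s2.mem 5 = s1.mem 5 := hF2.mem 5 (by decide)
  have h3 : AddedUpTo I 0 s2 := by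
    refine ⟨fun e => ?_, fun e => ?_, fun e => ?_, fun e => ?_, ?_, ?_, ?_, ?_, fun x hx _ => ?_, ?_⟩
    · rw [m20]; exact pad_fin _ e
    · rw [m21, h1.it e, if_pos e.2]
    · rw [m22]; exact pad_fin _ e
    · rw [m25]; exact h1.cap e e.2
    · exact fun a ha => absurd ha (Nat.not_lt_zero _)
    · exact fun a ha => absurd ha (Nat.not_lt_zero _)
    · exact fun a ha => absurd ha (Nat.not_lt_zero _)
    · exact fun a ha => absurd ha (Nat.not_lt_zero _)
    · rw [m25]; exact h1.cap_zero x fun e _ => hx e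
    · exact fun a ha => absurd ha (Nat.not_lt_zero _)
  refine WP.seq (addLasts_spec I h3 r20 r21 r22) fun s4 hF4 h4 => ?_
  have r43 : s4.reg 3 = I.m + I.n₁ := (hF4.reg 3 (by decide)).trans h2
  have r44 : s4.reg 4 = s1.reg 4 := (hF4.reg 4 (by decide)).trans r24
  have hrep : Represents I (s4.mem 0) (s4.mem 1) (s4.mem 2) (s4.mem 5) := by
    refine ⟨h4.per, h4.it, h4.rk, h4.per_last, h4.it_last, fun a ha e => ?_, h4.cap, h4.cap_last,
      fun x hx => h4.cap_zero x (fun e => ?_) fun a ha => ?_⟩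
    · rw [h4.rk_last a ha, r44]; exact h1.rank e e.2
    · rw [← h4.it e]; exact hx e (by have := e.2; omega)
    · rw [← h4.it_last a ha]; exact hx _ (by omega)
  have m7 : s4.mem 7 = fun _ => 0 := (hF4.mem 7 (by decide)).trans
    ((hF2.mem 7 (by decide)).trans (hF1.mem 7 (by decide)))
  refine (insertEdges_spec I r43 (fun e he => hrep.per_lt he) ⟨fun a _ => ?_, ?_, ?_, fun a ha => ?_⟩).mono
    le_rfl fun s5 hF5 h5 => ?_
  · rw [m7]; exact Prev.zero _ _
  · exact fun a ha => absurd ha (Nat.not_lt_zero _)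
  · exact fun a ha => absurd ha (Nat.not_lt_zero _)
  · exact Or.inl (h4.top a ha)
  · have m0 : s5.mem 0 = s4.mem 0 := hF5.mem 0 (by decide)
    have m1 : s5.mem 1 = s4.mem 1 := hF5.mem 1 (by decide)
    have m2 : s5.mem 2 = s4.mem 2 := hF5.mem 2 (by decide)
    have m5 : s5.mem 5 = s4.mem 5 := hF5.mem 5 (by decide)
    have m14 : s5.mem 14 = s1.mem 14 := (hF5.mem 14 (by decide)).trans
      ((hF4.mem 14 (by decide)).trans (hF2.mem 14 (by decide)))
    refine ⟨?_, ?_, ?_, ?_, ?_, ?_, fun a => ?_, ?_, fun a ha => ?_⟩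
    · exact (hF5.reg 0 (by decide)).trans ((hF4.reg 0 (by decide)).trans r20)
    · exact (hF5.reg 1 (by decide)).trans ((hF4.reg 1 (by decide)).trans r21)
    · exact (hF5.reg 3 (by decide)).trans r43
    · rwa [m0, m1, m2, m5]
    · rw [m0]; exact h5.head
    · rw [m0]; exact h5.nxt
    · rw [m14, h1.act a]
      simp
    · rw [m0, m1, m2, m5]; exact h5.top_le
    · rw [m0, m1, m2, m5]
      rcases h5.top_eq a ha with h | h
      -- If no edge has lowered the initial value, it is the rank of the last resort, whose edge
      -- then attains it.
      · refine ⟨I.m + a, by omega, hrep.per_last a ha, ?_, (h4.rk_last a ha).trans h.symm⟩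
        rw [hrep.it_last a ha, hrep.cap_last a ha]
        exact one_pos
      · exact h

end PopMatch

/-! ### Reading the market off the prepared arrays -/

namespace PopMatch

open Finset

variable {p : ℕ → ℝ≥0} {I : Inst}

/-- The arrays `0`, `1`, `2`, `5`, `7`, `8`, `14`, `15` and the registers `0`, `1`, `3` are kept. -/
def Prog.KeepsPrepared (P : Prog) : Prop :=
  (∀ x ∈ [0, 1, 3], x ∉ P.regs) ∧ ∀ A ∈ [0, 1, 2, 5, 7, 8, 14, 15], A ∉ P.arrs

instance (P : Prog) : Decidable P.KeepsPrepared := inferInstanceAs (Decidable (_ ∧ _))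

theorem Frame.prepared {P : Prog} {s s' : State} (hF : Frame P s s') (hP : P.KeepsPrepared)
    (h : Prepared I s) : Prepared I s' := by
  have e0 := hF.mem 0 (hP.2 0 (by simp))
  have e1 := hF.mem 1 (hP.2 1 (by simp))
  have e2 := hF.mem 2 (hP.2 2 (by simp))
  have e5 := hF.mem 5 (hP.2 5 (by simp))
  have e7 := hF.mem 7 (hP.2 7 (by simp))
  have e8 := hF.mem 8 (hP.2 8 (by simp))
  have e14 := hF.mem 14 (hP.2 14 (by simp))
  have e15 := hF.mem 15 (hP.2 15 (by simp))
  refine ⟨(hF.reg 0 (hP.1 0 (by simp))).trans h.r0, (hF.reg 1 (hP.1 1 (by simp))).trans h.r1,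
    (hF.reg 3 (hP.1 3 (by simp))).trans h.r3, ?_, ?_, ?_, ?_, ?_, ?_⟩
  · rw [e0, e1, e2, e5]; exact h.rep
  · rw [e0, e7]; exact h.head
  · rw [e0, e8]; exact h.nxt
  · rw [e14]; exact h.act
  · rw [e0, e1, e2, e5, e15]; exact h.top_le
  · rw [e0, e1, e2, e5, e15]; exact h.top_eq

theorem Prepared.graphOk {s : State} (h : Prepared I s) : (netOf p s).GraphOk := by
  have hr := h.rep
  refine ⟨fun e he => ?_, fun e he => ?_, fun a ha => ?_, fun e he => ?_⟩ <;>
    simp only [netOf, h.r0, h.r3] at *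
  · exact hr.per_lt he
  · exact hr.it_ne he
  · exact h.head a ha
  · exact h.nxt e he

/-- The market of a prepared state. -/
def Prepared.market {s : State} (h : Prepared I s) : Market := h.rep.market

theorem Prepared.adj_iff {s : State} (h : Prepared I s) {a b : ℕ} : h.market.adj a b ↔
    ∃ e < I.m + I.n₁, s.mem 0 e = a ∧ s.mem 1 e = b ∧ 0 < s.mem 5 b := Iff.rfl

theorem Prepared.adj_edge {s : State} (h : Prepared I s) {e : ℕ} (he : e < I.m + I.n₁) :
    h.market.adj (s.mem 0 e) (s.mem 1 e) ↔ 0 < s.mem 5 (s.mem 1 e) := by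
  rw [h.adj_iff]
  constructor
  · rintro ⟨_, _, _, _, h1⟩; exact h1
  · exact fun h1 => ⟨e, he, rfl, rfl, h1⟩

theorem Prepared.rk_eq {s : State} (h : Prepared I s) {e : ℕ} (he : e < I.m + I.n₁) :
    h.market.rk (s.mem 0 e) (s.mem 1 e) = s.mem 2 e := h.rep.rk_eq he

theorem Prepared.top_edge {s : State} (h : Prepared I s) {e : ℕ} (he : e < I.m + I.n₁) :
    h.market.Top (s.mem 0 e) (s.mem 1 e) ↔
      0 < s.mem 5 (s.mem 1 e) ∧ s.mem 2 e = s.mem 15 (s.mem 0 e) := by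
  unfold Market.Top
  rw [h.adj_edge he, h.rk_eq he]
  refine and_congr_right fun hc => ⟨fun h1 => ?_, fun h1 b' => ?_⟩
  · obtain ⟨e', he', h2, h3, h4⟩ := h.top_eq _ (h.rep.per_lt he)
    have h5 := h1 (s.mem 1 e') (h2 ▸ (h.adj_edge he').2 h3)
    rw [← h2, h.rk_eq he', h4] at h5
    rw [← h2] at h5 ⊢
    have h6 := h.top_le e he hc
    rw [← h2] at h6
    exact le_antisymm h5 h6
  · rintro ⟨e', he', h2, rfl, h3⟩
    have h4 := h.top_le e' he' h3
    rw [← h2, h.rk_eq he', h1, ← h2]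
    exact h4

/-- The only edge of a person without given edges leads to her last resort. -/
theorem Prepared.inactive {s : State} (h : Prepared I s) {a e : ℕ} (ha : s.mem 14 a ≠ 1)
    (he : e < I.m + I.n₁) (hp : s.mem 0 e = a) : s.mem 1 e = I.n₂ + a + 1 := by
  rcases Represents.edge_cases he with ⟨e, rfl⟩ | ⟨a', ha', rfl⟩
  · rw [h.rep.per_inst] at hp
    exact absurd ((h.act a).2 ⟨e, hp⟩) ha
  · rw [h.rep.per_last a' ha'] at hp
    rw [h.rep.it_last a' ha', hp]

/-- The number of people with edges. -/
theorem Prepared.card_active_le {s : State} (h : Prepared I s) :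
    #{a ∈ range I.n₁ | s.mem 14 a = 1} ≤ min I.m I.n₁ := by
  refine le_min ?_ ?_
  · have : {a ∈ range I.n₁ | s.mem 14 a = 1} ⊆
        (univ : Finset (Fin I.m)).image fun e => (I.person e : ℕ) := by
      intro a ha
      obtain ⟨e, he⟩ := (h.act a).1 (mem_filter.1 ha).2
      exact mem_image.2 ⟨e, mem_univ _, he⟩
    refine (card_le_card this).trans (card_image_le.trans ?_)
    simp
  · exact (card_filter_le _ _).trans (card_range _).le

/-! ## Marking edges -/

/-- Mark the edges that pass a test. -/
def mark (c : Test) : Prog :=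
  .forTo 5 3 (.branch c (.store 9 (.var 5) (.const 1)) (.store 9 (.var 5) (.const 0)))

/-- The values of the test depend only on the counter and on the arrays other than the marks. -/
theorem mark_spec {c : Test} {s : State} (P : ℕ → Prop)
    (hc : ∀ s', Frame (mark c) s s' → s'.reg 5 < s.reg 3 → (c.Holds p s' ↔ P (s'.reg 5))) :
    WP p (mark c) (6 + s.reg 3 * (c.time + 9 + 8))
      (fun s' => ∀ e < s.reg 3, s'.mem 9 e = 1 ↔ P e) s := by
  refine WP.forTo (c.time + 9) (fun k s' => ∀ e < k, s'.mem 9 e = 1 ↔ P e) rfl (by decide)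
    (by simp [Prog.regs]) (by simp [Prog.regs]) (fun _ _ _ h => h)
    (fun e he => absurd he (Nat.not_lt_zero _)) ?_ (fun _ _ h _ => h) le_rfl
  intro k s' hF hI hk hkm
  refine WP.of_run rfl (by simp [Prog.cost, Expr.time]) ?_
  have h1 := hc s' hF (hk ▸ hkm)
  rw [hk] at h1
  intro e he
  by_cases hek : e = k
  · subst hek
    by_cases h : c.Holds p s'
    · simp [Prog.run, h, Expr.eval, hk, h1.1 h]
    · have hn : ¬P e := fun h' => h (h1.2 h')
      simp [Prog.run, h, Expr.eval, hk, hn]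
  · have h2 := hI e (by omega)
    by_cases h : c.Holds p s'
    · simpa [Prog.run, h, Expr.eval, hk, Function.update_of_ne hek] using h2
    · simpa [Prog.run, h, Expr.eval, hk, Function.update_of_ne hek] using h2

/-! ## Initial assignments -/

/-- Everybody with an edge is unmatched, the others get their last resorts. -/
def initAssignment : Prog :=
  -- A person without given edges can only hold her last resort. Seating her here spares a search,
  -- which matters when `n₁` exceeds `m`.
  .forTo 5 0 (.branch (.eq (.get 14 (.var 5)) (.const 1)) (.store 4 (.var 5) (.const 0))
    (.store 4 (.var 5) (.add (.add (.var 1) (.var 5)) (.const 1))))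

theorem initAssignment_spec {s : State} (r0 : s.reg 0 = I.n₁) (r1 : s.reg 1 = I.n₂) :
    WP p initAssignment (6 + I.n₁ * (30 + 8)) (fun s' => ∀ a < I.n₁,
      s'.mem 4 a = if s.mem 14 a = 1 then 0 else I.n₂ + a + 1) s := by
  refine WP.forTo 30 (fun k s' => ∀ a < k, s'.mem 4 a = if s.mem 14 a = 1 then 0 else I.n₂ + a + 1)
    r0 (by decide) (by decide) (by decide) (fun _ _ _ h => h)
    (fun e he => absurd he (Nat.not_lt_zero _)) ?_ (fun _ _ h _ => h) le_rfl
  intro k s' hF hI hk hkm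
  have e14 : s'.mem 14 = s.mem 14 := hF.mem 14 (by decide)
  have e1 : s'.reg 1 = I.n₂ := (hF.reg 1 (by decide)).trans r1
  refine WP.of_run rfl (by decide) ?_
  intro a ha
  by_cases hak : a = k
  · subst hak
    by_cases h : s.mem 14 a = 1 <;> simp [Prog.run, Test.Holds, Expr.eval, hk, e14, e1, h]
  · have h2 := hI a (by omega)
    by_cases h : s.mem 14 k = 1 <;>
      simpa [Prog.run, Test.Holds, Expr.eval, hk, e14, e1, h, Function.update_of_ne hak] using h2

/-- The initial assignment is optimal for its size. -/
theorem optimal_init {s : State} (h : Prepared I s)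
    (hM : ∀ a < I.n₁, s.mem 4 a = if s.mem 14 a = 1 then 0 else I.n₂ + a + 1)
    (hlast : ∀ a < I.n₁, s.mem 14 a ≠ 1 → graphOf s a (I.n₂ + a + 1)) :
    Optimal p s ∧ load (s.reg 0) (s.mem 4) 0 ≤ min I.m I.n₁ := by
  have hload : ∀ x, x ≠ 0 → ∀ a < I.n₁, s.mem 4 a = x → s.mem 14 a ≠ 1 ∧ x = I.n₂ + a + 1 := by
    intro x hx a ha hax
    rw [hM a ha] at hax
    split_ifs at hax with h1
    · exact absurd hax.symm hx
    · exact ⟨h1, hax.symm⟩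
  have hle : ∀ x, x ≠ 0 → load I.n₁ (s.mem 4) x ≤ 1 := by
    intro x hx
    refine card_le_one.2 fun c hc d hd => ?_
    obtain ⟨c1, c2⟩ := mem_filter.1 hc
    obtain ⟨d1, d2⟩ := mem_filter.1 hd
    have := (hload x hx c (mem_range.1 c1) c2).2
    have := (hload x hx d (mem_range.1 d1) d2).2
    omega
  refine ⟨⟨h.graphOk, ?_, ?_⟩, ?_⟩
  · rw [h.r0]
    refine ⟨fun a ha h0 => ?_, fun x hx => ?_⟩
    · obtain ⟨h1, h2⟩ := hload _ h0 a ha rfl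
      rw [h2]
      exact hlast a ha h1
    · refine (Nat.eq_zero_or_pos _).elim (fun h0 => h0.trans_le (Nat.zero_le _)) fun hpos => ?_
      obtain ⟨a, ha, hax⟩ := load_pos.1 hpos
      obtain ⟨h1, rfl⟩ := hload x hx a ha hax
      rw [h.rep.cap_last a ha]
      exact hle _ hx
  · rw [h.r0]
    intro T _
    -- The last resorts in use form one certificate for all lower sets: their owners have no other
    -- edge, and one person fills each of them.
    refine ⟨{x | ∃ a < I.n₁, s.mem 14 a ≠ 1 ∧ x = I.n₂ + a + 1}, ?_, ?_, ?_⟩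
    · rintro a ha ⟨a', ha', h1, h2⟩ b ⟨e, he, h3, h4, _⟩
      obtain ⟨h5, h6⟩ := hload _ (by omega) a ha h2
      obtain rfl : a' = a := by omega
      rw [h.r3] at he
      exact ⟨a', ha', h1, h4 ▸ h.inactive h1 he h3⟩
    · intro a ha h0 _
      obtain ⟨h1, h2⟩ := hload _ h0 a ha rfl
      exact ⟨a, ha, h1, h2⟩
    · rintro x ⟨⟨a, ha, h1, rfl⟩, _⟩ _
      rw [h.rep.cap_last a ha]
      exact load_pos.2 ⟨a, ha, by rw [hM a ha, if_neg h1]⟩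
  · rw [h.r0]
    refine le_trans (card_le_card fun a ha => ?_) h.card_active_le
    obtain ⟨h1, h2⟩ := mem_filter.1 ha
    refine mem_filter.2 ⟨h1, ?_⟩
    rw [hM a (mem_range.1 h1)] at h2
    split_ifs at h2 with h3
    exact h3

/-- Mark edges, start with the initial assignment, and augment as long as possible. -/
def phase (c : Test) : Prog := .seq (mark c) (.seq initAssignment maximize)

/-- The phase is run once for top choices and once for allowed edges. The condition `hlast` makes
the initial assignment legal in either graph. -/
theorem phase_spec {c : Test} {s : State} {T : ℕ} (R : ℕ → ℕ → Prop) (h : Prepared I s)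
    (hc : ∀ s', Frame (mark c) s s' → s'.reg 5 < s.reg 3 →
      (c.Holds p s' ↔ R (s'.mem 0 (s'.reg 5)) (s'.mem 1 (s'.reg 5))))
    (hR : ∀ a b, R a b → h.market.adj a b)
    (hlast : ∀ a < I.n₁, s.mem 14 a ≠ 1 → R a (I.n₂ + a + 1))
    (hT : 2000 * (I.m + I.n₁ + 1) * (min I.m I.n₁ + 1) + (I.m + I.n₁ + 1) * (c.time + 100) ≤ T) :
    WP p (phase c) T (fun s' => Prepared I s' ∧ graphOf s' = R ∧ Optimal p s' ∧ Maximal s') s := by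
  have hkp : (mark c).KeepsPrepared := by
    simp [Prog.KeepsPrepared, mark, Prog.forTo, Prog.regs, Prog.arrs]
  refine WP.mono (T := (6 + s.reg 3 * (c.time + 9 + 8)) + ((6 + I.n₁ * (30 + 8)) +
    (1000 * (I.m + 2 * I.n₁ + 1) * (min I.m I.n₁ + 1) + 20))) ?_ ?_ fun _ _ h => h
  rotate_left
  · refine le_trans ?_ hT
    rw [h.r3]
    have h1 : 1000 * (I.m + 2 * I.n₁ + 1) * (min I.m I.n₁ + 1) ≤
        2000 * (I.m + I.n₁ + 1) * (min I.m I.n₁ + 1) := Nat.mul_le_mul_right _ (by omega)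
    have h2 : (I.m + I.n₁ + 1) * (c.time + 100) =
      (I.m + I.n₁) * (c.time + 9 + 8) + (I.m + I.n₁) * 83 + (c.time + 100) := by ring
    linarith [Nat.zero_le I.m]
  refine WP.seq (mark_spec (fun e => R (s.mem 0 e) (s.mem 1 e)) fun s' hF he => ?_) fun s1 hF1 h1 => ?_
  · rw [hc s' hF he, hF.mem 0 (hkp.2 0 (by simp)), hF.mem 1 (hkp.2 1 (by simp))]
  have hp1 := hF1.prepared hkp h
  refine WP.seq (initAssignment_spec hp1.r0 hp1.r1) fun s2 hF2 h2 => ?_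
  have hp2 := hF2.prepared (by decide) hp1
  have hg : graphOf s2 = R := by
    have e9 : s2.mem 9 = s1.mem 9 := hF2.mem 9 (by decide)
    have e0 : s2.mem 0 = s.mem 0 := (hF2.mem 0 (by decide)).trans (hF1.mem 0 (hkp.2 0 (by simp)))
    have e1 : s2.mem 1 = s.mem 1 := (hF2.mem 1 (by decide)).trans (hF1.mem 1 (hkp.2 1 (by simp)))
    funext a b
    refine propext ⟨?_, fun hab => ?_⟩
    · rintro ⟨e, he, rfl, rfl, hok⟩
      rw [e0, e1]
      rw [hp2.r3, ← h.r3] at he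
      exact (h1 e he).1 (e9 ▸ hok)
    · obtain ⟨e, he, hp, hi, _⟩ := h.adj_iff.1 (hR a b hab)
      refine ⟨e, by rwa [hp2.r3], by rwa [e0], by rwa [e1], ?_⟩
      rw [e9]
      exact (h1 e (by rwa [h.r3])).2 (by rwa [hp, hi])
  have e14 : s2.mem 14 = s1.mem 14 := hF2.mem 14 (by decide)
  have e14' : s1.mem 14 = s.mem 14 := hF1.mem 14 (hkp.2 14 (by simp))
  obtain ⟨hO, hl⟩ := optimal_init (p := p) hp2 (by rw [e14]; exact h2) (by
    rw [hg, e14, e14']; exact hlast)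
  refine (maximize_spec hO ?_).mono le_rfl fun s3 hF3 h3 => ?_
  · rw [hp2.r0, hp2.r3]
    rw [hp2.r0] at hl
    have e : I.m + I.n₁ + I.n₁ + 1 = I.m + 2 * I.n₁ + 1 := by ring
    rw [e]
    exact Nat.add_le_add_right (Nat.mul_le_mul_left _ (Nat.add_le_add_right hl 1)) 20
  · refine ⟨hF3.prepared (by decide) hp2, ?_, h3⟩
    rw [(hF3.optData (p := p) (by decide) (by decide) (by decide) (by decide)).2.1, hg]

end PopMatch

namespace PopMatch

open Finset

variable {p : ℕ → ℝ≥0} {I : Inst}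

/-! ## The even items -/

/-- The items in the memory from which no free item can be reached. -/
def tightOf (s : State) : Set ℕ := tight (s.reg 0) (graphOf s) (s.mem 5) (s.mem 4)

/-- A closed set that contains the start contains all visited items, hence also the free one, and so
it is not full. -/
theorem Searched.notMem_tightOf {x : ℕ} {s : State} (h : Searched p x s) (hb : s.reg 8 ≠ 0) :
    x ∉ tightOf s := by
  intro hx
  have hQ : ∀ j < s.reg 10, s.mem 13 j ∈ tightOf s := by
    intro j
    induction j using Nat.strong_induction_on with
    | _ j ih =>
      intro hj
      rcases Nat.eq_zero_or_pos j with rfl | hj0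
      · rwa [h.vis.zero]
      · obtain ⟨a, i, _, ha, hij, hMa, hR⟩ := h.vis.parent j hj hj0
        have hi := ih i hij (hij.trans hj)
        rw [← hMa] at hi
        exact closed_tight _ _ _ _ a ha hi _ hR
  obtain ⟨⟨j, hj, _, hjb⟩, hfree, _⟩ := h.best.2 hb
  have hin := hQ j hj
  rw [hjb] at hin
  have h1 := full_tight _ _ _ _ _ hin hb
  have h2 := h.lists.used _ (hjb ▸ h.item j hj)
  exact absurd (hfree.trans_le h1) (by rw [h2]; exact lt_irrefl _)

/-- The set of visited items is closed. The search ignores the start when it looks for free items,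
so fullness of the start is a separate hypothesis. -/
theorem Searched.mem_tightOf {x : ℕ} {s : State} (h : Searched p x s) (hb : s.reg 8 = 0)
    (hx : x ≠ 0 → s.mem 5 x ≤ load (s.reg 0) (s.mem 4) x) : x ∈ tightOf s := by
  refine subset_tight h.closed ?_ ⟨0, h.vis.pos, h.vis.zero⟩
  rintro b ⟨j, hj, rfl⟩ hb0
  rcases Nat.eq_zero_or_pos j with rfl | hj0
  · rw [h.vis.zero] at hb0 ⊢
    exact hx hb0
  · exact (h.best.1 hb j hj hj0).trans (h.lists.used _ (h.item j hj)).le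

/-- Mark the free items. -/
def markFree : Prog :=
  .forTo 5 3 (.branch (.lt (.get 6 (.get 1 (.var 5))) (.get 5 (.get 1 (.var 5))))
    (.store 16 (.get 1 (.var 5)) (.const 1)) .skip)

theorem markFree_spec {s : State} (h : ∀ x, s.mem 16 x = 0) :
    WP p markFree (6 + s.reg 3 * (20 + 8)) (fun s' => ∀ x, s'.mem 16 x ≤ 1 ∧
      (s'.mem 16 x = 1 ↔ ∃ e < s.reg 3, s.mem 1 e = x ∧ s.mem 6 x < s.mem 5 x)) s := by
  refine WP.forTo 20 (fun k s' => ∀ x, s'.mem 16 x ≤ 1 ∧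
    (s'.mem 16 x = 1 ↔ ∃ e < k, s.mem 1 e = x ∧ s.mem 6 x < s.mem 5 x)) rfl (by decide) (by decide)
    (by decide) (fun _ _ _ h => h) (fun x => by simp [h x]) ?_ (fun _ _ h _ => h) le_rfl
  intro k s' hF hI hk hkm
  have e1 : s'.mem 1 = s.mem 1 := hF.mem 1 (by decide)
  have e5 : s'.mem 5 = s.mem 5 := hF.mem 5 (by decide)
  have e6 : s'.mem 6 = s.mem 6 := hF.mem 6 (by decide)
  refine WP.of_run rfl (by decide) fun x => ?_
  have hx := hI x
  by_cases hf : s.mem 6 (s.mem 1 k) < s.mem 5 (s.mem 1 k)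
  · by_cases hxk : x = s.mem 1 k
    · subst hxk
      simpa [Prog.run, Test.Holds, Expr.eval, hk, e1, e5, e6, hf] using ⟨k, le_rfl, rfl⟩
    · have : (∃ e < k + 1, s.mem 1 e = x ∧ s.mem 6 x < s.mem 5 x) ↔
          ∃ e < k, s.mem 1 e = x ∧ s.mem 6 x < s.mem 5 x := by
        refine ⟨fun ⟨e, he, h1, h2⟩ => ⟨e, ?_, h1, h2⟩, fun ⟨e, he, h1⟩ => ⟨e, by omega, h1⟩⟩
        rcases Nat.lt_succ_iff_lt_or_eq.1 he with h' | rfl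
        · exact h'
        · exact absurd h1.symm hxk
      rw [this]
      simpa [Prog.run, Test.Holds, Expr.eval, hk, e1, e5, e6, hf, Function.update_of_ne hxk] using hx
  · have : (∃ e < k + 1, s.mem 1 e = x ∧ s.mem 6 x < s.mem 5 x) ↔
        ∃ e < k, s.mem 1 e = x ∧ s.mem 6 x < s.mem 5 x := by
      refine ⟨fun ⟨e, he, h1, h2⟩ => ⟨e, ?_, h1, h2⟩, fun ⟨e, he, h1⟩ => ⟨e, by omega, h1⟩⟩
      rcases Nat.lt_succ_iff_lt_or_eq.1 he with h' | rfl
      · exact h'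
      · exact absurd (h1 ▸ h2) hf
    rw [this]
    simpa [Prog.run, Test.Holds, Expr.eval, hk, e1, e5, e6, hf] using hx

/-- Mark the items of the people with edges from which a search finds a free item. -/
def markReaching : Prog :=
  -- The counter is register `6` because the search inside uses register `5`.
  .forTo 6 0 (.branch (.eq (.get 14 (.var 6)) (.const 1))
    (.seq (.assign 7 (.get 4 (.var 6))) (.seq search
      (.branch (.eq (.var 8) (.const 0)) .skip (.store 16 (.get 4 (.var 6)) (.const 1)))))
    .skip)

/-- Free items are already marked. A full item outside the tight set must be held by a person with
given edges, so one search per such person is enough. -/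
theorem markReaching_spec {s : State} {T : ℕ} (hP : Prepared I s)
    (hM : IsPartial (s.reg 0) (graphOf s) (s.mem 5) (s.mem 4)) (h0 : 0 ∈ tightOf s)
    (h1 : ∀ x, s.mem 16 x ≤ 1) (h2 : ∀ x ∈ tightOf s, s.mem 16 x = 0)
    (h3 : ∀ x, load (s.reg 0) (s.mem 4) x < s.mem 5 x → s.mem 16 x = 1)
    (hT : 1000 * (I.m + I.n₁ + 1) * (min I.m I.n₁ + 1) ≤ T) :
    WP p markReaching T (fun s' => ∀ x, s'.mem 16 x ≤ 1 ∧ (s'.mem 16 x = 0 ↔ x ∈ tightOf s)) s := by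
  refine WP.forTo_sum
    (fun k => 20 + if s.mem 14 k = 1 then 400 * (I.m + I.n₁ + I.n₁ + 1) else 0)
    (fun k s' => (∀ x, s'.mem 16 x ≤ 1) ∧ (∀ x ∈ tightOf s, s'.mem 16 x = 0) ∧
      (∀ x, load (s.reg 0) (s.mem 4) x < s.mem 5 x → s'.mem 16 x = 1) ∧
      ∀ a < k, s.mem 14 a = 1 → s.mem 4 a ∉ tightOf s → s'.mem 16 (s.mem 4 a) = 1)
    hP.r0 (by decide) (by decide) (by decide) (fun _ _ _ h => h)
    ⟨h1, h2, h3, fun a ha => absurd ha (Nat.not_lt_zero _)⟩ ?_ ?_ ?_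
  · rintro k s' hF ⟨i1, i2, i3, i4⟩ hk hkn
    have e0 : s'.reg 0 = s.reg 0 := hF.reg 0 (by decide)
    have e3 : s'.reg 3 = s.reg 3 := hF.reg 3 (by decide)
    have m4 : s'.mem 4 = s.mem 4 := hF.mem 4 (by decide)
    have m5 : s'.mem 5 = s.mem 5 := hF.mem 5 (by decide)
    have m14 : s'.mem 14 = s.mem 14 := hF.mem 14 (by decide)
    have eg : graphOf s' = graphOf s := by
      unfold graphOf
      rw [e3, hF.mem 0 (by decide), hF.mem 1 (by decide), hF.mem 9 (by decide)]
    by_cases ha : s.mem 14 k = 1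
    swap
    · refine (WP.branch (T := 1) (fun h => absurd ?_ ha) fun _ =>
        WP.of_run rfl le_rfl ?_).mono ?_ fun _ _ h => h
      · simpa only [Test.Holds, Expr.eval, hk, m14] using h
      · refine ⟨i1, i2, i3, fun a hak ha' => ?_⟩
        rcases Nat.lt_succ_iff_lt_or_eq.1 hak with h' | rfl
        · exact i4 a h' ha'
        · exact absurd ha' ha
      · exact le_trans (by simp [Test.time, Expr.time]) (Nat.le_add_right 20 _)
    refine (WP.branch (T := 3 + (400 * (I.m + I.n₁ + I.n₁ + 1) + 10)) (fun _ => ?_)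
      fun h => absurd ?_ h).mono ?_ fun _ _ h => h
    rotate_left
    · simpa only [Test.Holds, Expr.eval, hk, m14] using ha
    · simp only [Test.time, Expr.time, if_pos ha]; linarith
    refine WP.seq (Q := fun s' => s'.reg 7 = s.mem 4 k)
      (WP.of_run rfl (by decide) (by simp [Prog.run, Expr.eval, hk, m4])) fun s1 hF1 k7 => ?_
    have r10 : s1.reg 0 = s.reg 0 := (hF1.reg 0 (by decide)).trans e0
    have r13 : s1.reg 3 = s.reg 3 := (hF1.reg 3 (by decide)).trans e3
    have r16 : s1.reg 6 = k := (hF1.reg 6 (by decide)).trans hk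
    have m14' : s1.mem 4 = s.mem 4 := (hF1.mem 4 (by decide)).trans m4
    have m15 : s1.mem 5 = s.mem 5 := (hF1.mem 5 (by decide)).trans m5
    have m116 : s1.mem 16 = s'.mem 16 := hF1.mem 16 (by decide)
    have eg1 : graphOf s1 = graphOf s := (hF1.optData (p := p) (by decide) (by decide) (by decide)
      (by decide)).2.1.trans eg
    have hG1 : (netOf p s1).GraphOk := hF1.graphOk (by decide) (hF.graphOk (by decide) hP.graphOk)
    have hitem : ∀ a < s1.reg 0, (netOf p s1).IsItem (s1.mem 4 a) := by
      refine IsPartial.isItem ?_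
      rw [r10, eg1, m15, m14']
      exact hM
    have hkn' : k < s1.reg 0 := by rw [r10, hP.r0]; exact hkn
    have h7 : (netOf p s1).IsItem (s1.reg 7) := by rw [k7, ← m14']; exact hitem k hkn'
    refine WP.seq ((search_spec hG1 hitem h7).mono ?_ fun _ _ h => h) fun s2 hF2 hS => ?_
    · rw [r10, r13, hP.r0, hP.r3]
    have r26 : s2.reg 6 = k := (hF2.reg 6 (by decide)).trans r16
    have m24 : s2.mem 4 = s.mem 4 := (hF2.mem 4 (by decide)).trans m14'
    have m25 : s2.mem 5 = s.mem 5 := (hF2.mem 5 (by decide)).trans m15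
    have r20 : s2.reg 0 = s.reg 0 := (hF2.reg 0 (by decide)).trans r10
    have m216 : s2.mem 16 = s'.mem 16 := (hF2.mem 16 (by decide)).trans m116
    have eg2 : graphOf s2 = graphOf s := (hF2.optData (p := p) (by decide) (by decide) (by decide)
      (by decide)).2.1.trans eg1
    have et : tightOf s2 = tightOf s := by unfold tightOf; rw [r20, eg2, m25, m24]
    rw [k7] at hS
    refine WP.of_run rfl (by decide) ?_
    by_cases hb : s2.reg 8 = 0
    · have hrun : (Prog.branch (.eq (.var 8) (.const 0)) .skip
          (.store 16 (.get 4 (.var 6)) (.const 1))).run p s2 = s2 := by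
        simp [Prog.run, Test.Holds, Expr.eval, hb]
      rw [hrun, m216]
      refine ⟨i1, i2, i3, fun a hak ha' hx => ?_⟩
      rcases Nat.lt_succ_iff_lt_or_eq.1 hak with h' | rfl
      · exact i4 a h' ha' hx
      · by_contra hne
        refine hx (et ▸ hS.mem_tightOf hb fun _ => ?_)
        rw [m25, r20, m24]
        exact not_lt.1 fun hlt => hne (i3 _ hlt)
    · have hx := hS.notMem_tightOf hb
      rw [et] at hx
      have hrun : ((Prog.branch (.eq (.var 8) (.const 0)) .skip
          (.store 16 (.get 4 (.var 6)) (.const 1))).run p s2).mem 16 =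
          Function.update (s'.mem 16) (s.mem 4 k) 1 := by
        simp [Prog.run, Test.Holds, Expr.eval, hb, m216, m24, r26]
      rw [hrun]
      have hup : ∀ x, s'.mem 16 x = 1 → Function.update (s'.mem 16) (s.mem 4 k) 1 x = 1 := by
        intro x h
        by_cases hxk : x = s.mem 4 k
        · rw [hxk, Function.update_self]
        · rw [Function.update_of_ne hxk, h]
      refine ⟨fun x => ?_, fun x h => ?_, fun x h => hup x (i3 x h), fun a hak ha' h => ?_⟩
      · by_cases hxk : x = s.mem 4 k
        · rw [hxk, Function.update_self]
        · rw [Function.update_of_ne hxk]; exact i1 x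
      · rw [Function.update_of_ne fun hxk : x = s.mem 4 k => hx (hxk ▸ h)]; exact i2 x h
      · rcases Nat.lt_succ_iff_lt_or_eq.1 hak with h' | rfl
        · exact hup _ (i4 a h' ha' h)
        · exact Function.update_self ..
  · rintro s' hF ⟨i1, i2, i3, i4⟩ _ x
    refine ⟨i1 x, fun hx => ?_, i2 x⟩
    by_cases hx0 : x = 0
    · rw [hx0]; exact h0
    have hfull : s.mem 5 x ≤ load (s.reg 0) (s.mem 4) x := not_lt.1 fun h => by
      have := i3 x h; omega
    by_cases hact : ∃ a < I.n₁, s.mem 14 a = 1 ∧ s.mem 4 a = x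
    · obtain ⟨a, ha, ha', rfl⟩ := hact
      by_contra hnot
      have := i4 a ha ha' hnot
      omega
    -- If `x` is full and held by no person with given edges, any holder has `x` as her only edge.
    -- So `x` alone is a closed full set.
    · refine subset_tight (Z := {x}) ?_ ?_ rfl
      · rintro a ha rfl b ⟨e, he, hp, hi, _⟩
        have ha' : s.mem 14 a ≠ 1 := fun h => hact ⟨a, hP.r0 ▸ ha, h, rfl⟩
        obtain ⟨e', he', hp', hi', _⟩ := hM.1 a ha hx0
        rw [hP.r3] at he he'
        rw [Set.mem_singleton_iff, ← hi, ← hi', hP.inactive ha' he hp, hP.inactive ha' he' hp']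
      · rintro b rfl _
        exact hfull
  · have hs : ∑ k ∈ range I.n₁, ((20 + if s.mem 14 k = 1 then 400 * (I.m + I.n₁ + I.n₁ + 1) else 0) + 8)
        = I.n₁ * 28 + #{a ∈ range I.n₁ | s.mem 14 a = 1} * (400 * (I.m + I.n₁ + I.n₁ + 1)) := by
      have : ∀ k ∈ range I.n₁,
          ((20 + if s.mem 14 k = 1 then 400 * (I.m + I.n₁ + I.n₁ + 1) else 0) + 8) =
            28 + if s.mem 14 k = 1 then 400 * (I.m + I.n₁ + I.n₁ + 1) else 0 := by
        intro k _
        generalize (if s.mem 14 k = 1 then 400 * (I.m + I.n₁ + I.n₁ + 1) else 0) = v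
        omega
      rw [sum_congr rfl this, sum_add_distrib, ← sum_filter]
      simp
    rw [hs]
    refine le_trans ?_ hT
    -- Only people with given edges are charged for a search, and there are at most `min m n₁` of
    -- them.
    have h4 := Nat.mul_le_mul_right (400 * (I.m + I.n₁ + I.n₁ + 1)) hP.card_active_le
    have h5 : 400 * (I.m + I.n₁ + I.n₁ + 1) ≤ 800 * (I.m + I.n₁ + 1) := by linarith [Nat.zero_le I.m]
    have h6 := Nat.mul_le_mul_left (min I.m I.n₁) h5
    have h7 : 1000 * (I.m + I.n₁ + 1) * (min I.m I.n₁ + 1) =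
      min I.m I.n₁ * (800 * (I.m + I.n₁ + 1)) + 200 * (min I.m I.n₁ * (I.m + I.n₁ + 1)) +
        1000 * (I.m + I.n₁ + 1) := by ring
    rw [h7]
    linarith [Nat.zero_le I.m, Nat.zero_le (min I.m I.n₁ * (I.m + I.n₁ + 1))]

/-- Mark the items from which a free item can be reached. -/
def markEven : Prog := .seq markFree markReaching

theorem markEven_spec {s : State} {T : ℕ} (hP : Prepared I s) (hO : Optimal p s) (hX : Maximal s)
    (h16 : ∀ x, s.mem 16 x = 0) (hT : 1100 * (I.m + I.n₁ + 1) * (min I.m I.n₁ + 1) ≤ T) :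
    WP p markEven T (fun s' => ∀ x, s'.mem 16 x ≤ 1 ∧ (s'.mem 16 x = 0 ↔ x ∈ tightOf s)) s := by
  -- A free item has positive capacity and therefore occurs in an edge, so the pass over the edges
  -- sees all of them.
  have hitem : ∀ x, load (s.reg 0) (s.mem 4) x < s.mem 5 x ↔
      ∃ e < s.reg 3, s.mem 1 e = x ∧ s.mem 6 x < s.mem 5 x := by
    intro x
    constructor
    · intro hx
      obtain ⟨e, he, rfl⟩ : ∃ e < I.m + I.n₁, s.mem 1 e = x := by
        by_contra h
        push Not at h
        have := hP.rep.cap_zero x h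
        omega
      rw [← hP.r3] at he
      exact ⟨e, he, rfl, by rwa [hX.1 e he]⟩
    · rintro ⟨e, he, rfl, h⟩
      rwa [hX.1 e he] at h
  refine WP.mono (T := (6 + s.reg 3 * (20 + 8)) + 1000 * (I.m + I.n₁ + 1) * (min I.m I.n₁ + 1))
    (WP.seq (markFree_spec h16) fun s1 hF1 h1 => ?_) ?_ fun _ _ h => h
  · have e0 : s1.reg 0 = s.reg 0 := hF1.reg 0 (by decide)
    have m4 : s1.mem 4 = s.mem 4 := hF1.mem 4 (by decide)
    have m5 : s1.mem 5 = s.mem 5 := hF1.mem 5 (by decide)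
    have eg : graphOf s1 = graphOf s := by
      unfold graphOf
      rw [hF1.reg 3 (by decide), hF1.mem 0 (by decide), hF1.mem 1 (by decide),
        hF1.mem 9 (by decide)]
    have et : tightOf s1 = tightOf s := by unfold tightOf; rw [e0, eg, m5, m4]
    rw [← et]
    refine markReaching_spec (hF1.prepared (by decide) hP) ?_ ?_ (fun x => (h1 x).1) (fun x hx => ?_)
      (fun x hx => ?_) le_rfl
    · rw [e0, eg, m5, m4]; exact hO.isPartial
    · rw [et]; exact hX.2
    · have hx0 : s1.mem 16 x ≠ 1 := fun h => by
        have h2 := (h1 x).2.1 h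
        rw [← hitem] at h2
        rw [et] at hx
        by_cases hx0 : x = 0
        · obtain ⟨e, he, h3, _⟩ := (h1 x).2.1 h
          exact hP.rep.it_ne (hP.r3 ▸ he) (h3.trans hx0)
        · exact absurd h2 (not_lt.2 (full_tight _ _ _ _ x hx hx0))
      have := (h1 x).1
      omega
    · rw [e0, m4, m5] at hx
      exact (h1 x).2.2 ((hitem x).1 hx)
  · refine le_trans ?_ hT
    rw [hP.r3]
    have h7 : 1100 * (I.m + I.n₁ + 1) * (min I.m I.n₁ + 1) =
      1000 * (I.m + I.n₁ + 1) * (min I.m I.n₁ + 1) +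
        100 * (min I.m I.n₁ * (I.m + I.n₁ + 1)) + 100 * (I.m + I.n₁ + 1) := by ring
    rw [h7]
    linarith [Nat.zero_le I.m, Nat.zero_le (min I.m I.n₁ * (I.m + I.n₁ + 1))]

end PopMatch

namespace PopMatch

open Finset

variable {p : ℕ → ℝ≥0} {I : Inst}

/-! ## The allowed edges -/

/-- The edge `5` has the rank `top` of its person. -/
def topTest : Test :=
  .and (.lt (.const 0) (.get 5 (.get 1 (.var 5)))) (.eq (.get 2 (.var 5)) (.get 15 (.get 0 (.var 5))))

/-- Store, for every person, the smallest rank of her edges to even items, plus `1`. -/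
def evenRanks : Prog :=
  .forTo 5 3 (.branch (.and
      (.and (.lt (.const 0) (.get 5 (.get 1 (.var 5)))) (.eq (.get 16 (.get 1 (.var 5))) (.const 1)))
      (.not (.and (.lt (.const 0) (.get 17 (.get 0 (.var 5))))
        (.lt (.get 17 (.get 0 (.var 5))) (.add (.get 2 (.var 5)) (.const 2))))))
    (.store 17 (.get 0 (.var 5)) (.add (.get 2 (.var 5)) (.const 1))) .skip)

/-- The smallest rank of the edges below `k` from `a` to even items, plus `1`, is `v`. -/
def IsEvenRank (s : State) (k a v : ℕ) : Prop :=
  (∀ e < k, s.mem 0 e = a → 0 < s.mem 5 (s.mem 1 e) → s.mem 16 (s.mem 1 e) = 1 →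
    0 < v ∧ v ≤ s.mem 2 e + 1) ∧
  (v ≠ 0 → ∃ e < k, s.mem 0 e = a ∧ 0 < s.mem 5 (s.mem 1 e) ∧ s.mem 16 (s.mem 1 e) = 1 ∧
    v = s.mem 2 e + 1)

theorem IsEvenRank.skip {s : State} {k a v : ℕ} (h : IsEvenRank s k a v)
    (hk : s.mem 0 k = a → 0 < s.mem 5 (s.mem 1 k) → s.mem 16 (s.mem 1 k) = 1 →
      0 < v ∧ v ≤ s.mem 2 k + 1) : IsEvenRank s (k + 1) a v := by
  refine ⟨fun e he => ?_, fun hv => ?_⟩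
  · rcases Nat.lt_succ_iff_lt_or_eq.1 he with h' | rfl
    · exact h.1 e h'
    · exact hk
  · obtain ⟨e, he, h'⟩ := h.2 hv
    exact ⟨e, by omega, h'⟩

theorem IsEvenRank.step {s : State} {k v : ℕ} (h : IsEvenRank s k (s.mem 0 k) v)
    (hc : 0 < s.mem 5 (s.mem 1 k)) (he : s.mem 16 (s.mem 1 k) = 1)
    (hv : 0 < v → s.mem 2 k + 1 < v) : IsEvenRank s (k + 1) (s.mem 0 k) (s.mem 2 k + 1) := by
  refine ⟨fun e hek h1 h2 h3 => ⟨Nat.succ_pos _, ?_⟩, fun _ => ⟨k, k.lt_succ_self, rfl, hc, he, rfl⟩⟩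
  rcases Nat.lt_succ_iff_lt_or_eq.1 hek with h' | rfl
  · obtain ⟨h4, h5⟩ := h.1 e h' h1 h2 h3
    have := hv h4
    omega
  · exact le_rfl

theorem evenRanks_spec {s : State} (h17 : ∀ a, s.mem 17 a = 0) :
    WP p evenRanks (6 + s.reg 3 * (60 + 8)) (fun s' => ∀ a, IsEvenRank s (s.reg 3) a (s'.mem 17 a))
      s := by
  refine WP.forTo 60 (fun k s' => ∀ a, IsEvenRank s k a (s'.mem 17 a)) rfl (by decide) (by decide)
    (by decide) (fun _ _ _ h => h)
    (fun a => ⟨fun e he => absurd he (Nat.not_lt_zero _), fun h => absurd (h17 a) h⟩) ?_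
    (fun _ _ h _ => h) le_rfl
  intro k s' hF hI hk hkm
  have e0 : s'.mem 0 = s.mem 0 := hF.mem 0 (by decide)
  have e1 : s'.mem 1 = s.mem 1 := hF.mem 1 (by decide)
  have e2 : s'.mem 2 = s.mem 2 := hF.mem 2 (by decide)
  have e5 : s'.mem 5 = s.mem 5 := hF.mem 5 (by decide)
  have e16 : s'.mem 16 = s.mem 16 := hF.mem 16 (by decide)
  refine WP.of_run rfl (by decide) fun a => ?_
  have ha := hI a
  simp only [Prog.run, Test.Holds, Expr.eval, hk, e0, e1, e2, e5, e16]
  split_ifs with hc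
  · obtain ⟨⟨h1, h2⟩, h3⟩ := hc
    simp only [Function.update_self]
    by_cases hak : a = s.mem 0 k
    · subst hak
      rw [Function.update_self]
      exact ha.step h1 h2 (by omega)
    · rw [Function.update_of_ne hak]
      exact ha.skip fun h => absurd h.symm hak
  · refine ha.skip fun h1 h2 h3 => ?_
    subst h1
    by_contra h4
    exact hc ⟨⟨h2, h3⟩, by omega⟩

/-- The edge `5` is allowed. -/
def allowedTest : Test :=
  .and (.lt (.const 0) (.get 5 (.get 1 (.var 5)))) (.not (.and
    (.not (.and (.eq (.get 16 (.get 1 (.var 5))) (.const 1))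
      (.eq (.get 17 (.get 0 (.var 5))) (.add (.get 2 (.var 5)) (.const 1)))))
    (.not (.and (.not (.eq (.get 16 (.get 1 (.var 5))) (.const 1)))
      (.and (.eq (.get 2 (.var 5)) (.get 15 (.get 0 (.var 5))))
        (.not (.eq (.get 17 (.get 0 (.var 5))) (.add (.get 2 (.var 5)) (.const 1)))))))))

/-- Two minima per person decide everything: array `15` holds her top rank, and array `17` her best
rank among items outside `N`, shifted by one so that `0` means none. She has a top item outside `N`
exactly if the two ranks agree. -/
theorem Prepared.allowed_edge {s : State} (h : Prepared I s) {N : Set ℕ}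
    (hN : ∀ x, s.mem 16 x ≤ 1 ∧ (s.mem 16 x = 0 ↔ x ∈ N))
    (hr : ∀ a, IsEvenRank s (I.m + I.n₁) a (s.mem 17 a)) {e : ℕ} (he : e < I.m + I.n₁) :
    h.market.Allowed N (s.mem 0 e) (s.mem 1 e) ↔ 0 < s.mem 5 (s.mem 1 e) ∧
      ((s.mem 16 (s.mem 1 e) = 1 ∧ s.mem 17 (s.mem 0 e) = s.mem 2 e + 1) ∨
        (s.mem 16 (s.mem 1 e) ≠ 1 ∧ s.mem 2 e = s.mem 15 (s.mem 0 e) ∧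
          s.mem 17 (s.mem 0 e) ≠ s.mem 2 e + 1)) := by
  have hN' : ∀ x, x ∉ N ↔ s.mem 16 x = 1 := fun x => by
    rw [← (hN x).2]
    have := (hN x).1
    omega
  have hNN : ∀ x, x ∈ N ↔ s.mem 16 x ≠ 1 := fun x => by rw [ne_eq, ← hN', not_not]
  have hr := hr (s.mem 0 e)
  unfold Market.Allowed
  rw [h.adj_edge he]
  refine and_congr_right fun hc => or_congr ?_ ?_
  · rw [hN']
    refine and_congr_right fun hev => ⟨fun h1 => ?_, fun h1 b' hb' hadj => ?_⟩
    · obtain ⟨h2, h3⟩ := hr.1 e he rfl hc hev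
      obtain ⟨e', he', h4, h5, h6, h7⟩ := hr.2 h2.ne'
      have h8 := h1 (s.mem 1 e') ((hN' _).2 h6) (by rw [← h4, h.adj_edge he']; exact h5)
      rw [h.rk_eq he, ← h4, h.rk_eq he'] at h8
      omega
    · obtain ⟨e', he', h4, rfl, h5⟩ := h.adj_iff.1 hadj
      have h6 := (hr.1 e' he' h4 h5 ((hN' _).1 hb')).2
      rw [h.rk_eq he, ← h4, h.rk_eq he']
      omega
  · rw [hNN, h.top_edge he]
    refine and_congr_right fun hev => ⟨fun ⟨h1, h2⟩ => ⟨h1.2, fun h3 => ?_⟩, fun ⟨h1, h2⟩ =>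
      ⟨⟨hc, h1⟩, fun b' hb' htop => ?_⟩⟩
    · obtain ⟨e', he', h4, h5, h6, h7⟩ := hr.2 (by omega)
      refine h2 (s.mem 1 e') ((hN' _).2 h6) ?_
      have := h.top_edge he'
      rw [h4] at this
      rw [this]
      exact ⟨h5, by have := h1.2; omega⟩
    · obtain ⟨e', he', h4, rfl, h5⟩ := h.adj_iff.1 htop.1
      obtain ⟨h6, h7⟩ := hr.1 e' he' h4 h5 ((hN' _).1 hb')
      -- The best rank outside `N` is at most that of the supposed top item `b'` and at least the
      -- top rank. It would equal the rank of `e`, which the test excludes.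
      obtain ⟨e'', he'', h8, h9, h10, h11⟩ := hr.2 h6.ne'
      have h12 := h.top_le e'' he'' h9
      have h13 := h.top_edge he'
      rw [h4] at h13
      have := (h13.1 htop).2
      rw [h8] at h12
      omega

/-! ## The output -/

/-- Clear the register `19` if some number below the register `n` passes a test. -/
def refute (n : ℕ) (c : Test) : Prog := .forTo 5 n (.branch c (.assign 19 (.const 0)) .skip)

theorem refute_spec {n : ℕ} {c : Test} {s : State} (P : ℕ → Prop) (hn : n ≠ 5) (hn' : n ≠ 19)
    (hs : s.reg 19 ≤ 1)
    (hc : ∀ s', Frame (refute n c) s s' → s'.reg 5 < s.reg n → (c.Holds p s' ↔ P (s'.reg 5))) :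
    WP p (refute n c) (6 + s.reg n * (c.time + 4 + 8))
      (fun s' => s'.reg 19 ≤ 1 ∧ (s'.reg 19 = 1 ↔ s.reg 19 = 1 ∧ ∀ e < s.reg n, ¬ P e)) s := by
  refine WP.forTo (c.time + 4)
    (fun k s' => s'.reg 19 ≤ 1 ∧ (s'.reg 19 = 1 ↔ s.reg 19 = 1 ∧ ∀ e < k, ¬ P e)) rfl hn.symm
    (by simp [Prog.regs]) (by simpa [Prog.regs] using hn')
    (fun _ _ _ h => by simpa [State.setReg] using h) ⟨hs, by simp⟩ ?_ (fun _ _ h _ => h) le_rfl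
  rintro k s' hF ⟨h1, h2⟩ hk hkm
  have h3 := hc s' hF (hk ▸ hkm)
  rw [hk] at h3
  refine WP.of_run rfl (by simp only [Prog.cost, Expr.time]; omega) ?_
  by_cases h : c.Holds p s'
  · have : ¬ ∀ e < k + 1, ¬ P e := fun h' => h' k k.lt_succ_self (h3.1 h)
    simp only [Prog.run, h, Expr.eval, if_true, Function.update_self, this, and_false]
    simp
  · have : (∀ e < k + 1, ¬ P e) ↔ ∀ e < k, ¬ P e := by
      refine ⟨fun h' e he => h' e (by omega), fun h' e he => ?_⟩
      rcases Nat.lt_succ_iff_lt_or_eq.1 he with h4 | rfl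
      · exact h' e h4
      · exact fun h5 => h (h3.2 h5)
    rw [this]
    simpa [Prog.run, h] using ⟨h1, h2⟩

/-- Remove the last resorts. -/
def removeLast : Prog :=
  .forTo 5 0 (.branch (.lt (.var 1) (.get 4 (.var 5))) (.store 4 (.var 5) (.const 0)) .skip)

theorem removeLast_spec {s : State} :
    WP p removeLast (6 + s.reg 0 * (20 + 8)) (fun s' => ∀ a < s.reg 0,
      s'.mem 4 a = if s.reg 1 < s.mem 4 a then 0 else s.mem 4 a) s := by
  refine WP.forTo 20 (fun k s' => ∀ a, s'.mem 4 a =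
      if a < k ∧ s.reg 1 < s.mem 4 a then 0 else s.mem 4 a) rfl (by decide) (by decide) (by decide)
    (fun _ _ _ h => h) (fun a => by simp) ?_ (fun s' _ h _ a ha => by simp [h a, ha]) le_rfl
  intro k s' hF hI hk hkm
  have e1 : s'.reg 1 = s.reg 1 := hF.reg 1 (by decide)
  have hIk : s'.mem 4 k = s.mem 4 k := by simp [hI k]
  refine WP.of_run rfl (by decide) fun a => ?_
  simp only [Prog.run, Test.Holds, Expr.eval, hk, e1, hIk]
  have ha := hI a
  by_cases hak : a = k
  · subst hak
    by_cases h : s.reg 1 < s.mem 4 a <;> simp [h, hIk]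
  · have e : a < k + 1 ↔ a < k := by omega
    simp only [e, ← ha]
    by_cases h : s.reg 1 < s.mem 4 k <;> simp [h, hak]

/-- The verdict: is everybody matched, and are the odd items used to capacity? -/
def finish : Prog :=
  .seq (.assign 19 (.const 1)) (.seq (refute 0 (.eq (.get 4 (.var 5)) (.const 0)))
    (.seq (refute 3 (.and (.eq (.get 16 (.get 1 (.var 5))) (.const 0))
        (.lt (.get 6 (.get 1 (.var 5))) (.get 5 (.get 1 (.var 5))))))
      (.seq removeLast (.assign 0 (.var 19)))))

theorem finish_spec {s : State} (h : Prepared I s) :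
    WP p finish (200 * (I.m + I.n₁ + 1)) (fun s' => s'.reg 0 ≤ 1 ∧
      (s'.reg 0 = 1 ↔ (∀ a < I.n₁, s.mem 4 a ≠ 0) ∧ ∀ e < I.m + I.n₁,
        s.mem 16 (s.mem 1 e) = 0 → s.mem 5 (s.mem 1 e) ≤ s.mem 6 (s.mem 1 e)) ∧
      ∀ a < I.n₁, s'.mem 4 a = if I.n₂ < s.mem 4 a then 0 else s.mem 4 a) s := by
  have hT : 2 + ((6 + I.n₁ * (4 + 4 + 8)) + ((6 + (I.m + I.n₁) * (13 + 4 + 8)) +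
      ((6 + I.n₁ * (20 + 8)) + 2))) ≤ 200 * (I.m + I.n₁ + 1) := by omega
  refine WP.mono ?_ hT fun _ _ h => h
  refine WP.seq (Q := fun s' => s'.reg 19 = 1)
    (WP.of_run rfl (by decide) (by simp [Prog.run, Expr.eval])) fun s1 hF1 h1 => ?_
  have hp1 := hF1.prepared (by decide) h
  refine WP.seq ((refute_spec (fun a => s.mem 4 a = 0) (by decide) (by decide) h1.le
    fun s' hF _ => ?_).mono ?_ fun _ _ h => h) fun s2 hF2 h2 => ?_
  · simp only [Test.Holds, Expr.eval, hF.mem 4 (by decide), hF1.mem 4 (by decide)]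
  · rw [hp1.r0]; exact le_rfl
  have hp2 := hF2.prepared (by decide) hp1
  refine WP.seq ((refute_spec (fun e => s.mem 16 (s.mem 1 e) = 0 ∧
    s.mem 6 (s.mem 1 e) < s.mem 5 (s.mem 1 e)) (by decide) (by decide) h2.1
    fun s' hF _ => ?_).mono ?_ fun _ _ h => h) fun s3 hF3 h3 => ?_
  · simp only [Test.Holds, Expr.eval, hF.mem 16 (by decide), hF.mem 1 (by decide),
      hF.mem 5 (by decide), hF.mem 6 (by decide), hF2.mem 16 (by decide), hF2.mem 1 (by decide),
      hF2.mem 5 (by decide), hF2.mem 6 (by decide), hF1.mem 16 (by decide), hF1.mem 1 (by decide),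
      hF1.mem 5 (by decide), hF1.mem 6 (by decide)]
  · rw [hp2.r3]; exact le_rfl
  have hp3 := hF3.prepared (by decide) hp2
  refine WP.seq (removeLast_spec.mono (by rw [hp3.r0]) fun _ _ h => h) fun s4 hF4 h4 => ?_
  have m4 : s3.mem 4 = s.mem 4 := (hF3.mem 4 (by decide)).trans <| (hF2.mem 4 (by decide)).trans
    (hF1.mem 4 (by decide))
  have r19 : s4.reg 19 = s3.reg 19 := hF4.reg 19 (by decide)
  rw [hp3.r0, hp3.r1, m4] at h4
  rw [h2.2, hp1.r0, hp2.r3] at h3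
  refine WP.of_run rfl (by decide) ⟨?_, ?_, ?_⟩
  · simpa [Prog.run, Expr.eval, r19] using h3.1
  · simp only [Prog.run, Expr.eval, r19, Function.update_self, h3.2, h1, true_and, not_and, not_lt]

  · exact h4

end PopMatch

namespace PopMatch

open Finset

variable {p : ℕ → ℝ≥0} {I : Inst}

/-! ## The algorithm -/

/-- The market is built from a proof about the arrays of one state. This identifies the markets of
states that share these arrays. -/
theorem Represents.market_congr {per it rk cap per' it' rk' cap' : ℕ → ℕ}
    (h : Represents I per it rk cap) (h' : Represents I per' it' rk' cap') (hp : per' = per)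
    (hi : it' = it) (hr : rk' = rk) (hc : cap' = cap) : h'.market = h.market := by
  subst hp hi hr hc
  rfl

theorem Prepared.market_frame {P : Prog} {s s' : State} (hF : Frame P s s') (hP : P.KeepsPrepared)
    (h : Prepared I s) : (hF.prepared hP h).market = h.market :=
  h.rep.market_congr _ (hF.mem 0 (hP.2 0 (by simp))) (hF.mem 1 (hP.2 1 (by simp)))
    (hF.mem 2 (hP.2 2 (by simp))) (hF.mem 5 (hP.2 5 (by simp)))

section Verdict

variable {s : State} {N : Set ℕ} (h : Prepared I s) (hN : ∀ x, s.mem 16 x = 0 ↔ x ∈ N)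
  (hg : graphOf s = h.market.Allowed N) (hO : Optimal p s) (hX : Maximal s)

-- The program can test goodness because allowed edges and capacities are guaranteed by the matching
-- phase. What remains is whether all people are matched and all items of `N` are full.
include hN hg hO hX in
theorem Prepared.good_iff : h.market.Good N (s.mem 4) ↔ (∀ a < I.n₁, s.mem 4 a ≠ 0) ∧
    ∀ e < I.m + I.n₁, s.mem 16 (s.mem 1 e) = 0 → s.mem 5 (s.mem 1 e) ≤ s.mem 6 (s.mem 1 e) := by
  have hused := hX.1
  have hP := hO.isPartial
  rw [h.r3, h.r0] at hused
  rw [h.r0, hg] at hP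
  constructor
  · rintro ⟨h1, _, h3⟩
    refine ⟨fun a ha => h.market.pos (h1 a ha).1, fun e he h0 => ?_⟩
    rw [hused e he]
    exact h3 _ ((hN _).1 h0) (h.rep.it_ne he)
  · rintro ⟨h1, h2⟩
    refine ⟨fun a ha => hP.1 a ha (h1 a ha), fun b => ?_, fun b hb hb0 => ?_⟩
    · by_cases hb : b = 0
      · subst hb
        refine (Nat.eq_zero_or_pos _).elim (fun h0 => h0.trans_le (Nat.zero_le _)) fun hpos => ?_
        obtain ⟨a, ha, h0⟩ := load_pos.1 hpos
        exact absurd h0 (h1 a ha)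
      · exact hP.2 b hb
    · by_cases hbe : ∃ e < I.m + I.n₁, s.mem 1 e = b
      · obtain ⟨e, he, rfl⟩ := hbe
        exact (h2 e he ((hN _).2 hb)).trans (hused e he).le
      · push Not at hbe
        -- Items that occur in no edge have capacity `0` in the array and are full for trivial
        -- reasons.
        exact (h.rep.cap_zero b hbe).trans_le (Nat.zero_le _)

-- If some good assignment exists, it matches everybody along allowed edges. A matching that no path
-- to a free item improves must then match everybody, too, and its certificate makes it good and
-- cheapest.
include hN hg hX in
theorem Prepared.good_and_cheapest (hO : Optimal I.costArray s) (hev : ∀ x, s.mem 16 x ≤ 1)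
    {K : ℕ → ℕ} (hK : h.market.Good N K) : h.market.Good N (s.mem 4) ∧
      ∑ a ∈ range I.n₁, I.costArray (s.mem 4 a - 1) ≤ ∑ a ∈ range I.n₁, I.costArray (K a - 1) := by
  have hP := hO.isPartial
  have hopt := hO.isOpt
  obtain ⟨_, Z, hZ1, hZ2, hZ0⟩ := hX
  rw [h.r0, hg] at hP hopt hZ1
  rw [h.r0] at hZ2
  have hload : load I.n₁ (s.mem 4) 0 ≤ load I.n₁ K 0 :=
    (IsPartial.transfer ⟨fun a ha _ => hK.1 a ha, fun b _ => hK.2.1 b⟩ hZ0 hZ1 hZ2).1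
  have hK0 : load I.n₁ K 0 = 0 := by
    by_contra hne
    obtain ⟨a, ha, h0⟩ := load_pos.1 (Nat.pos_of_ne_zero hne)
    exact h.market.pos (hK.1 a ha).1 h0
  have hM : ∀ a < I.n₁, s.mem 4 a ≠ 0 := fun a ha h0 => by
    have := load_pos.2 ⟨a, ha, h0⟩
    omega
  refine IsOpt.good_and_cheapest (G := h.market) hN hev hopt (fun b => ?_)
    (fun a ha => hP.1 a ha (hM a ha)) hK
  by_cases hb : b = 0
  · subst hb
    exact (hload.trans hK0.le).trans (Nat.zero_le _)
  · exact hP.2 b hb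

end Verdict

theorem outputs_truncate {s : State} {K : ℕ → ℕ}
    (h : ∀ a < I.n₁, s.mem 4 a = if I.n₂ < K a then 0 else K a) :
    Inst.Outputs s (truncate I K) := by
  intro a
  rw [h a a.2]
  unfold truncate
  by_cases h1 : I.n₂ < K a
  · rw [if_pos h1, dif_neg (by omega)]
    rfl
  · rw [if_neg h1]
    by_cases h2 : K a = 0
    · rw [dif_neg (by omega), h2]
      rfl
    · rw [dif_pos (⟨h2, by omega⟩ : K a ≠ 0 ∧ K a - 1 < I.n₂)]
      simp only [Option.elim_some]
      omega

/-- The algorithm for instances with edges. -/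
def solve : Prog :=
  .seq prepare (.seq (phase topTest) (.seq markEven (.seq evenRanks
    (.seq (phase allowedTest) finish))))

/-- What the algorithm has to achieve. -/
def Solves (I : Inst) (s : State) : Prop :=
  ((∃ M : I.Assignment, Inst.IsPopular M) →
    s.reg 0 = 1 ∧ ∃ M : I.Assignment, Inst.IsMinCostPopular M ∧ Inst.Outputs s M) ∧
  ((¬ ∃ M : I.Assignment, Inst.IsPopular M) → s.reg 0 = 0)

theorem phase_topTest_spec {s : State} (h : Prepared I s) :
    WP p (phase topTest) (3000 * ((I.m + I.n₁ + 1) * (min I.m I.n₁ + 1))) (fun s' =>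
      Prepared I s' ∧ graphOf s' = h.market.Top ∧ Optimal p s' ∧ Maximal s') s := by
  refine phase_spec h.market.Top h (fun s' hF he => ?_) (fun a b hab => hab.1)
    (fun a ha h14 => ?_) ?_
  · have e0 : s'.mem 0 = s.mem 0 := hF.mem 0 (by decide)
    have e1 : s'.mem 1 = s.mem 1 := hF.mem 1 (by decide)
    have e2 : s'.mem 2 = s.mem 2 := hF.mem 2 (by decide)
    have e5 : s'.mem 5 = s.mem 5 := hF.mem 5 (by decide)
    have e15 : s'.mem 15 = s.mem 15 := hF.mem 15 (by decide)
    rw [e0, e1, h.top_edge (by rwa [← h.r3])]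
    simp only [topTest, Test.Holds, Expr.eval, e0, e1, e2, e5, e15]
  · refine ⟨h.market.adj_last ha, fun b hb => ?_⟩
    obtain ⟨e, he, hp, rfl, _⟩ := h.adj_iff.1 hb
    rw [h.inactive h14 he hp]
  · have ht : topTest.time = 12 := rfl
    rw [ht]
    nlinarith [Nat.zero_le ((I.m + I.n₁ + 1) * min I.m I.n₁)]

theorem phase_allowedTest_spec {s : State} {N : Set ℕ} (h : Prepared I s)
    (hN : ∀ x, s.mem 16 x ≤ 1 ∧ (s.mem 16 x = 0 ↔ x ∈ N))
    (hr : ∀ a, IsEvenRank s (I.m + I.n₁) a (s.mem 17 a)) :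
    WP p (phase allowedTest) (3000 * ((I.m + I.n₁ + 1) * (min I.m I.n₁ + 1))) (fun s' =>
      Prepared I s' ∧ graphOf s' = h.market.Allowed N ∧ Optimal p s' ∧ Maximal s') s := by
  refine phase_spec (h.market.Allowed N) h (fun s' hF he => ?_) (fun a b hab => hab.1)
    (fun a ha h14 => ?_) ?_
  · have e0 : s'.mem 0 = s.mem 0 := hF.mem 0 (by decide)
    have e1 : s'.mem 1 = s.mem 1 := hF.mem 1 (by decide)
    have e2 : s'.mem 2 = s.mem 2 := hF.mem 2 (by decide)
    have e5 : s'.mem 5 = s.mem 5 := hF.mem 5 (by decide)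
    have e15 : s'.mem 15 = s.mem 15 := hF.mem 15 (by decide)
    have e16 : s'.mem 16 = s.mem 16 := hF.mem 16 (by decide)
    have e17 : s'.mem 17 = s.mem 17 := hF.mem 17 (by decide)
    rw [e0, e1, h.allowed_edge hN hr (by rwa [← h.r3])]
    simp only [allowedTest, Test.Holds, Expr.eval, e0, e1, e2, e5, e15, e16, e17]
    tauto
  · have honly : ∀ b, h.market.adj a b → b = I.n₂ + a + 1 := fun b hb => by
      obtain ⟨e, he, hp, rfl, _⟩ := h.adj_iff.1 hb
      exact h.inactive h14 he hp
    refine ⟨h.market.adj_last ha, ?_⟩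
    by_cases hb : I.n₂ + a + 1 ∈ N
    · refine Or.inr ⟨hb, ⟨h.market.adj_last ha, fun b hb => by rw [honly b hb]⟩, fun b hb' htop => ?_⟩
      exact hb' (honly b htop.1 ▸ hb)
    · exact Or.inl ⟨hb, fun b _ hb => by rw [honly b hb]⟩
  · have ht : allowedTest.time ≤ 60 := by decide
    have := Nat.mul_le_mul_left (I.m + I.n₁ + 1) (Nat.add_le_add_right ht 100)
    nlinarith [Nat.zero_le ((I.m + I.n₁ + 1) * min I.m I.n₁)]

/-- Popular assignments are good, and if a good one exists the computed one is good and cheapest.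
Conversely, a computed assignment that passes the final test is good and hence popular, so the
verdict is right in both directions. -/
theorem solve_spec (I : Inst) :
    WP I.costArray solve (10000 * ((I.m + I.n₁ + 1) * (min I.m I.n₁ + 1))) (Solves I) I.input := by
  obtain ⟨X, hX⟩ : ∃ X, X = (I.m + I.n₁ + 1) * (min I.m I.n₁ + 1) := ⟨_, rfl⟩
  have hLX : I.m + I.n₁ + 1 ≤ X := hX ▸ Nat.le_mul_of_pos_right _ (Nat.succ_pos _)
  rw [← hX]
  refine WP.mono (T := 200 * (I.m + I.n₁ + 1) + (3000 * X + (1100 * X + ((6 + (I.m + I.n₁) * 68) +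
    (3000 * X + 200 * (I.m + I.n₁ + 1)))))) ?_ (by linarith [Nat.zero_le X]) fun _ _ h => h
  refine WP.seq (prepare_spec I) fun s1 hF1 ⟨h1, hz⟩ => ?_
  refine WP.seq (hX ▸ phase_topTest_spec h1) fun s2 hF2 ⟨h2, hg2, hO2, hX2⟩ => ?_
  have m16 : s2.mem 16 = fun _ => 0 :=
    (hF2.mem 16 (by decide)).trans (hz 16 (by decide))
  have m17 : s2.mem 17 = fun _ => 0 :=
    (hF2.mem 17 (by decide)).trans (hz 17 (by decide))
  have hm2 : h2.market = h1.market := Prepared.market_frame hF2 (by decide) h1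
  have hcap : s2.mem 5 = h2.market.cap := rfl
  refine WP.seq (markEven_spec h2 hO2 hX2 (fun x => by rw [m16])
    (by rw [mul_assoc, ← hX])) fun s3 hF3 h16 => ?_
  have h3 := hF3.prepared (by decide) h2
  have hm3 : h3.market = h2.market := Prepared.market_frame hF3 (by decide) h2
  have m17' : s3.mem 17 = fun _ => 0 := (hF3.mem 17 (by decide)).trans m17
  refine WP.seq ((evenRanks_spec fun a => by rw [m17']).mono (by rw [h3.r3]) fun _ _ h => h)
    fun s4 hF4 h17 => ?_
  have h4 := hF4.prepared (by decide) h3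
  have hm4 : h4.market = h3.market := Prepared.market_frame hF4 (by decide) h3
  have m416 : s4.mem 16 = s3.mem 16 := hF4.mem 16 (by decide)
  have h17' : ∀ a, IsEvenRank s4 (I.m + I.n₁) a (s4.mem 17 a) := by
    intro a
    have := h17 a
    unfold IsEvenRank at this ⊢
    rwa [← h3.r3, m416, hF4.mem 0 (by decide), hF4.mem 1 (by decide), hF4.mem 2 (by decide),
      hF4.mem 5 (by decide)]
  set N := tightOf s2
  rw [← m416] at h16
  refine WP.seq (hX ▸ phase_allowedTest_spec h4 h16 h17') fun s5 hF5 ⟨h5, hg5, hO5, hX5⟩ => ?_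
  have hm5 : h5.market = h4.market := Prepared.market_frame hF5 (by decide) h4
  have m516 : s5.mem 16 = s4.mem 16 := hF5.mem 16 (by decide)
  rw [← m516] at h16
  rw [← hm5] at hg5
  have hm : h5.market = h2.market := hm5.trans (hm4.trans hm3)
  have hpop : ∀ L, h5.market.Popular L → h5.market.Good N L := by
    intro L hL
    -- The tight set was read off the state after the first phase. It is rewritten in terms of the
    -- market of the last state, where the top choices are the same.
    have hNe : N = tight h5.market.n h5.market.Top h5.market.cap (s2.mem 4) := by
      rw [hm, hm2, ← hg2, ← hm2]
      change tight (s2.reg 0) _ _ _ = tight I.n₁ _ _ _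
      rw [h2.r0]
      rfl
    rw [hNe]
    refine hL.good ?_ (hNe ▸ hX2.2)
    have := hO2.isPartial
    rw [hg2, h2.r0, hcap, ← hm2, ← hm] at this
    exact this
  have hev : ∀ x, s5.mem 16 x = 0 ↔ x ∈ N := fun x => (h16 x).2
  have hgood := h5.good_iff hev hg5 hO5 hX5
  have hbest : ∀ {K}, h5.market.Good N K → _ := fun {K} hK =>
    h5.good_and_cheapest hev hg5 hX5 hO5 (fun x => (h16 x).1) hK
  refine (finish_spec h5).mono le_rfl fun s6 _ ⟨h6, hv, hout⟩ => ⟨?_, fun hno => ?_⟩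
  · rintro ⟨L, hL⟩
    have hK := (hbest (hpop _ (h5.rep.popular_iff.2 hL))).1
    exact ⟨hv.2 (hgood.1 hK), truncate I (s5.mem 4),
      h5.rep.isMinCostPopular hK hpop fun L hL => (hbest hL).2, outputs_truncate hout⟩
  · by_contra hne
    have hK := hgood.2 (hv.1 (by omega))
    exact hno ⟨_, (h5.rep.isMinCostPopular hK hpop fun L hL => (hbest hL).2).1⟩

/-- The algorithm. -/
def program : Prog := .branch (.eq (.var 2) (.const 0)) (.assign 0 (.const 1)) solve

theorem eq_none_of_m_eq_zero (hm : I.m = 0) {M : I.Assignment} (hM : Inst.IsMatching M) :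
    M = fun _ => none := by
  funext a
  rcases ha : M a with _ | b
  · rfl
  · obtain ⟨_, e, _⟩ := hM.1 a b ha
    exact absurd e.2 (by omega)

theorem isMinCostPopular_of_m_eq_zero (hm : I.m = 0) :
    Inst.IsMinCostPopular (fun _ => none : I.Assignment) := by
  have h : Inst.IsMatching (fun _ => none : I.Assignment) := ⟨by simp, by simp [Inst.used]⟩
  refine ⟨⟨h, fun M' hM' => ?_⟩, fun M' hM' => ?_⟩
  · rw [eq_none_of_m_eq_zero hm hM']
    exact lt_irrefl _
  · rw [eq_none_of_m_eq_zero hm hM'.1]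

theorem program_spec (I : Inst) :
    WP I.costArray program (100000 * (I.m * I.n₁ + 1)) (Solves I) I.input := by
  have htest : (Test.eq (.var 2) (.const 0)).Holds I.costArray I.input ↔ I.m = 0 := Iff.rfl
  by_cases hm : I.m = 0
  · refine (WP.branch (T := 2) (fun _ => WP.of_run rfl le_rfl ?_) fun h =>
      absurd (htest.2 hm) h).mono ?_ fun _ _ h => h
    · have h0 := isMinCostPopular_of_m_eq_zero hm
      refine ⟨fun _ => ⟨by simp [Prog.run, Expr.eval], _, h0, fun a => ?_⟩, fun h => ?_⟩
      -- With no edges the time bound is a constant, so no array can be traversed. The untouched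
      -- array `4` already encodes the empty matching.
      · rfl
      · exact absurd ⟨_, h0.1⟩ h
    · have : 6 ≤ 100000 * (I.m * I.n₁ + 1) := by linarith [Nat.zero_le (I.m * I.n₁)]
      exact this
  · have hm1 : 1 ≤ I.m := Nat.one_le_iff_ne_zero.2 hm
    have hn1 : 1 ≤ I.n₁ := (Nat.zero_le _).trans_lt (I.person ⟨0, hm1⟩).2
    refine (WP.branch (fun h => absurd (htest.1 h) hm) fun _ => solve_spec I).mono ?_ fun _ _ h => h
    -- Since `m` and `n₁` are positive, the first factor is at most three times their maximum and
    -- the second at most twice their minimum, and the product of maximum and minimum is `m * n₁`.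
    have key : (I.m + I.n₁ + 1) * (min I.m I.n₁ + 1) ≤ 6 * (I.m * I.n₁) := by
      rcases le_total I.m I.n₁ with h | h
      · rw [min_eq_left h]
        calc (I.m + I.n₁ + 1) * (I.m + 1) ≤ (3 * I.n₁) * (2 * I.m) :=
              Nat.mul_le_mul (by omega) (by omega)
          _ = 6 * (I.m * I.n₁) := by ring
      · rw [min_eq_right h]
        calc (I.m + I.n₁ + 1) * (I.n₁ + 1) ≤ (3 * I.m) * (2 * I.n₁) :=
              Nat.mul_le_mul (by omega) (by omega)
          _ = 6 * (I.m * I.n₁) := by ring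
    change 3 + 1 + 10000 * ((I.m + I.n₁ + 1) * (min I.m I.n₁ + 1)) ≤ _
    linarith [Nat.zero_le (I.m * I.n₁)]

end PopMatch

theorem mainTheorem4 :
    ∃ (P : PopMatch.Prog) (C : ℕ), ∀ I : PopMatch.Inst,
      ∃ (t : ℕ) (s : PopMatch.State),
        PopMatch.Exec I.costArray P I.input t s ∧
        t ≤ C * (I.m * I.n₁ + 1) ∧
        ((∃ M : I.Assignment, PopMatch.Inst.IsPopular M) →
          s.reg 0 = 1 ∧
            ∃ M : I.Assignment, PopMatch.Inst.IsMinCostPopular M ∧ PopMatch.Inst.Outputs s M) ∧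
        ((¬ ∃ M : I.Assignment, PopMatch.Inst.IsPopular M) → s.reg 0 = 0) :=
  ⟨PopMatch.program, 100000, PopMatch.program_spec⟩
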